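/- Let $I\subset\mathbb{R}$ be a nonempty open interval with $0\notin I$, let $Y,Z,W\colon I\to\mathbb{R}$ be smooth, and consider on $I\times\mathbb{R}^3$, with coordinates $(u,r,x,y)$, the plane wave metric in Bondi–Pirani–Robinson (Rosen) form $$ds^2=-e^{2Y}\,du\,dr+u^2\cosh 2Z\,(dx^2+dy^2)+u^2\sinh 2Z\cos 2W\,(dx^2-dy^2)-2u^2\sinh 2Z\sin 2W\,dx\,dy .$$ Assume that the metric is vacuum (its Ricci tensor vanishes) and that its Weyl tensor vanishes at no point. A canonical tetrad on an open set is a smooth complex null tetrad $(\ell,n,m,\bar m)$, with $\ell\cdot n=-1$, $m\cdot\bar m=1$ and all other products zero, for which the Newman–Penrose Weyl scalars satisfy $\Psi_0=\Psi_1=\Psi_2=\Psi_3=0$ and $\Psi_4=1$. The wave is called linearly polarized if around every point there is a canonical tetrad and the spin coefficient $\gamma_c=\tfrac12\,(m_{a;b}\bar m^a n^b-\ell_{a;b}n^a n^b)$ of every canonical tetrad is real-valued. Then the following are equivalent: 1. the wave is linearly polarized; 2. there are global coordinates in which $W'=0$, that is, there is a smooth diffeomorphism from $I\times\mathbb{R}^3$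 onto $\tilde I\times\mathbb{R}^3$, for some nonempty open interval $\tilde I\not\ni 0$, which carries the metric to a metric of the above form with smooth functions $\tilde Y,\tilde Z,\tilde W$ on $\tilde I$ and $\tilde W'=0$ on $\tilde I$; 3. there are local coordinates in which $W'=0$, that is, every point of $I\times\mathbb{R}^3$ has an open neighbourhood with a smooth diffeomorphism onto an open subset of some such $\tilde I\times\mathbb{R}^3$, which carries the metric to a metric of the above form with $\tilde W'=0$ on $\tilde I$. -/

import Mathlib

open scoped ContDiff

noncomputable section

namespace PlaneWave

/-- Coordinate space of a four-dimensional spacetime chart. -/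
abbrev Coord : Type := Fin 4 → ℝ

/-- A field of metric components `g p a b = g_{ab}(p)` on a chart. -/
abbrev MetricField : Type := Coord → Matrix (Fin 4) (Fin 4) ℝ

/-- The coordinate derivative `∂_a f` at `p`. -/
def pd {E : Type*} [NormedAddCommGroup E] [NormedSpace ℝ E]
    (a : Fin 4) (f : Coord → E) (p : Coord) : E :=
  fderiv ℝ f p (Pi.single a 1)

/-- Christoffel symbols `Γ^a_{bc}` of the Levi-Civita connection. -/
def christoffel (g : MetricField) (a b c : Fin 4) (p : Coord) : ℝ :=
  (1 / 2) * ∑ d, (g p)⁻¹ a d *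
    (pd b (fun q => g q d c) p + pd c (fun q => g q d b) p - pd d (fun q => g q b c) p)

/-- The curvature components `R^a_{bcd}`. -/
def riemannUp (g : MetricField) (a b c d : Fin 4) (p : Coord) : ℝ :=
  pd c (christoffel g a d b) p - pd d (christoffel g a c b) p
    + ∑ e, (christoffel g a c e p * christoffel g e d b p
        - christoffel g a d e p * christoffel g e c b p)

/-- The curvature components `R_{abcd}`. -/
def riemann (g : MetricField) (a b c d : Fin 4) (p : Coord) : ℝ :=
  ∑ e, g p a e * riemannUp g e b c d p

/-- The Ricci tensor `R_{bd} = R^a_{bad}`. -/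
def ricci (g : MetricField) (b d : Fin 4) (p : Coord) : ℝ :=
  ∑ a, riemannUp g a b a d p

/-- The scalar curvature. -/
def scalarCurvature (g : MetricField) (p : Coord) : ℝ :=
  ∑ b, ∑ d, (g p)⁻¹ b d * ricci g b d p

/-- The Weyl tensor `C_{abcd}` in dimension four. -/
def weyl (g : MetricField) (a b c d : Fin 4) (p : Coord) : ℝ :=
  riemann g a b c d p
    - (1 / 2) * (g p a c * ricci g b d p - g p a d * ricci g b c p
        - g p b c * ricci g a d p + g p b d * ricci g a c p)
    + (scalarCurvature g p / 6) * (g p a c * g p b d - g p a d * g p b c)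

/-- The vacuum equations on a region. -/
def IsVacuumOn (g : MetricField) (U : Set Coord) : Prop :=
  ∀ p ∈ U, ∀ a b, ricci g a b p = 0

/-- The Weyl tensor vanishes at no point of the region. -/
def WeylNowhereZeroOn (g : MetricField) (U : Set Coord) : Prop :=
  ∀ p ∈ U, ∃ a b c d, weyl g a b c d p ≠ 0

/-- The complex-bilinear extension of the metric to complex tangent vectors at `p`. -/
def inner4 (g : MetricField) (p : Coord) (v w : Fin 4 → ℂ) : ℂ :=
  ∑ a, ∑ b, (g p a b : ℂ) * v a * w b

/-- The Weyl tensor evaluated on complex tangent vectors at `p`. -/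
def weylC (g : MetricField) (p : Coord) (v w x y : Fin 4 → ℂ) : ℂ :=
  ∑ a, ∑ b, ∑ c, ∑ d, (weyl g a b c d p : ℂ) * v a * w b * x c * y d

/-- The covariant derivative `∇_X Y` at `p` of a complex vector field `Y`
along a complex tangent vector `X`. -/
def covDeriv (g : MetricField) (X : Fin 4 → ℂ) (Y : Coord → Fin 4 → ℂ) (p : Coord) :
    Fin 4 → ℂ :=
  fun a => ∑ b, X b * (pd b (fun q => Y q a) p + ∑ c, (christoffel g a b c p : ℂ) * Y p c)

/-- A quadruple `(ℓ, n, m, m̄)` with `ℓ`, `n` real and `m` complex. -/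
structure Tetrad where
  l : Coord → Fin 4 → ℝ
  n : Coord → Fin 4 → ℝ
  m : Coord → Fin 4 → ℂ

namespace Tetrad

/-- `ℓ` as a complex vector field. -/
def lC (T : Tetrad) (p : Coord) : Fin 4 → ℂ := fun a => (T.l p a : ℂ)

/-- `n` as a complex vector field. -/
def nC (T : Tetrad) (p : Coord) : Fin 4 → ℂ := fun a => (T.n p a : ℂ)

/-- The complex conjugate `m̄`. -/
def mBar (T : Tetrad) (p : Coord) : Fin 4 → ℂ := fun a => (starRingEnd ℂ) (T.m p a)

/-- `T` is a smooth complex null tetrad on `V` (signature `(-,+,+,+)`): the only nonzero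
products are `ℓ · n = -1` and `m · m̄ = 1`. -/
structure IsNullOn (T : Tetrad) (g : MetricField) (V : Set Coord) : Prop where
  smooth_l : ContDiffOn ℝ ∞ T.l V
  smooth_n : ContDiffOn ℝ ∞ T.n V
  smooth_m : ContDiffOn ℝ ∞ T.m V
  l_l : ∀ p ∈ V, inner4 g p (T.lC p) (T.lC p) = 0
  n_n : ∀ p ∈ V, inner4 g p (T.nC p) (T.nC p) = 0
  l_n : ∀ p ∈ V, inner4 g p (T.lC p) (T.nC p) = -1
  l_m : ∀ p ∈ V, inner4 g p (T.lC p) (T.m p) = 0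
  n_m : ∀ p ∈ V, inner4 g p (T.nC p) (T.m p) = 0
  m_m : ∀ p ∈ V, inner4 g p (T.m p) (T.m p) = 0
  m_mBar : ∀ p ∈ V, inner4 g p (T.m p) (T.mBar p) = 1

/-- The Newman–Penrose Weyl scalar `Ψ₀`. -/
def psi0 (T : Tetrad) (g : MetricField) (p : Coord) : ℂ :=
  weylC g p (T.lC p) (T.m p) (T.lC p) (T.m p)

/-- The Newman–Penrose Weyl scalar `Ψ₁`. -/
def psi1 (T : Tetrad) (g : MetricField) (p : Coord) : ℂ :=
  weylC g p (T.lC p) (T.nC p) (T.lC p) (T.m p)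

/-- The Newman–Penrose Weyl scalar `Ψ₂`. -/
def psi2 (T : Tetrad) (g : MetricField) (p : Coord) : ℂ :=
  weylC g p (T.lC p) (T.m p) (T.mBar p) (T.nC p)

/-- The Newman–Penrose Weyl scalar `Ψ₃`. -/
def psi3 (T : Tetrad) (g : MetricField) (p : Coord) : ℂ :=
  weylC g p (T.lC p) (T.nC p) (T.mBar p) (T.nC p)

/-- The Newman–Penrose Weyl scalar `Ψ₄`. -/
def psi4 (T : Tetrad) (g : MetricField) (p : Coord) : ℂ :=
  weylC g p (T.mBar p) (T.nC p) (T.mBar p) (T.nC p)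

/-- The Newman–Penrose spin coefficient
`γ = ½ (m_{a;b} m̄^a n^b - ℓ_{a;b} n^a n^b)` (signature `(-,+,+,+)`). -/
def gamma (T : Tetrad) (g : MetricField) (p : Coord) : ℂ :=
  (1 / 2) * (inner4 g p (covDeriv g (T.nC p) T.m p) (T.mBar p)
    - inner4 g p (covDeriv g (T.nC p) T.lC p) (T.nC p))

/-- `T` is a canonical tetrad on `V`: a null tetrad adapted to the type N Weyl tensor
and normalized by `Ψ₄ = 1`. -/
structure IsCanonicalOn (T : Tetrad) (g : MetricField) (V : Set Coord) : Prop
    extends IsNullOn T g V where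
  psi0_eq : ∀ p ∈ V, T.psi0 g p = 0
  psi1_eq : ∀ p ∈ V, T.psi1 g p = 0
  psi2_eq : ∀ p ∈ V, T.psi2 g p = 0
  psi3_eq : ∀ p ∈ V, T.psi3 g p = 0
  psi4_eq : ∀ p ∈ V, T.psi4 g p = 1

end Tetrad

/-- `z` is the value at `p` of the spin coefficient `γ` of a canonical tetrad defined
on some neighbourhood of `p` inside `U`. -/
def IsCartanGamma (g : MetricField) (U : Set Coord) (p : Coord) (z : ℂ) : Prop :=
  ∃ (V : Set Coord) (T : Tetrad),
    IsOpen V ∧ p ∈ V ∧ V ⊆ U ∧ T.IsCanonicalOn g V ∧ T.gamma g p = z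

/-- Linear polarization: canonical tetrads exist around every point and the Cartan
invariant `γ_c`, computed in any of them, is real-valued. -/
def IsLinearlyPolarizedOn (g : MetricField) (U : Set Coord) : Prop :=
  ∀ p ∈ U, (∃ z, IsCartanGamma g U p z) ∧ ∀ z, IsCartanGamma g U p z → z.im = 0

/-- The data of a Bondi–Pirani–Robinson form of a plane wave: an open interval of values of
`u`, not containing `0`, and three smooth functions on it. -/
structure BPRForm where
  I : Set ℝ
  isOpen : IsOpen I
  ordConnected : I.OrdConnected
  nonempty : I.Nonempty
  zero_notMem : (0 : ℝ) ∉ I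
  Y : ℝ → ℝ
  Z : ℝ → ℝ
  W : ℝ → ℝ
  smooth_Y : ContDiffOn ℝ ∞ Y I
  smooth_Z : ContDiffOn ℝ ∞ Z I
  smooth_W : ContDiffOn ℝ ∞ W I

namespace BPRForm

/-- The coordinate domain: `u ∈ I`, with `r`, `x`, `y` arbitrary. -/
def region (B : BPRForm) : Set Coord := {p | p 0 ∈ B.I}

/-- In coordinates `(u, r, x, y)`,
`ds² = -e^{2Y} du dr + u² cosh 2Z (dx² + dy²) + u² sinh 2Z cos 2W (dx² - dy²)
  - 2 u² sinh 2Z sin 2W dx dy`. -/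
def metric (B : BPRForm) : MetricField := fun p =>
  let u := p 0
  let k := -(Real.exp (2 * B.Y u) / 2)
  let c := u ^ 2 * Real.cosh (2 * B.Z u)
  let d := u ^ 2 * (Real.sinh (2 * B.Z u) * Real.cos (2 * B.W u))
  let s := -(u ^ 2 * (Real.sinh (2 * B.Z u) * Real.sin (2 * B.W u)))
  !![0, k, 0, 0;
     k, 0, 0, 0;
     0, 0, c + d, s;
     0, 0, s, c - d]

end BPRForm

/-- `e` is a smooth change of coordinates, defined on `e.source`, which turns the metric
components `g` into the metric components `g'`. -/
structure IsCoordinateChange (e : OpenPartialHomeomorph Coord Coord) (g g' : MetricField) :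
    Prop where
  smooth : ContDiffOn ℝ ∞ e e.source
  smooth_symm : ContDiffOn ℝ ∞ e.symm e.target
  metric_eq : ∀ p ∈ e.source, ∀ a b,
    g p a b = ∑ c, ∑ d, pd a (fun q => e q c) p * pd b (fun q => e q d) p * g' (e p) c d

/-- Coordinates with `W' = 0` exist globally: one Bondi–Pirani–Robinson form with `W' = 0` is
related to `B` by a coordinate change between the full coordinate domains. -/
def HasGlobalConstantWForm (B : BPRForm) : Prop :=
  ∃ (B' : BPRForm) (e : OpenPartialHomeomorph Coord Coord),
    (∀ u ∈ B'.I, deriv B'.W u = 0) ∧ e.source = B.region ∧ e.target = B'.region ∧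
      IsCoordinateChange e B.metric B'.metric

/-- Coordinates with `W' = 0` exist locally: around every point there are coordinates in which
the metric has a Bondi–Pirani–Robinson form with `W' = 0`. -/
def HasLocalConstantWForm (B : BPRForm) : Prop :=
  ∀ p ∈ B.region, ∃ (B' : BPRForm) (e : OpenPartialHomeomorph Coord Coord),
    (∀ u ∈ B'.I, deriv B'.W u = 0) ∧ p ∈ e.source ∧ e.source ⊆ B.region ∧
      e.target ⊆ B'.region ∧ IsCoordinateChange e B.metric B'.metric

end PlaneWave

end

/-! Everything takes place in the transverse plane. In Rosen form 2k du dr + h_ij(u) dx^i dx^j the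
curvature is carried by one symmetric 2×2 matrix, the profile H = ½h'' − ¼h'h⁻¹h' − ½(k'/k)h'
(`RosenForm.riemann_eq`). The vacuum equations make H trace-free with respect to h, and the Weyl
condition makes it nonzero.

A canonical tetrad is then rigid (`RosenForm.m_transverse`): ℓ is a multiple of ∂_r, the transverse
part of m satisfies h(m,m) = 0 and h(m,m̄) = 1, and (n^u)² H(m,m) = −1. Differentiating the last
relation along n and taking imaginary parts shows that Im γ vanishes exactly where det(h, H, H')
does, the three forms being read as vectors in the three-dimensional space of symmetric forms
(`RosenForm.im_gamma_eq_zero_iff`). Linear polarization thus says that the principal axes of the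
wave do not rotate, a condition on u that no longer involves the tetrad.

Local coordinates with W' = 0 imply linear polarization because canonical tetrads and γ are natural
under coordinate changes (`Tetrad.IsCanonicalOn.pushforward`), so γ may be computed in those
coordinates. There h stays in a fixed plane of symmetric matrices, hence so do H and H', and the
determinant is zero.

Conversely, factor h = EᵀE with a parallel coframe: E' = SE, where S = 1/u + T and T is symmetric
and trace-free with entries X, K. In this frame the vacuum profile is T' + (2/u − 2Y')T =
u⁻²e^{2Y}(u²e^{−2Y}T)'. If the determinant vanishes, the direction of this trace-free matrix is
constant, so a constant rotation of E makes it diagonal. This does not force K = 0, only K = c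
e^{2Y}/u² (`BPRForm.exists_aligned_coframe`). Since the profile is now diagonal, the two components
α, β of Ew, for a constant vector w, solve uncoupled equations, and diag(α, β) is another transverse
frame of the same wave. The coordinate change replaces E by this frame, at the price of shifting r
by a quadratic function of x, y.

The difficulty is to do this globally: αβ must be positive on all of I. But αβ/u² has derivative
K(α² + β²)/u², which has one sign, so the sets of directions in which αβ/u² ≥ 0 are nested and
compact, and some direction works on the whole interval (`Coframe.exists_pos_of_K_pos` and its
companions). The new radial coordinate satisfies ũ² = αβ. A quarter turn of the coframe changes the
sign of c, which is chosen with cu ≥ 0 to make ũ increasing. -/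

open scoped ContDiff

noncomputable section

namespace PlaneWave

/-! ### Coordinate derivatives -/

section PartialDerivatives

variable {E : Type*} [NormedAddCommGroup E] [NormedSpace ℝ E]

theorem pd_congr {f g : Coord → E} {p : Coord} (h : f =ᶠ[nhds p] g) (a : Fin 4) :
    pd a f p = pd a g p := by
  simp only [pd, h.fderiv_eq]

theorem pd_congr_of_isOpen {f g : Coord → E} {U : Set Coord} (hU : IsOpen U)
    (h : ∀ q ∈ U, f q = g q) {p : Coord} (hp : p ∈ U) (a : Fin 4) : pd a f p = pd a g p :=
  pd_congr (Filter.eventually_of_mem (hU.mem_nhds hp) h) a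

theorem pd_mul {𝔸 : Type*} [NormedCommRing 𝔸] [NormedAlgebra ℝ 𝔸] {f g : Coord → 𝔸} {p : Coord}
    (hf : DifferentiableAt ℝ f p) (hg : DifferentiableAt ℝ g p) (a : Fin 4) :
    pd a (fun q => f q * g q) p = pd a f p * g p + f p * pd a g p := by
  simp only [pd, fderiv_fun_mul hf hg, add_apply, smul_apply, smul_eq_mul]
  ring

theorem pd_sum {ι : Type*} {s : Finset ι} {f : ι → Coord → E} {p : Coord}
    (hf : ∀ i ∈ s, DifferentiableAt ℝ (f i) p) (a : Fin 4) :
    pd a (fun q => ∑ i ∈ s, f i q) p = ∑ i ∈ s, pd a (f i) p := by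
  simp only [pd, fderiv_fun_sum hf, sum_apply]

theorem pd_ofReal {f : Coord → ℝ} {p : Coord} (hf : DifferentiableAt ℝ f p) (a : Fin 4) :
    pd a (fun q => (f q : ℂ)) p = ((pd a f p : ℝ) : ℂ) := by
  have h := (Complex.ofRealCLM.hasFDerivAt.comp p hf.hasFDerivAt).fderiv
  simp only [pd]
  exact (congrArg (fun A => A (Pi.single a 1)) h)

theorem fderiv_eq_sum_pd (f : Coord → E) (p v : Coord) :
    fderiv ℝ f p v = ∑ b, v b • pd b f p := by
  have hv : v = ∑ b, v b • (Pi.single b 1 : Coord) := by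
    funext i
    simp [Finset.sum_apply, Pi.single_apply]
  conv_lhs => rw [hv]
  simp only [map_sum, map_smul, pd]

theorem pd_comp {e : Coord → Coord} {f : Coord → E} {p : Coord}
    (hf : DifferentiableAt ℝ f (e p)) (he : DifferentiableAt ℝ e p) (a : Fin 4) :
    pd a (fun q => f (e q)) p = ∑ k, pd a (fun q => e q k) p • pd k f (e p) := by
  have h : fderiv ℝ (fun q => f (e q)) p = (fderiv ℝ f (e p)).comp (fderiv ℝ e p) :=
    fderiv_comp p hf he
  rw [pd, h, ContinuousLinearMap.comp_apply, fderiv_eq_sum_pd]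
  refine Finset.sum_congr rfl fun k _ => ?_
  congr 1
  rw [pd, fderiv_apply he]
  rfl

theorem pd_comm {f : Coord → E} {p : Coord} (hf : ContDiffAt ℝ ∞ f p) (a b : Fin 4) :
    pd a (pd b f) p = pd b (pd a f) p := by
  have hsymm : IsSymmSndFDerivAt ℝ f p := hf.isSymmSndFDerivAt (by
    rw [minSmoothness_of_isRCLikeNormedField]
    exact WithTop.coe_le_coe.2 (le_top : (2 : ℕ∞) ≤ ⊤))
  have hd : DifferentiableAt ℝ (fderiv ℝ f) p :=
    (hf.fderiv_right (m := ∞) (by simp)).differentiableAt (by simp)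
  have key : ∀ v w : Coord, fderiv ℝ (fun q => fderiv ℝ f q v) p w = fderiv ℝ (fderiv ℝ f) p w v := by
    intro v w
    have := (hd.hasFDerivAt.clm_apply (hasFDerivAt_const v p)).fderiv
    rw [this]
    simp
  change fderiv ℝ (fun q => fderiv ℝ f q _) p _ = fderiv ℝ (fun q => fderiv ℝ f q _) p _
  rw [key, key]
  exact hsymm _ _

theorem contDiffOn_pd {f : Coord → E} {U : Set Coord} (hU : IsOpen U)
    (hf : ContDiffOn ℝ ∞ f U) (a : Fin 4) : ContDiffOn ℝ ∞ (pd a f) U :=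
  (hf.fderiv_of_isOpen hU (by simp)).clm_apply contDiffOn_const

theorem differentiableAt_of_contDiffOn {F : Type*} [NormedAddCommGroup F] [NormedSpace ℝ F]
    {f : F → E} {U : Set F} (hU : IsOpen U)
    (hf : ContDiffOn ℝ ∞ f U) {p : F} (hp : p ∈ U) : DifferentiableAt ℝ f p :=
  (hf.contDiffAt (hU.mem_nhds hp)).differentiableAt (by simp)

end PartialDerivatives

/-! ### Calculus of matrix-valued functions -/

section MatrixCalculus

/-- Entrywise coordinate derivative of a matrix-valued function. -/
def pdM (b : Fin 4) (F : MetricField) (p : Coord) : Matrix (Fin 4) (Fin 4) ℝ :=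
  Matrix.of fun i j => pd b (fun q => F q i j) p

/-- Entrywise smoothness of a matrix-valued function. -/
def SmoothM (F : MetricField) (U : Set Coord) : Prop :=
  ∀ i j, ContDiffOn ℝ ∞ (fun q => F q i j) U

variable {U : Set Coord} {F G : MetricField} {p : Coord}

theorem SmoothM.diff (hF : SmoothM F U) (hU : IsOpen U) (hp : p ∈ U) (i j : Fin 4) :
    DifferentiableAt ℝ (fun q => F q i j) p :=
  differentiableAt_of_contDiffOn hU (hF i j) hp

theorem SmoothM.mul (hF : SmoothM F U) (hG : SmoothM G U) : SmoothM (fun q => F q * G q) U := by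
  intro i j
  simp only [Matrix.mul_apply]
  exact ContDiffOn.sum fun k _ => (hF i k).mul (hG k j)

theorem SmoothM.transpose (hF : SmoothM F U) : SmoothM (fun q => (F q).transpose) U :=
  fun i j => hF j i

theorem pdM_mul (hU : IsOpen U) (hF : SmoothM F U) (hG : SmoothM G U) (hp : p ∈ U) (b : Fin 4) :
    pdM b (fun q => F q * G q) p = pdM b F p * G p + F p * pdM b G p := by
  ext i j
  simp only [pdM, Matrix.mul_apply, Matrix.add_apply, Matrix.of_apply]
  rw [pd_sum, ← Finset.sum_add_distrib]
  · exact Finset.sum_congr rfl fun k _ => pd_mul (hF.diff hU hp i k) (hG.diff hU hp k j) b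
  · exact fun k _ => (hF.diff hU hp i k).mul (hG.diff hU hp k j)

theorem pdM_transpose (b : Fin 4) : pdM b (fun q => (F q).transpose) p = (pdM b F p).transpose :=
  rfl

theorem pdM_congr (hU : IsOpen U) (h : ∀ q ∈ U, F q = G q) (hp : p ∈ U) (b : Fin 4) :
    pdM b F p = pdM b G p := by
  ext i j
  exact pd_congr_of_isOpen hU (fun q hq => by rw [h q hq]) hp b

theorem pdM_add (hU : IsOpen U) (hF : SmoothM F U) (hG : SmoothM G U) (hp : p ∈ U) (b : Fin 4) :
    pdM b (fun q => F q + G q) p = pdM b F p + pdM b G p := by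
  ext i j
  simp only [pdM, pd, Matrix.add_apply, Matrix.of_apply]
  rw [fderiv_fun_add (hF.diff hU hp i j) (hG.diff hU hp i j)]
  rfl

end MatrixCalculus

/-! ### The Levi-Civita connection and its curvature as matrices -/

section Connection

/-- The connection matrices `(Γ_b)^a_c = Γ^a_{bc}`. -/
def conn (g : MetricField) (b : Fin 4) (p : Coord) : Matrix (Fin 4) (Fin 4) ℝ :=
  Matrix.of fun a c => christoffel g a b c p

/-- The curvature matrices `(R_{cd})^a_b = R^a_{bcd}`. -/
def curv (g : MetricField) (c d : Fin 4) (p : Coord) : Matrix (Fin 4) (Fin 4) ℝ :=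
  pdM c (conn g d) p - pdM d (conn g c) p + (conn g c p * conn g d p - conn g d p * conn g c p)

/-- Reading the first index pair as a matrix turns the curvature into dΓ + Γ∧Γ, so that tensoriality
becomes a gauge transformation computed with noncommutative matrix algebra. -/
theorem riemannUp_eq_curv (g : MetricField) (a b c d : Fin 4) (p : Coord) :
    riemannUp g a b c d p = curv g c d p a b := by
  simp only [riemannUp, curv, Matrix.add_apply, Matrix.sub_apply, Matrix.mul_apply, pdM, conn,
    Matrix.of_apply, Finset.sum_sub_distrib]

/-- A smooth nondegenerate symmetric metric on an open set, with smooth connection. -/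
structure IsMetricOn (g : MetricField) (U : Set Coord) : Prop where
  isOpen : IsOpen U
  smooth : SmoothM g U
  smooth_conn : ∀ b, SmoothM (conn g b) U
  symm : ∀ p a b, g p a b = g p b a
  isUnit_det : ∀ p ∈ U, IsUnit (g p).det

theorem IsMetricOn.mono {g : MetricField} {U V : Set Coord} (hg : IsMetricOn g U) (hV : IsOpen V)
    (h : V ⊆ U) : IsMetricOn g V where
  isOpen := hV
  smooth i j := (hg.smooth i j).mono h
  smooth_conn b i j := (hg.smooth_conn b i j).mono h
  symm := hg.symm
  isUnit_det p hp := hg.isUnit_det p (h hp)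

variable {g : MetricField} {U : Set Coord} {p : Coord}

theorem christoffel_symm (hs : ∀ p a b, g p a b = g p b a) (a b c : Fin 4) (p : Coord) :
    christoffel g a b c p = christoffel g a c b p := by
  have h : ∀ x y, (fun q => g q x y) = fun q => g q y x := fun x y => funext fun q => hs q x y
  simp only [christoffel]
  congr 1
  refine Finset.sum_congr rfl fun d _ => ?_
  rw [h b c]
  ring

/-- Twice the Christoffel symbols of the first kind, as a matrix. -/
def firstKind (g : MetricField) (b : Fin 4) (p : Coord) : Matrix (Fin 4) (Fin 4) ℝ :=
  Matrix.of fun d c =>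
    pd b (fun q => g q d c) p + pd c (fun q => g q d b) p - pd d (fun q => g q b c) p

theorem conn_eq (g : MetricField) (b : Fin 4) (p : Coord) :
    conn g b p = (1 / 2 : ℝ) • ((g p)⁻¹ * firstKind g b p) := by
  ext a c
  simp [conn, christoffel, firstKind, Matrix.mul_apply]

theorem mul_conn (hdet : IsUnit (g p).det) (b : Fin 4) :
    g p * conn g b p = (1 / 2 : ℝ) • firstKind g b p := by
  rw [conn_eq, Matrix.mul_smul, Matrix.mul_nonsing_inv_cancel_left _ _ hdet]

/-- Metric compatibility of the Levi-Civita connection. -/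
theorem pdM_metric (hs : ∀ p a b, g p a b = g p b a) (hdet : IsUnit (g p).det) (b : Fin 4) :
    pdM b g p = (conn g b p).transpose * g p + g p * conn g b p := by
  have hT : (g p).transpose = g p := by ext i j; exact hs p j i
  have h1 : (conn g b p).transpose * g p = (g p * conn g b p).transpose := by
    rw [Matrix.transpose_mul, hT]
  have h : ∀ x y, (fun q => g q x y) = fun q => g q y x := fun x y => funext fun q => hs q x y
  rw [h1, mul_conn hdet]
  ext x c
  simp only [pdM, firstKind, Matrix.add_apply, Matrix.transpose_apply, Matrix.smul_apply,
    Matrix.of_apply, smul_eq_mul]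
  rw [h c x, h c b, h x b]
  ring

/-- The Levi-Civita connection is the only torsion-free metric one. -/
theorem conn_unique (hs : ∀ p a b, g p a b = g p b a) (hdet : IsUnit (g p).det)
    (G : Fin 4 → Matrix (Fin 4) (Fin 4) ℝ) (hG : ∀ a b c, G b a c = G c a b)
    (hm : ∀ b, pdM b g p = (G b).transpose * g p + g p * G b) (b : Fin 4) :
    conn g b p = G b := by
  have key : firstKind g b p = (2 : ℝ) • (g p * G b) := by
    ext d c
    have e : ∀ b x y, pd b (fun q => g q x y) p
        = ∑ i, (G b i x * g p i y) + ∑ i, g p x i * G b i y := by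
      intro b x y
      have := congrFun (congrFun (hm b) x) y
      simpa [pdM, Matrix.mul_apply] using this
    simp only [firstKind, Matrix.of_apply, Matrix.smul_apply, Matrix.mul_apply, smul_eq_mul, e]
    have e1 : ∑ i, G d i b * g p i c = ∑ i, G b i d * g p i c :=
      Finset.sum_congr rfl fun i _ => by rw [hG i d b]
    have e2 : ∑ i, g p b i * G d i c = ∑ i, G c i d * g p i b :=
      Finset.sum_congr rfl fun i _ => by rw [hG i d c, hs p b i]; ring
    have e3 : ∑ i, g p d i * G c i b = ∑ i, g p d i * G b i c :=
      Finset.sum_congr rfl fun i _ => by rw [hG i c b]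
    rw [e1, e2, e3]
    ring
  rw [conn_eq, key, Matrix.mul_smul, Matrix.nonsing_inv_mul_cancel_left _ _ hdet, smul_smul]
  norm_num

end Connection

/-! ### Connection and curvature under changes of coordinates -/

section CoordinateChange

/-- The Jacobian matrix of a map between charts. -/
def jac (e : Coord → Coord) (p : Coord) : Matrix (Fin 4) (Fin 4) ℝ :=
  Matrix.of fun c a => pd a (fun q => e q c) p

/-- The pulled-back connection matrices. -/
def pulledConn (e : Coord → Coord) (g' : MetricField) (b : Fin 4) (p : Coord) :
    Matrix (Fin 4) (Fin 4) ℝ :=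
  Matrix.of fun i j => ∑ k, jac e p k b * conn g' k (e p) i j

variable {e : Coord → Coord} {g g' : MetricField} {U U' : Set Coord} {p : Coord}

/-- A smooth map `e` from `U` into `U'` pulling `g'` back to `g`. -/
structure IsPullback (e : Coord → Coord) (g g' : MetricField) (U U' : Set Coord) : Prop where
  metric : IsMetricOn g U
  metric' : IsMetricOn g' U'
  smooth : ContDiffOn ℝ ∞ e U
  mapsTo : Set.MapsTo e U U'
  eq : ∀ p ∈ U, g p = (jac e p).transpose * g' (e p) * jac e p

theorem IsPullback.smooth_apply (h : IsPullback e g g' U U') (c : Fin 4) :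
    ContDiffOn ℝ ∞ (fun q => e q c) U :=
  contDiffOn_pi.1 h.smooth c

theorem IsPullback.smooth_jac (h : IsPullback e g g' U U') : SmoothM (jac e) U :=
  fun c a => contDiffOn_pd h.metric.isOpen (h.smooth_apply c) a

theorem IsPullback.differentiableAt (h : IsPullback e g g' U U') (hp : p ∈ U) :
    DifferentiableAt ℝ e p :=
  differentiableAt_of_contDiffOn h.metric.isOpen h.smooth hp

theorem IsPullback.isUnit_jac (h : IsPullback e g g' U U') (hp : p ∈ U) :
    IsUnit (jac e p).det := by
  have := h.metric.isUnit_det p hp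
  rw [h.eq p hp, Matrix.det_mul] at this
  exact isUnit_of_mul_isUnit_right this

theorem IsPullback.smooth_comp (h : IsPullback e g g' U U') {F : MetricField}
    (hF : SmoothM F U') : SmoothM (fun q => F (e q)) U :=
  fun i j => (hF i j).comp h.smooth h.mapsTo

theorem IsPullback.pdM_comp (h : IsPullback e g g' U U') {F : MetricField}
    (hF : SmoothM F U') (hp : p ∈ U) (b : Fin 4) :
    pdM b (fun q => F (e q)) p = ∑ k, jac e p k b • pdM k F (e p) := by
  ext i j
  rw [Matrix.sum_apply]
  exact pd_comp (f := fun q => F q i j) (hF.diff h.metric'.isOpen (h.mapsTo hp) i j)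
    (h.differentiableAt hp) b

theorem IsPullback.pdM_jac_symm (h : IsPullback e g g' U U') (hp : p ∈ U) (a b c : Fin 4) :
    pdM b (jac e) p a c = pdM c (jac e) p a b :=
  pd_comm ((h.smooth_apply a).contDiffAt (h.metric.isOpen.mem_nhds hp)) b c

theorem pulledConn_eq (b : Fin 4) :
    pulledConn e g' b p = ∑ k, jac e p k b • conn g' k (e p) := by
  ext i j
  simp [pulledConn, Matrix.sum_apply]

/-- Transformation law of the Levi-Civita connection. -/
theorem IsPullback.jac_mul_conn (h : IsPullback e g g' U U') (hp : p ∈ U) (b : Fin 4) :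
    jac e p * conn g b p = pdM b (jac e) p + pulledConn e g' b p * jac e p := by
  have hJ := h.isUnit_jac hp
  -- The law to be proved, solved for the connection. It suffices that this candidate is
  -- torsion-free and metric; uniqueness of the Levi-Civita connection does the rest.
  set G : Fin 4 → Matrix (Fin 4) (Fin 4) ℝ := fun b =>
    (jac e p)⁻¹ * (pdM b (jac e) p + pulledConn e g' b p * jac e p) with hGdef
  have hJG : ∀ b, jac e p * G b = pdM b (jac e) p + pulledConn e g' b p * jac e p := fun b =>
    Matrix.mul_nonsing_inv_cancel_left _ _ hJ
  have hsym : ∀ a b c, G b a c = G c a b := by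
    intro a b c
    simp only [hGdef, Matrix.mul_apply (M := (jac e p)⁻¹)]
    refine Finset.sum_congr rfl fun i _ => ?_
    congr 1
    rw [Matrix.add_apply, Matrix.add_apply, h.pdM_jac_symm hp]
    congr 1
    simp only [Matrix.mul_apply, pulledConn, Matrix.of_apply, Finset.sum_mul]
    rw [Finset.sum_comm]
    refine Finset.sum_congr rfl fun x _ => Finset.sum_congr rfl fun y _ => ?_
    simp only [conn, Matrix.of_apply]
    rw [christoffel_symm h.metric'.symm]
    ring
  have hm : ∀ b, pdM b g p = (G b).transpose * g p + g p * G b := by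
    intro b
    have h1 : pdM b g p
        = pdM b (fun q => (jac e q).transpose * g' (e q) * jac e q) p :=
      pdM_congr h.metric.isOpen h.eq hp b
    have hg'e := h.smooth_comp h.metric'.smooth
    have hM : pdM b (fun q => g' (e q)) p
        = (pulledConn e g' b p).transpose * g' (e p) + g' (e p) * pulledConn e g' b p := by
      rw [h.pdM_comp h.metric'.smooth hp, pulledConn_eq]
      simp only [pdM_metric h.metric'.symm (h.metric'.isUnit_det _ (h.mapsTo hp)),
        Matrix.transpose_sum, Matrix.transpose_smul, Finset.sum_mul, Finset.mul_sum, smul_add,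
        Finset.sum_add_distrib, Matrix.smul_mul, Matrix.mul_smul]
    rw [h1, pdM_mul h.metric.isOpen (h.smooth_jac.transpose.mul hg'e) h.smooth_jac hp,
      pdM_mul h.metric.isOpen h.smooth_jac.transpose hg'e hp, pdM_transpose, hM, h.eq p hp]
    have e1 : (G b).transpose * ((jac e p).transpose * g' (e p) * jac e p)
        = (jac e p * G b).transpose * g' (e p) * jac e p := by
      simp only [Matrix.transpose_mul, Matrix.mul_assoc]
    have e2 : (jac e p).transpose * g' (e p) * jac e p * G b
        = (jac e p).transpose * g' (e p) * (jac e p * G b) := by noncomm_ring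
    rw [e1, e2, hJG, Matrix.transpose_add, Matrix.transpose_mul]
    noncomm_ring
  rw [conn_unique h.metric.symm (h.metric.isUnit_det p hp) G hsym hm, hJG]

theorem IsPullback.smooth_pulledConn (h : IsPullback e g g' U U') (b : Fin 4) :
    SmoothM (pulledConn e g' b) U := by
  intro i j
  simp only [pulledConn, Matrix.of_apply]
  exact ContDiffOn.sum fun k _ =>
    (h.smooth_jac k b).mul (h.smooth_comp (h.metric'.smooth_conn k) i j)

/-- The first sum contains second derivatives of `e` and is symmetric in `c`, `d`; it drops out of
the curvature on antisymmetrization. -/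
theorem IsPullback.pdM_pulledConn (h : IsPullback e g g' U U') (hp : p ∈ U) (c d : Fin 4) :
    pdM c (pulledConn e g' d) p = ∑ k, pdM c (jac e) p k d • conn g' k (e p)
      + ∑ k, ∑ l, (jac e p k d * jac e p l c) • pdM l (conn g' k) (e p) := by
  ext i j
  have hc := fun k => (h.smooth_comp (h.metric'.smooth_conn k)).diff h.metric.isOpen hp i j
  have hJ := fun k => h.smooth_jac.diff h.metric.isOpen hp k d
  have h1 : ∀ k, pd c (fun q => conn g' k (e q) i j) p
      = ∑ l, jac e p l c * pdM l (conn g' k) (e p) i j := by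
    intro k
    have := congrFun (congrFun (h.pdM_comp (h.metric'.smooth_conn k) hp c) i) j
    simpa [Matrix.sum_apply, pdM] using this
  have h2 : pdM c (pulledConn e g' d) p i j
      = ∑ k, pd c (fun q => jac e q k d * conn g' k (e q) i j) p := by
    simp only [pdM, pulledConn, Matrix.of_apply]
    exact pd_sum (fun k _ => (hJ k).mul (hc k)) c
  rw [h2]
  simp only [Matrix.add_apply, Matrix.sum_apply, Matrix.smul_apply, smul_eq_mul]
  rw [← Finset.sum_add_distrib]
  refine Finset.sum_congr rfl fun k _ => ?_
  rw [pd_mul (hJ k) (hc k), h1, Finset.mul_sum]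
  congr 1
  exact Finset.sum_congr rfl fun l _ => by ring

/-- Tensoriality of the curvature. -/
theorem IsPullback.jac_mul_curv (h : IsPullback e g g' U U') (hp : p ∈ U) (c d : Fin 4) :
    jac e p * curv g c d p
      = (∑ l, ∑ k, (jac e p l c * jac e p k d) • curv g' l k (e p)) * jac e p := by
  have hO := h.metric.isOpen
  have hder : ∀ c d, pdM c (jac e) p * conn g d p + jac e p * pdM c (conn g d) p
      = pdM c (pdM d (jac e)) p
        + (pdM c (pulledConn e g' d) p * jac e p + pulledConn e g' d p * pdM c (jac e) p) := by
    intro c d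
    rw [← pdM_mul hO h.smooth_jac (h.metric.smooth_conn d) hp,
      ← pdM_mul hO (h.smooth_pulledConn d) h.smooth_jac hp, ← pdM_add hO _
        ((h.smooth_pulledConn d).mul h.smooth_jac) hp]
    · exact pdM_congr hO (fun q hq => h.jac_mul_conn hq d) hp c
    · exact fun i j => contDiffOn_pd hO (h.smooth_jac i j) d
  have hsymm : pdM c (pdM d (jac e)) p = pdM d (pdM c (jac e)) p := by
    ext i j
    exact pd_comm ((h.smooth_jac i j).contDiffAt (hO.mem_nhds hp)) c d
  have hJ : ∀ c, pdM c (jac e) p = jac e p * conn g c p - pulledConn e g' c p * jac e p := by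
    intro c
    rw [h.jac_mul_conn hp c]; abel
  have hcd : jac e p * pdM c (conn g d) p = pdM c (pdM d (jac e)) p
        + (pdM c (pulledConn e g' d) p * jac e p + pulledConn e g' d p * pdM c (jac e) p)
        - pdM c (jac e) p * conn g d p := by
    rw [← hder c d]; abel
  have hdc : jac e p * pdM d (conn g c) p = pdM d (pdM c (jac e)) p
        + (pdM d (pulledConn e g' c) p * jac e p + pulledConn e g' c p * pdM d (jac e) p)
        - pdM d (jac e) p * conn g c p := by
    rw [← hder d c]; abel
  -- Gauge covariance: after substituting dJ = JΓ − Γ'J, where Γ' is the pulled-back connection, and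
  -- cancelling the mixed second derivatives of J, only the curvature expression of Γ' remains,
  -- multiplied by J.
  have h1 : jac e p * curv g c d p = (pdM c (pulledConn e g' d) p - pdM d (pulledConn e g' c) p
      + (pulledConn e g' c p * pulledConn e g' d p - pulledConn e g' d p * pulledConn e g' c p))
        * jac e p := by
    rw [curv, mul_add, mul_sub, hcd, hdc, hsymm, hJ c, hJ d]
    noncomm_ring
  rw [h1]
  congr 1
  rw [h.pdM_pulledConn hp, h.pdM_pulledConn hp]
  have h2 : ∑ k, pdM c (jac e) p k d • conn g' k (e p)
      = ∑ k, pdM d (jac e) p k c • conn g' k (e p) :=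
    Finset.sum_congr rfl fun k _ => by rw [h.pdM_jac_symm hp]
  have h3 : ∑ k, ∑ l, (jac e p k d * jac e p l c) • pdM l (conn g' k) (e p)
      = ∑ l, ∑ k, (jac e p l c * jac e p k d) • pdM l (conn g' k) (e p) := by
    rw [Finset.sum_comm]
    exact Finset.sum_congr rfl fun k _ => Finset.sum_congr rfl fun l _ => by rw [mul_comm]
  have h4 : ∀ c d, pulledConn e g' c p * pulledConn e g' d p
      = ∑ l, ∑ k, (jac e p l c * jac e p k d) • (conn g' l (e p) * conn g' k (e p)) := by
    intro c d
    rw [pulledConn_eq, pulledConn_eq, Finset.sum_mul_sum]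
    refine Finset.sum_congr rfl fun k _ => Finset.sum_congr rfl fun l _ => ?_
    rw [Matrix.smul_mul, Matrix.mul_smul, smul_smul]
  have h5 : pulledConn e g' d p * pulledConn e g' c p
      = ∑ l, ∑ k, (jac e p l c * jac e p k d) • (conn g' k (e p) * conn g' l (e p)) := by
    rw [h4, Finset.sum_comm]
    exact Finset.sum_congr rfl fun k _ => Finset.sum_congr rfl fun l _ => by rw [mul_comm (jac e p l d)]
  rw [h2, h3, h4, h5]
  simp only [curv, smul_add, smul_sub, Finset.sum_add_distrib, Finset.sum_sub_distrib]
  abel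

/-- Tensoriality of the Ricci tensor. -/
theorem IsPullback.ricci_eq (h : IsPullback e g g' U U') (hp : p ∈ U) :
    (Matrix.of fun b d => ricci g b d p)
      = (jac e p).transpose * (Matrix.of fun b d => ricci g' b d (e p)) * jac e p := by
  have hJ := h.isUnit_jac hp
  ext b d
  set Y : Fin 4 → Matrix (Fin 4) (Fin 4) ℝ :=
    fun l => (∑ k, jac e p k d • curv g' l k (e p)) * jac e p with hY
  -- The Ricci tensor contracts the factor J⁻¹ with the Jacobian factor of the form index; the two
  -- annihilate each other and leave the trace of `Y`.
  have h1 : ∀ a, curv g a d p = (jac e p)⁻¹ * ∑ l, jac e p l a • Y l := by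
    intro a
    rw [← Matrix.nonsing_inv_mul_cancel_left (jac e p) (curv g a d p) hJ, h.jac_mul_curv hp]
    congr 1
    rw [Finset.sum_mul]
    refine Finset.sum_congr rfl fun l _ => ?_
    simp only [hY, Finset.sum_mul, Finset.smul_sum, Matrix.smul_mul, smul_smul]
  have h2 : ricci g b d p = ∑ l, Y l l b := by
    simp only [ricci, riemannUp_eq_curv, h1, Matrix.mul_apply, Matrix.sum_apply,
      Matrix.smul_apply, smul_eq_mul, Finset.mul_sum]
    have h3 : ∀ x l, ∑ a, (jac e p)⁻¹ a x * (jac e p l a * Y l x b)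
        = if l = x then Y l x b else 0 := by
      intro x l
      have h4 := congrFun (congrFun (Matrix.mul_nonsing_inv (jac e p) hJ) l) x
      rw [Matrix.mul_apply, Matrix.one_apply] at h4
      have h5 : ∑ a, (jac e p)⁻¹ a x * (jac e p l a * Y l x b)
          = (∑ a, jac e p l a * (jac e p)⁻¹ a x) * Y l x b := by
        rw [Finset.sum_mul]
        exact Finset.sum_congr rfl fun a _ => by ring
      rw [h5, h4, ite_mul, one_mul, zero_mul]
    rw [Finset.sum_comm]
    have h6 : ∀ x, ∑ a, ∑ l, (jac e p)⁻¹ a x * (jac e p l a * Y l x b) = Y x x b := by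
      intro x
      rw [Finset.sum_comm]
      simp only [h3]
      simp
    exact Finset.sum_congr rfl fun x _ => h6 x
  rw [Matrix.of_apply, h2]
  simp only [hY, Matrix.mul_apply, Matrix.sum_apply, Matrix.smul_apply, smul_eq_mul,
    Matrix.of_apply, Matrix.transpose_apply, ricci, riemannUp_eq_curv, Finset.sum_mul,
    Finset.mul_sum]
  rw [Finset.sum_comm]
  refine Finset.sum_congr rfl fun k _ => ?_
  rw [Finset.sum_comm]
  exact Finset.sum_congr rfl fun y _ => Finset.sum_congr rfl fun l _ => by ring

theorem IsPullback.ricci_eq_zero (h : IsPullback e g g' U U') (hp : p ∈ U)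
    (hric : ∀ a b, ricci g a b p = 0) (a b : Fin 4) : ricci g' a b (e p) = 0 := by
  have hJ := h.isUnit_jac hp
  have h0 : (Matrix.of fun b d => ricci g b d p) = 0 := by ext i j; exact hric i j
  have h1 := h.ricci_eq hp
  rw [h0] at h1
  have hJT : IsUnit (jac e p).transpose.det := by rwa [Matrix.det_transpose]
  have h2 : (Matrix.of fun b d => ricci g' b d (e p))
      = (jac e p).transpose⁻¹ * (((jac e p).transpose * (Matrix.of fun b d => ricci g' b d (e p))
        * jac e p) * (jac e p)⁻¹) := by
    rw [Matrix.mul_nonsing_inv_cancel_right _ _ hJ, Matrix.nonsing_inv_mul_cancel_left _ _ hJT]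
  rw [← h1, zero_mul, mul_zero] at h2
  exact congrFun (congrFun h2 a) b

end CoordinateChange

/-! ### Naturality of metric products, Weyl tensor and covariant derivative -/

section Pushforward

/-- The differential of `e` at `p`, acting on complex tangent vectors. -/
def push (e : Coord → Coord) (p : Coord) (v : Fin 4 → ℂ) : Fin 4 → ℂ :=
  fun i => ∑ a, (jac e p i a : ℂ) * v a

variable {e : Coord → Coord} {g g' : MetricField} {U U' : Set Coord} {p : Coord}

theorem sum_congruence (J M : Matrix (Fin 4) (Fin 4) ℂ) (v w : Fin 4 → ℂ) :
    ∑ a, ∑ b, (J.transpose * M * J) a b * v a * w b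
      = ∑ a, ∑ b, M a b * (∑ i, J a i * v i) * (∑ i, J b i * w i) := by
  have h : ∀ (M : Matrix (Fin 4) (Fin 4) ℂ) v w,
      ∑ a, ∑ b, M a b * v a * w b = v ⬝ᵥ M.mulVec w := by
    intro M v w
    simp only [dotProduct, Matrix.mulVec, Finset.mul_sum]
    exact Finset.sum_congr rfl fun a _ => Finset.sum_congr rfl fun b _ => by ring
  have h2 : ∀ v : Fin 4 → ℂ, (fun a => ∑ i, J a i * v i) = J.mulVec v := fun v => rfl
  rw [h, h M (fun a => ∑ i, J a i * v i) (fun a => ∑ i, J a i * w i), h2, h2,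
    ← Matrix.mulVec_mulVec, ← Matrix.mulVec_mulVec, Matrix.dotProduct_mulVec,
    Matrix.vecMul_transpose]

theorem IsPullback.inner4_eq (h : IsPullback e g g' U U') (hp : p ∈ U) (v w : Fin 4 → ℂ) :
    inner4 g p v w = inner4 g' (e p) (push e p v) (push e p w) := by
  have h1 : ∀ a b, (g p a b : ℂ) = (((jac e p).map Complex.ofReal).transpose
      * ((g' (e p)).map Complex.ofReal) * ((jac e p).map Complex.ofReal)) a b := by
    intro a b
    rw [h.eq p hp]
    simp [Matrix.mul_apply]
  simp only [inner4, h1]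
  rw [sum_congruence]
  rfl

/-- Where the Ricci tensor vanishes the Weyl tensor equals the Riemann tensor, so tensoriality of
the curvature is enough. It is used once for each pair of indices, the second pair being the matrix
index of `curv`. -/
theorem IsPullback.weylC_eq (h : IsPullback e g g' U U') (hp : p ∈ U)
    (hric : ∀ a b, ricci g a b p = 0) (v w x y : Fin 4 → ℂ) :
    weylC g p v w x y
      = weylC g' (e p) (push e p v) (push e p w) (push e p x) (push e p y) := by
  have hric' := h.ricci_eq_zero hp hric
  have hw : ∀ (g : MetricField) (p : Coord), (∀ a b, ricci g a b p = 0) → ∀ v w x y,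
      weylC g p v w x y = ∑ c, ∑ d, (∑ a, ∑ b, ((g p * curv g c d p).map Complex.ofReal) a b
        * v a * w b) * x c * y d := by
    intro g p hr v w x y
    have hweyl : ∀ a b c d, weyl g a b c d p = (g p * curv g c d p) a b := by
      intro a b c d
      simp [weyl, scalarCurvature, hr, riemann, riemannUp_eq_curv, Matrix.mul_apply]
    simp only [weylC, hweyl, Finset.sum_mul, Matrix.map_apply]
    calc _ = ∑ a, ∑ c, ∑ d, ∑ b, (((g p * curv g c d p) a b : ℝ) : ℂ) * v a * w b * x c * y d := by
          refine Finset.sum_congr rfl fun a _ => ?_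
          rw [Finset.sum_comm]
          exact Finset.sum_congr rfl fun c _ => Finset.sum_comm
      _ = _ := by
          rw [Finset.sum_comm]
          exact Finset.sum_congr rfl fun c _ => Finset.sum_comm
  set Jc := (jac e p).map Complex.ofReal with hJc
  have hmat : ∀ c d, (g p * curv g c d p).map Complex.ofReal
      = Jc.transpose * (∑ l, ∑ k, (Jc l c * Jc k d) •
        (g' (e p) * curv g' l k (e p)).map Complex.ofReal) * Jc := by
    intro c d
    have h1 : g p * curv g c d p = (jac e p).transpose * (∑ l, ∑ k, (jac e p l c * jac e p k d) •
        (g' (e p) * curv g' l k (e p))) * jac e p := by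
      rw [h.eq p hp, Matrix.mul_assoc, h.jac_mul_curv hp]
      simp only [← Matrix.mul_smul, ← Finset.mul_sum, Matrix.mul_assoc]
    rw [h1]
    ext i j
    simp [Matrix.mul_apply, Matrix.sum_apply, hJc]
  rw [hw g p hric, hw g' (e p) hric']
  simp only [hmat, sum_congruence]
  set φ : Matrix (Fin 4) (Fin 4) ℂ := Matrix.of fun l k => ∑ a, ∑ b,
    ((g' (e p) * curv g' l k (e p)).map Complex.ofReal) a b * push e p v a * push e p w b with hφ
  have h2 : ∀ c d, ∑ a, ∑ b, (∑ l, ∑ k, (Jc l c * Jc k d) •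
        (g' (e p) * curv g' l k (e p)).map Complex.ofReal) a b * (∑ i, Jc a i * v i)
          * (∑ i, Jc b i * w i) = (Jc.transpose * φ * Jc) c d := by
    intro c d
    have h3 : (Jc.transpose * φ * Jc) c d = ∑ l, ∑ k, (Jc l c * Jc k d) * φ l k := by
      simp only [Matrix.mul_apply, Matrix.transpose_apply, Finset.sum_mul]
      rw [Finset.sum_comm]
      exact Finset.sum_congr rfl fun _ _ => Finset.sum_congr rfl fun _ _ => by ring
    have h4 : ∀ M : Matrix (Fin 4) (Fin 4) ℂ, ∑ a, ∑ b, M a b * (∑ i, Jc a i * v i)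
          * (∑ i, Jc b i * w i) = push e p v ⬝ᵥ M.mulVec (push e p w) := by
      intro M
      change ∑ a, ∑ b, M a b * push e p v a * push e p w b = _
      simp only [dotProduct, Matrix.mulVec, Finset.mul_sum]
      exact Finset.sum_congr rfl fun a _ => Finset.sum_congr rfl fun b _ => by ring
    have h5 : ∀ l k, φ l k = push e p v ⬝ᵥ
        ((g' (e p) * curv g' l k (e p)).map Complex.ofReal).mulVec (push e p w) := by
      intro l k
      rw [← h4]
      rfl
    rw [h3, h4]
    simp only [h5, Matrix.sum_mulVec, dotProduct_sum, Matrix.smul_mulVec, dotProduct_smul,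
      smul_eq_mul]
  simp only [h2]
  rw [sum_congruence]
  rfl

theorem sum_sum_mul_comm (J : Fin 4 → Fin 4 → ℂ) (X A : Fin 4 → ℂ) :
    ∑ k, (∑ b, J k b * X b) * A k = ∑ b, X b * ∑ k, J k b * A k := by
  simp only [Finset.sum_mul, Finset.mul_sum]
  rw [Finset.sum_comm]
  exact Finset.sum_congr rfl fun _ _ => Finset.sum_congr rfl fun _ _ => by ring

theorem sum_mul_sum_comm (X K : Fin 4 → ℂ) (A : Fin 4 → Fin 4 → ℂ) :
    ∑ b, X b * ∑ d, K d * A b d = ∑ d, K d * ∑ b, X b * A b d := by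
  simp only [Finset.mul_sum]
  rw [Finset.sum_comm]
  exact Finset.sum_congr rfl fun _ _ => Finset.sum_congr rfl fun _ _ => by ring

/-- Naturality of the covariant derivative. -/
theorem IsPullback.push_covDeriv (h : IsPullback e g g' U U') (hp : p ∈ U) (X : Fin 4 → ℂ)
    {Y Y' : Coord → Fin 4 → ℂ} (hY : ∀ a, DifferentiableAt ℝ (fun q => Y q a) p)
    (hY' : ∀ a, DifferentiableAt ℝ (fun q => Y' q a) (e p))
    (hYY : ∀ q ∈ U, Y' (e q) = push e q (Y q)) :
    covDeriv g' (push e p X) Y' (e p) = push e p (covDeriv g X Y p) := by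
  have hO := h.metric.isOpen
  have hJd : ∀ i j, DifferentiableAt ℝ (fun q => (jac e q i j : ℂ)) p := fun i j =>
    Complex.ofRealCLM.differentiableAt.comp p (h.smooth_jac.diff hO hp i j)
  have hchain : ∀ b a, ∑ k, (jac e p k b : ℂ) * pd k (fun q => Y' q a) (e p)
      = ∑ c, (((pdM b (jac e) p a c : ℝ) : ℂ) * Y p c + (jac e p a c : ℂ) * pd b (fun q => Y q c) p) := by
    intro b a
    have h1 := pd_comp (hY' a) (h.differentiableAt hp) b
    have h2 : pd b (fun q => Y' (e q) a) p = pd b (fun q => ∑ c, (jac e q a c : ℂ) * Y q c) p :=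
      pd_congr_of_isOpen hO (fun q hq => by rw [hYY q hq]; rfl) hp b
    rw [h2, pd_sum (f := fun c q => (jac e q a c : ℂ) * Y q c)
      (fun c _ => (hJd a c).mul (hY c))] at h1
    simp only [Complex.real_smul] at h1
    refine Eq.trans h1.symm (Finset.sum_congr rfl fun c _ => ?_)
    rw [pd_mul (hJd a c) (hY c), pd_ofReal (h.smooth_jac.diff hO hp a c)]
    rfl
  have hconn : ∀ a b c, ∑ d, (jac e p a d : ℂ) * (christoffel g d b c p : ℂ)
      = ((pdM b (jac e) p a c : ℝ) : ℂ)
        + ∑ k, ∑ f, (jac e p k b : ℂ) * (christoffel g' a k f (e p) : ℂ) * (jac e p f c : ℂ) := by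
    intro a b c
    have h1 := congrFun (congrFun (h.jac_mul_conn hp b) a) c
    simp only [Matrix.add_apply, Matrix.mul_apply, pulledConn, Matrix.of_apply, conn,
      Finset.sum_mul] at h1
    rw [Finset.sum_comm (γ := Fin 4)]
    exact_mod_cast h1
  funext a
  have hb : ∀ b, ∑ k, (jac e p k b : ℂ) * (pd k (fun q => Y' q a) (e p)
        + ∑ f, (christoffel g' a k f (e p) : ℂ) * Y' (e p) f)
      = ∑ d, (jac e p a d : ℂ) * (pd b (fun q => Y q d) p
        + ∑ c, (christoffel g d b c p : ℂ) * Y p c) := by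
    intro b
    simp only [mul_add, Finset.sum_add_distrib]
    rw [hchain, Finset.sum_add_distrib]
    have h3 : ∑ d, (jac e p a d : ℂ) * ∑ c, (christoffel g d b c p : ℂ) * Y p c
        = ∑ c, (∑ d, (jac e p a d : ℂ) * (christoffel g d b c p : ℂ)) * Y p c := by
      simp only [Finset.mul_sum, Finset.sum_mul]
      rw [Finset.sum_comm]
      exact Finset.sum_congr rfl fun _ _ => Finset.sum_congr rfl fun _ _ => by ring
    have h4 : ∑ k, (jac e p k b : ℂ) * ∑ f, (christoffel g' a k f (e p) : ℂ) * Y' (e p) f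
        = ∑ c, (∑ k, ∑ f, (jac e p k b : ℂ) * (christoffel g' a k f (e p) : ℂ)
          * (jac e p f c : ℂ)) * Y p c := by
      rw [hYY p hp]
      simp only [push, Finset.mul_sum, Finset.sum_mul]
      refine Eq.symm (Finset.sum_comm.trans (Finset.sum_congr rfl fun k _ => ?_))
      refine Finset.sum_comm.trans (Finset.sum_congr rfl fun f _ => ?_)
      exact Finset.sum_congr rfl fun c _ => by ring
    rw [h3, h4]
    simp only [hconn, add_mul, Finset.sum_add_distrib]
    ring
  simp only [covDeriv, push] at hb ⊢
  calc _ = ∑ b, X b * ∑ k, (jac e p k b : ℂ) * (pd k (fun q => Y' q a) (e p)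
        + ∑ f, (christoffel g' a k f (e p) : ℂ) * Y' (e p) f) := by
        exact sum_sum_mul_comm (fun k b => (jac e p k b : ℂ)) X _
    _ = ∑ b, X b * ∑ d, (jac e p a d : ℂ) * (pd b (fun q => Y q d) p
        + ∑ c, (christoffel g d b c p : ℂ) * Y p c) :=
        Finset.sum_congr rfl fun b _ => by rw [hb b]
    _ = _ := by
        exact sum_mul_sum_comm X (fun d => (jac e p a d : ℂ)) _

end Pushforward

/-! ### Curvature of Rosen metrics -/

/-- The data of a Rosen form `2 k(u) du dr + a(u) dx² + 2 b(u) dx dy + d(u) dy²`. -/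
structure RosenForm where
  I : Set ℝ
  isOpen : IsOpen I
  k : ℝ → ℝ
  a : ℝ → ℝ
  b : ℝ → ℝ
  d : ℝ → ℝ
  smooth_k : ContDiffOn ℝ ∞ k I
  smooth_a : ContDiffOn ℝ ∞ a I
  smooth_b : ContDiffOn ℝ ∞ b I
  smooth_d : ContDiffOn ℝ ∞ d I
  k_ne : ∀ u ∈ I, k u ≠ 0
  a_pos : ∀ u ∈ I, 0 < a u
  det_pos : ∀ u ∈ I, 0 < a u * d u - b u ^ 2

theorem pd_comp_zero {E : Type*} [NormedAddCommGroup E] [NormedSpace ℝ E] {f : ℝ → E} {p : Coord}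
    (hf : DifferentiableAt ℝ f (p 0)) (c : Fin 4) :
    pd c (fun q => f (q 0)) p = if c = 0 then deriv f (p 0) else 0 := by
  have h1 : HasFDerivAt (fun q : Coord => q 0)
      (ContinuousLinearMap.proj (R := ℝ) (φ := fun _ : Fin 4 => ℝ) 0) p :=
    (ContinuousLinearMap.proj (R := ℝ) (φ := fun _ : Fin 4 => ℝ) 0).hasFDerivAt
  have h2 := (hf.hasDerivAt.hasFDerivAt.comp p h1).fderiv
  have h3 : fderiv ℝ (fun q : Coord => f (q 0)) p = _ := h2
  rw [pd, h3]
  by_cases hc : c = 0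
  · subst hc; simp
  · simp [hc, Ne.symm hc]

namespace RosenForm

variable (R : RosenForm)

/-- The coordinate domain. -/
def region : Set Coord := {p | p 0 ∈ R.I}

theorem isOpen_region : IsOpen R.region := R.isOpen.preimage (continuous_apply 0)

/-- The metric components in coordinates `(u, r, x, y)`. -/
def metric : MetricField := fun p =>
  !![0, R.k (p 0), 0, 0;
     R.k (p 0), 0, 0, 0;
     0, 0, R.a (p 0), R.b (p 0);
     0, 0, R.b (p 0), R.d (p 0)]

/-- This is Γ^u_uu, the failure of `u` to be an affine parameter. -/
def kap (u : ℝ) : ℝ := deriv R.k u / R.k u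

/-- The determinant of the transverse metric. -/
def det (u : ℝ) : ℝ := R.a u * R.d u - R.b u ^ 2

/-! Components of `½ h⁻¹ h'`, where `h` is the transverse metric. -/

def L11 (u : ℝ) : ℝ := (R.d u * deriv R.a u - R.b u * deriv R.b u) / (2 * R.det u)
def L12 (u : ℝ) : ℝ := (R.d u * deriv R.b u - R.b u * deriv R.d u) / (2 * R.det u)
def L21 (u : ℝ) : ℝ := (R.a u * deriv R.b u - R.b u * deriv R.a u) / (2 * R.det u)
def L22 (u : ℝ) : ℝ := (R.a u * deriv R.d u - R.b u * deriv R.b u) / (2 * R.det u)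

/-! The wave profile `½ h'' - ¼ h' h⁻¹ h' - ½ (k'/k) h'`. -/

def H11 (u : ℝ) : ℝ := deriv (deriv R.a) u / 2
  - (deriv R.a u * R.L11 u + deriv R.b u * R.L21 u) / 2 - R.kap u * deriv R.a u / 2
def H12 (u : ℝ) : ℝ := deriv (deriv R.b) u / 2
  - (deriv R.a u * R.L12 u + deriv R.b u * R.L22 u) / 2 - R.kap u * deriv R.b u / 2
def H22 (u : ℝ) : ℝ := deriv (deriv R.d) u / 2
  - (deriv R.b u * R.L12 u + deriv R.d u * R.L22 u) / 2 - R.kap u * deriv R.d u / 2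

/-- The connection matrices as functions of `u`. -/
def connMat (u : ℝ) : Fin 4 → Matrix (Fin 4) (Fin 4) ℝ :=
  ![!![R.kap u, 0, 0, 0; 0, 0, 0, 0; 0, 0, R.L11 u, R.L12 u; 0, 0, R.L21 u, R.L22 u],
    0,
    !![0, 0, 0, 0; 0, 0, -(deriv R.a u / (2 * R.k u)), -(deriv R.b u / (2 * R.k u));
      R.L11 u, 0, 0, 0; R.L21 u, 0, 0, 0],
    !![0, 0, 0, 0; 0, 0, -(deriv R.b u / (2 * R.k u)), -(deriv R.d u / (2 * R.k u));
      R.L12 u, 0, 0, 0; R.L22 u, 0, 0, 0]]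

variable {R}

theorem det_ne {u : ℝ} (hu : u ∈ R.I) : R.det u ≠ 0 := (R.det_pos u hu).ne'

theorem smooth_deriv {f : ℝ → ℝ} (hf : ContDiffOn ℝ ∞ f R.I) : ContDiffOn ℝ ∞ (deriv f) R.I :=
  hf.deriv_of_isOpen R.isOpen (by simp)

theorem diff {f : ℝ → ℝ} (hf : ContDiffOn ℝ ∞ f R.I) {u : ℝ} (hu : u ∈ R.I) :
    DifferentiableAt ℝ f u :=
  differentiableAt_of_contDiffOn R.isOpen hf hu

variable (R)

theorem smooth_det : ContDiffOn ℝ ∞ R.det R.I :=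
  (R.smooth_a.mul R.smooth_d).sub (R.smooth_b.pow 2)

theorem smooth_two_det : ContDiffOn ℝ ∞ (fun u => 2 * R.det u) R.I :=
  contDiffOn_const.mul R.smooth_det

theorem smooth_kap : ContDiffOn ℝ ∞ R.kap R.I := (smooth_deriv R.smooth_k).div R.smooth_k R.k_ne

theorem smooth_quot {f g f' g' : ℝ → ℝ} (hf : ContDiffOn ℝ ∞ f R.I) (hg : ContDiffOn ℝ ∞ g R.I)
    (hf' : ContDiffOn ℝ ∞ f' R.I) (hg' : ContDiffOn ℝ ∞ g' R.I) :
    ContDiffOn ℝ ∞ (fun u => (f u * deriv f' u - g u * deriv g' u) / (2 * R.det u)) R.I :=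
  ((hf.mul (smooth_deriv hf')).sub (hg.mul (smooth_deriv hg'))).div R.smooth_two_det
    fun _ hu => mul_ne_zero two_ne_zero (det_ne hu)

theorem smooth_L11 : ContDiffOn ℝ ∞ R.L11 R.I :=
  R.smooth_quot R.smooth_d R.smooth_b R.smooth_a R.smooth_b
theorem smooth_L12 : ContDiffOn ℝ ∞ R.L12 R.I :=
  R.smooth_quot R.smooth_d R.smooth_b R.smooth_b R.smooth_d
theorem smooth_L21 : ContDiffOn ℝ ∞ R.L21 R.I :=
  R.smooth_quot R.smooth_a R.smooth_b R.smooth_b R.smooth_a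
theorem smooth_L22 : ContDiffOn ℝ ∞ R.L22 R.I :=
  R.smooth_quot R.smooth_a R.smooth_b R.smooth_d R.smooth_b

theorem smooth_profile {f x y z w : ℝ → ℝ} (hf : ContDiffOn ℝ ∞ f R.I)
    (hx : ContDiffOn ℝ ∞ x R.I) (hy : ContDiffOn ℝ ∞ y R.I) (hz : ContDiffOn ℝ ∞ z R.I)
    (hw : ContDiffOn ℝ ∞ w R.I) :
    ContDiffOn ℝ ∞ (fun u => deriv (deriv f) u / 2 - (deriv x u * y u + deriv z u * w u) / 2
      - R.kap u * deriv f u / 2) R.I :=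
  ((smooth_deriv (smooth_deriv hf)).div_const 2).sub
    ((((smooth_deriv hx).mul hy).add ((smooth_deriv hz).mul hw)).div_const 2) |>.sub
    ((R.smooth_kap.mul (smooth_deriv hf)).div_const 2)

theorem smooth_H11 : ContDiffOn ℝ ∞ R.H11 R.I :=
  R.smooth_profile R.smooth_a R.smooth_a R.smooth_L11 R.smooth_b R.smooth_L21
theorem smooth_H12 : ContDiffOn ℝ ∞ R.H12 R.I :=
  R.smooth_profile R.smooth_b R.smooth_a R.smooth_L12 R.smooth_b R.smooth_L22
theorem smooth_H22 : ContDiffOn ℝ ∞ R.H22 R.I :=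
  R.smooth_profile R.smooth_d R.smooth_b R.smooth_L12 R.smooth_d R.smooth_L22

variable {R} {u : ℝ} {p : Coord}

/-! The relation `h L = ½ h'`. -/

theorem hL11 (hu : u ∈ R.I) : R.a u * R.L11 u + R.b u * R.L21 u = deriv R.a u / 2 := by
  have := det_ne hu
  simp only [L11, L21]; field_simp; simp only [det]; ring
theorem hL12 (hu : u ∈ R.I) : R.a u * R.L12 u + R.b u * R.L22 u = deriv R.b u / 2 := by
  have := det_ne hu
  simp only [L12, L22]; field_simp; simp only [det]; ring
theorem hL21 (hu : u ∈ R.I) : R.b u * R.L11 u + R.d u * R.L21 u = deriv R.b u / 2 := by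
  have := det_ne hu
  simp only [L11, L21]; field_simp; simp only [det]; ring
theorem hL22 (hu : u ∈ R.I) : R.b u * R.L12 u + R.d u * R.L22 u = deriv R.d u / 2 := by
  have := det_ne hu
  simp only [L12, L22]; field_simp; simp only [det]; ring

/-- One entry of the differentiated relation h'L + hL' = ½h''. It lets hL' be eliminated without
differentiating the quotients that define L. -/
theorem deriv_row {x y s t f : ℝ → ℝ} (hx : ContDiffOn ℝ ∞ x R.I) (hy : ContDiffOn ℝ ∞ y R.I)
    (hs : ContDiffOn ℝ ∞ s R.I) (ht : ContDiffOn ℝ ∞ t R.I) (hf : ContDiffOn ℝ ∞ f R.I)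
    (h : ∀ u ∈ R.I, x u * s u + y u * t u = deriv f u / 2) (hu : u ∈ R.I) :
    deriv x u * s u + x u * deriv s u + (deriv y u * t u + y u * deriv t u)
      = deriv (deriv f) u / 2 := by
  have h1 := ((diff hx hu).hasDerivAt.mul (diff hs hu).hasDerivAt).add
    ((diff hy hu).hasDerivAt.mul (diff ht hu).hasDerivAt)
  have h2 := (diff (smooth_deriv hf) hu).hasDerivAt.div_const 2
  have h3 : (x * s + y * t) =ᶠ[nhds u] fun v => deriv f v / 2 :=
    Filter.eventually_of_mem (R.isOpen.mem_nhds hu) h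
  exact h1.unique (h2.congr_of_eventuallyEq h3)

theorem metric_symm (p : Coord) (a b : Fin 4) : R.metric p a b = R.metric p b a := by
  fin_cases a <;> fin_cases b <;> rfl

theorem det_metric (p : Coord) : (R.metric p).det = -(R.k (p 0)) ^ 2 * R.det (p 0) := by
  simp [metric, Matrix.det_succ_row_zero, Fin.sum_univ_succ, det, Fin.succAbove]
  ring

theorem isUnit_det (hp : p ∈ R.region) : IsUnit (R.metric p).det := by
  rw [det_metric]
  exact (mul_ne_zero (neg_ne_zero.2 (pow_ne_zero 2 (R.k_ne _ hp))) (det_ne hp)).isUnit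

theorem pdM_metric_eq (hp : p ∈ R.region) (c : Fin 4) :
    pdM c R.metric p = if c = 0 then
      !![0, deriv R.k (p 0), 0, 0; deriv R.k (p 0), 0, 0, 0;
        0, 0, deriv R.a (p 0), deriv R.b (p 0); 0, 0, deriv R.b (p 0), deriv R.d (p 0)]
      else 0 := by
  have hk := pd_comp_zero (diff R.smooth_k hp) c
  have ha := pd_comp_zero (diff R.smooth_a hp) c
  have hb := pd_comp_zero (diff R.smooth_b hp) c
  have hd := pd_comp_zero (diff R.smooth_d hp) c
  have h0 : pd c (fun _ : Coord => (0 : ℝ)) p = 0 := by simp [pd]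
  split_ifs with hc <;> simp only [hc, if_true, if_false] at hk ha hb hd <;>
    ext i j <;> fin_cases i <;> fin_cases j <;> simp [pdM, metric, hk, ha, hb, hd, h0, hc] <;>
    first | exact hk | exact ha | exact hb | exact hd | (subst hc; assumption)

/-- No inverse metric is computed: the proposed matrices are symmetric in the lower indices and
compatible with the metric, which by hL = ½h' is a linear check, and `conn_unique` identifies them.
-/
theorem conn_metric (hp : p ∈ R.region) (c : Fin 4) : conn R.metric c p = R.connMat (p 0) c := by
  have h11 := hL11 hp
  have h12 := hL12 hp
  have h21 := hL21 hp
  have h22 := hL22 hp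
  have hk := R.k_ne _ hp
  have hkap : R.kap (p 0) * R.k (p 0) = deriv R.k (p 0) := div_mul_cancel₀ _ hk
  have e : ∀ x, R.k (p 0) * (x / (2 * R.k (p 0))) = x / 2 := fun x => by field_simp
  have e' : ∀ x, x / (2 * R.k (p 0)) * R.k (p 0) = x / 2 := fun x => by field_simp
  refine conn_unique metric_symm (isUnit_det hp) _ ?_ ?_ c
  · intro i j k
    fin_cases i <;> fin_cases j <;> fin_cases k <;> rfl
  · intro b
    rw [pdM_metric_eq hp]
    ext i j
    fin_cases b <;> fin_cases i <;> fin_cases j <;>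
      simp [connMat, metric, Matrix.mul_apply, Fin.sum_univ_four, e, e'] <;> linarith

end RosenForm

namespace RosenForm
variable {R : RosenForm} {u : ℝ} {p : Coord}

theorem connMat_smooth (c i j : Fin 4) : ContDiffOn ℝ ∞ (fun u => R.connMat u c i j) R.I := by
  have hk : ∀ f : ℝ → ℝ, ContDiffOn ℝ ∞ f R.I →
      ContDiffOn ℝ ∞ (fun u => -(deriv f u / (2 * R.k u))) R.I := fun f hf =>
    ((smooth_deriv hf).div (contDiffOn_const.mul R.smooth_k)
      fun u hu => mul_ne_zero two_ne_zero (R.k_ne u hu)).neg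
  fin_cases c <;> fin_cases i <;> fin_cases j <;> first
    | exact contDiffOn_const
    | exact R.smooth_kap
    | exact R.smooth_L11
    | exact R.smooth_L12
    | exact R.smooth_L21
    | exact R.smooth_L22
    | exact hk _ R.smooth_a
    | exact hk _ R.smooth_b
    | exact hk _ R.smooth_d

theorem isMetricOn (R : RosenForm) : IsMetricOn R.metric R.region where
  isOpen := R.isOpen_region
  smooth i j := by
    have h0 : ContDiffOn ℝ ∞ (fun q : Coord => q 0) R.region := (contDiff_apply ℝ ℝ 0).contDiffOn
    have hm : ∀ f : ℝ → ℝ, ContDiffOn ℝ ∞ f R.I →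
        ContDiffOn ℝ ∞ (fun q : Coord => f (q 0)) R.region := fun f hf => hf.comp h0 fun q hq => hq
    fin_cases i <;> fin_cases j <;> first
      | exact contDiffOn_const
      | exact hm _ R.smooth_k
      | exact hm _ R.smooth_a
      | exact hm _ R.smooth_b
      | exact hm _ R.smooth_d
  smooth_conn c i j := by
    have h0 : ContDiffOn ℝ ∞ (fun q : Coord => q 0) R.region := (contDiff_apply ℝ ℝ 0).contDiffOn
    have h1 : ContDiffOn ℝ ∞ (fun q : Coord => R.connMat (q 0) c i j) R.region :=
      (connMat_smooth c i j).comp h0 fun q hq => hq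
    exact h1.congr fun q hq => by rw [conn_metric hq]
  symm := metric_symm
  isUnit_det _ hp := isUnit_det hp

variable (R) in
/-- The `u`-derivatives of the connection matrices. -/
def connMatDeriv (u : ℝ) : Fin 4 → Matrix (Fin 4) (Fin 4) ℝ :=
  ![!![deriv R.kap u, 0, 0, 0; 0, 0, 0, 0; 0, 0, deriv R.L11 u, deriv R.L12 u;
      0, 0, deriv R.L21 u, deriv R.L22 u],
    0,
    !![0, 0, 0, 0; 0, 0, deriv (fun u => -(deriv R.a u / (2 * R.k u))) u,
        deriv (fun u => -(deriv R.b u / (2 * R.k u))) u;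
      deriv R.L11 u, 0, 0, 0; deriv R.L21 u, 0, 0, 0],
    !![0, 0, 0, 0; 0, 0, deriv (fun u => -(deriv R.b u / (2 * R.k u))) u,
        deriv (fun u => -(deriv R.d u / (2 * R.k u))) u;
      deriv R.L12 u, 0, 0, 0; deriv R.L22 u, 0, 0, 0]]

theorem deriv_connMat (u : ℝ) (d i j : Fin 4) :
    deriv (fun u => R.connMat u d i j) u = R.connMatDeriv u d i j := by
  have h0 : deriv (fun _ : ℝ => (0 : ℝ)) u = 0 := deriv_const _ _
  fin_cases d <;> fin_cases i <;> fin_cases j <;> first | exact h0 | rfl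

theorem pdM_conn (hp : p ∈ R.region) (c d : Fin 4) :
    pdM c (conn R.metric d) p = if c = 0 then R.connMatDeriv (p 0) d else 0 := by
  rw [pdM_congr R.isOpen_region (fun q hq => conn_metric hq d) hp]
  ext i j
  simp only [pdM, Matrix.of_apply]
  rw [pd_comp_zero (f := fun u => R.connMat u d i j) (diff (connMat_smooth d i j) hp),
    deriv_connMat]
  split_ifs <;> rfl

variable (R) in
/-- The wave profile as a `4 × 4` matrix. -/
def profile (u : ℝ) : Matrix (Fin 4) (Fin 4) ℝ :=
  !![0, 0, 0, 0; 0, 0, 0, 0; 0, 0, R.H11 u, R.H12 u; 0, 0, R.H12 u, R.H22 u]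

theorem deriv_div_two_k {f : ℝ → ℝ} (hf : ContDiffOn ℝ ∞ f R.I) (hu : u ∈ R.I) :
    R.k u * deriv (fun u => deriv f u / (2 * R.k u)) u
      = deriv (deriv f) u / 2 - R.kap u * deriv f u / 2 := by
  have hk := R.k_ne u hu
  have h := (diff (smooth_deriv hf) hu).hasDerivAt.fun_div
    ((diff R.smooth_k hu).hasDerivAt.const_mul 2) (mul_ne_zero two_ne_zero hk)
  rw [h.deriv, kap]
  field_simp

/-- `h' h⁻¹ h'` is symmetric. -/
theorem hL_symm (hu : u ∈ R.I) : deriv R.a u * R.L12 u + deriv R.b u * R.L22 u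
    = deriv R.b u * R.L11 u + deriv R.d u * R.L21 u := by
  have := det_ne hu
  simp only [L11, L12, L21, L22]; field_simp; ring

theorem curv_antisymm (g : MetricField) (c d : Fin 4) (p : Coord) :
    curv g c d p = -curv g d c p := by
  simp only [curv]; abel

theorem curv_self (g : MetricField) (c : Fin 4) (p : Coord) : curv g c c p = 0 := by
  simp only [curv]; abel

theorem k_mul_div (hu : u ∈ R.I) (x : ℝ) : R.k u * (x / (2 * R.k u)) = x / 2 := by
  have := R.k_ne _ hu
  field_simp

/-- The lower-left entries are a column of h(L' + L² − κL); since hL' = ½h'' − h'L and hL² = ½h'L,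
this is the profile H. The upper-right entries come from Γ^r_ij = −h'_ij/(2k) and give the same
column with the opposite sign. -/
theorem metric_mul_curv_two (hp : p ∈ R.region) :
    R.metric p * curv R.metric 0 2 p = !![0, 0, -R.H11 (p 0), -R.H12 (p 0); 0, 0, 0, 0;
      R.H11 (p 0), 0, 0, 0; R.H12 (p 0), 0, 0, 0] := by
  have d1 := deriv_row R.smooth_a R.smooth_b R.smooth_L11 R.smooth_L21 R.smooth_a
    (fun _ => hL11) hp
  have d3 := deriv_row R.smooth_b R.smooth_d R.smooth_L11 R.smooth_L21 R.smooth_b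
    (fun _ => hL21) hp
  have k1 := deriv_div_two_k R.smooth_a hp
  have k2 := deriv_div_two_k R.smooth_b hp
  have e := k_mul_div hp
  rw [curv, pdM_conn hp, pdM_conn hp, conn_metric hp, conn_metric hp]
  ext i j
  fin_cases i <;> fin_cases j <;>
    simp [connMat, connMatDeriv, metric, Matrix.mul_apply, Fin.sum_univ_four, H11, H12]
  · linear_combination -k1 + R.L21 (p 0) * e (deriv R.b (p 0)) + R.L11 (p 0) * e (deriv R.a (p 0))
  · linear_combination -k2 + R.L22 (p 0) * e (deriv R.b (p 0)) + R.L12 (p 0) * e (deriv R.a (p 0))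
  · linear_combination d1 + R.L11 (p 0) * hL11 hp + R.L21 (p 0) * hL12 hp
      - R.kap (p 0) * hL11 hp
  · linear_combination d3 + R.L11 (p 0) * hL21 hp + R.L21 (p 0) * hL22 hp
      - R.kap (p 0) * hL21 hp + (1 / 2) * hL_symm hp

theorem metric_mul_curv_three (hp : p ∈ R.region) :
    R.metric p * curv R.metric 0 3 p = !![0, 0, -R.H12 (p 0), -R.H22 (p 0); 0, 0, 0, 0;
      R.H12 (p 0), 0, 0, 0; R.H22 (p 0), 0, 0, 0] := by
  have d2 := deriv_row R.smooth_a R.smooth_b R.smooth_L12 R.smooth_L22 R.smooth_b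
    (fun _ => hL12) hp
  have d4 := deriv_row R.smooth_b R.smooth_d R.smooth_L12 R.smooth_L22 R.smooth_d
    (fun _ => hL22) hp
  have k2 := deriv_div_two_k R.smooth_b hp
  have k3 := deriv_div_two_k R.smooth_d hp
  have e := k_mul_div hp
  rw [curv, pdM_conn hp, pdM_conn hp, conn_metric hp, conn_metric hp]
  ext i j
  fin_cases i <;> fin_cases j <;>
    simp [connMat, connMatDeriv, metric, Matrix.mul_apply, Fin.sum_univ_four, H22, H12]
  · linear_combination -k2 + R.L21 (p 0) * e (deriv R.d (p 0)) + R.L11 (p 0) * e (deriv R.b (p 0))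
      - (1 / 2) * hL_symm hp
  · linear_combination -k3 + R.L22 (p 0) * e (deriv R.d (p 0)) + R.L12 (p 0) * e (deriv R.b (p 0))
  · linear_combination d2 + R.L12 (p 0) * hL11 hp + R.L22 (p 0) * hL12 hp
      - R.kap (p 0) * hL12 hp
  · linear_combination d4 + R.L12 (p 0) * hL21 hp + R.L22 (p 0) * hL22 hp
      - R.kap (p 0) * hL22 hp

theorem curv_two_three (hp : p ∈ R.region) : curv R.metric 2 3 p = 0 := by
  have := R.k_ne _ hp
  rw [curv, pdM_conn hp, pdM_conn hp, conn_metric hp, conn_metric hp]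
  ext i j
  fin_cases i <;> fin_cases j <;> simp [connMat, Matrix.mul_apply, Fin.sum_univ_four]
  field_simp
  linear_combination -hL_symm hp

/-- No coefficient depends on r and the connection matrix in the r direction is zero: ∂_r is a
symmetry that contributes no curvature. -/
theorem curv_one (hp : p ∈ R.region) (d : Fin 4) : curv R.metric 1 d p = 0 := by
  rw [curv, pdM_conn hp, pdM_conn hp, conn_metric hp, conn_metric hp]
  have h1 : R.connMat (p 0) 1 = 0 := rfl
  have h2 : R.connMatDeriv (p 0) 1 = 0 := rfl
  simp [h1, h2]

/-- The curvature of a Rosen metric. -/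
theorem riemann_eq (hp : p ∈ R.region) (a b c d : Fin 4) :
    riemann R.metric a b c d p
      = (if b = 0 ∧ c = 0 then R.profile (p 0) a d else 0)
        + (if a = 0 ∧ d = 0 then R.profile (p 0) b c else 0)
        - (if a = 0 ∧ c = 0 then R.profile (p 0) b d else 0)
        - (if b = 0 ∧ d = 0 then R.profile (p 0) a c else 0) := by
  have h : riemann R.metric a b c d p = (R.metric p * curv R.metric c d p) a b := by
    simp only [riemann, riemannUp_eq_curv, Matrix.mul_apply]
  have h02 := metric_mul_curv_two hp
  have h03 := metric_mul_curv_three hp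
  have h23 := curv_two_three hp
  have h1 := curv_one hp
  have anti := curv_antisymm R.metric
  have self := fun c => curv_self R.metric c p
  rw [h]
  have hc : ∀ c, curv R.metric c 1 p = 0 := fun c => by rw [anti, h1, neg_zero]
  have h20 : R.metric p * curv R.metric 2 0 p = -(R.metric p * curv R.metric 0 2 p) := by
    rw [anti 2 0, Matrix.mul_neg]
  have h30 : R.metric p * curv R.metric 3 0 p = -(R.metric p * curv R.metric 0 3 p) := by
    rw [anti 3 0, Matrix.mul_neg]
  have h32 : curv R.metric 3 2 p = 0 := by rw [anti, h23, neg_zero]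
  rw [h02] at h20
  rw [h03] at h30
  have key : R.metric p * curv R.metric c d p = Matrix.of fun a b =>
      (if b = 0 ∧ c = 0 then R.profile (p 0) a d else 0)
        + (if a = 0 ∧ d = 0 then R.profile (p 0) b c else 0)
        - (if a = 0 ∧ c = 0 then R.profile (p 0) b d else 0)
        - (if b = 0 ∧ d = 0 then R.profile (p 0) a c else 0) := by
    ext i j
    fin_cases c <;> fin_cases d <;>
      simp only [Fin.zero_eta, Fin.mk_one, Fin.reduceFinMk, h02, h03, h20, h30, h23, h32, h1, hc,
        self, Matrix.mul_zero, Matrix.of_apply] <;>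
      fin_cases i <;> fin_cases j <;> simp [profile]
  rw [key, Matrix.of_apply]

variable (R) in
/-- The trace of the wave profile, up to the factor `det h`. -/
def trace (u : ℝ) : ℝ := R.d u * R.H11 u - 2 * R.b u * R.H12 u + R.a u * R.H22 u

/-- The component R_uu is minus the h-trace of H. Multiplying it by det h clears the inverse of h,
and this cleared form is what the later polynomial identities use. -/
theorem trace_eq_zero (hp : p ∈ R.region) (hric : ricci R.metric 0 0 p = 0) :
    R.trace (p 0) = 0 := by
  have h : ∀ a c d, riemann R.metric a 0 c d p
      = ∑ e, R.metric p a e * riemannUp R.metric e 0 c d p := fun a c d => rfl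
  have h2 := h 2 2 0
  have h2' := h 3 2 0
  have h3 := h 2 3 0
  have h3' := h 3 3 0
  rw [riemann_eq hp] at h2 h3 h2' h3'
  have h1 : riemannUp R.metric 1 0 1 0 p = 0 := by rw [riemannUp_eq_curv, curv_one hp]; rfl
  have h0 : riemannUp R.metric 0 0 0 0 p = 0 := by rw [riemannUp_eq_curv, curv_self]; rfl
  simp only [ricci, Fin.sum_univ_four, h0, h1] at hric
  simp [Fin.sum_univ_four, metric, profile] at h2 h2' h3 h3'
  simp only [trace]
  linear_combination -R.d (p 0) * h2 + R.b (p 0) * h2' + R.b (p 0) * h3 - R.a (p 0) * h3'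
    - (R.a (p 0) * R.d (p 0) - R.b (p 0) ^ 2) * hric

end RosenForm

/-! ### Symmetric forms on the complexified transverse plane -/

/-- The bilinear form with components `(s, t, w)` on the transverse parts of complex vectors. -/
def bil (s t w : ℝ) (x y : Fin 4 → ℂ) : ℂ :=
  s * x 2 * y 2 + t * (x 2 * y 3 + x 3 * y 2) + w * x 3 * y 3

/-- Componentwise complex conjugation. -/
def conjV (x : Fin 4 → ℂ) : Fin 4 → ℂ := fun a => starRingEnd ℂ (x a)

theorem bil_conj (s t w : ℝ) (x y : Fin 4 → ℂ) :
    bil s t w (conjV x) (conjV y) = starRingEnd ℂ (bil s t w x y) := by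
  simp [bil, conjV]

namespace RosenForm

variable {R : RosenForm} {u : ℝ} {p : Coord}

theorem inner4_eq (p : Coord) (v w : Fin 4 → ℂ) : inner4 R.metric p v w
    = R.k (p 0) * (v 0 * w 1 + v 1 * w 0) + bil (R.a (p 0)) (R.b (p 0)) (R.d (p 0)) v w := by
  simp [inner4, metric, Fin.sum_univ_four, bil]
  ring

theorem weylC_eq (hp : p ∈ R.region) (hric : ∀ a b, ricci R.metric a b p = 0)
    (v w x y : Fin 4 → ℂ) : weylC R.metric p v w x y
    = w 0 * x 0 * bil (R.H11 (p 0)) (R.H12 (p 0)) (R.H22 (p 0)) v y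
      + v 0 * y 0 * bil (R.H11 (p 0)) (R.H12 (p 0)) (R.H22 (p 0)) w x
      - v 0 * x 0 * bil (R.H11 (p 0)) (R.H12 (p 0)) (R.H22 (p 0)) w y
      - w 0 * y 0 * bil (R.H11 (p 0)) (R.H12 (p 0)) (R.H22 (p 0)) v x := by
  have hweyl : ∀ a b c d, weyl R.metric a b c d p = riemann R.metric a b c d p := by
    intro a b c d
    simp [weyl, scalarCurvature, hric]
  simp only [weylC, hweyl, riemann_eq hp]
  simp [Fin.sum_univ_four, profile, bil]
  ring

end RosenForm

/-- The area form of the transverse parts. -/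
def wedge (x y : Fin 4 → ℂ) : ℂ := x 2 * y 3 - x 3 * y 2

theorem bil_gram (a b d : ℝ) (x y : Fin 4 → ℂ) :
    bil a b d x x * bil a b d y y - bil a b d x y ^ 2
      = ((a * d - b ^ 2 : ℝ) : ℂ) * wedge x y ^ 2 := by
  simp only [bil, wedge]; push_cast; ring

/-- The contraction of two symmetric forms with two area forms, which is the trace of one form with
respect to the other up to a determinant. When the trace is zero and x is null, it expresses
products of H by those of h: z = y = x̄ gives H(x, x̄) = 0, and z = m' gives H(m, m'). -/
theorem bil_trace (a b d s t w : ℝ) (x y z : Fin 4 → ℂ) :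
    bil a b d x x * bil s t w y z + bil a b d y z * bil s t w x x
      - bil a b d x y * bil s t w x z - bil a b d x z * bil s t w x y
      = wedge x y * wedge x z * ((d * s - 2 * b * t + a * w : ℝ) : ℂ) := by
  simp only [bil, wedge]; push_cast; ring

theorem bil_comm (s t w : ℝ) (x y : Fin 4 → ℂ) : bil s t w x y = bil s t w y x := by
  simp only [bil]; ring

/-- A trace-free form that vanishes on a nonzero complex null vector is zero. -/
theorem eq_zero_of_null {a b d s t w : ℝ} {x : Fin 4 → ℂ}
    (htr : d * s - 2 * b * t + a * w = 0) (hx : bil a b d x x = 0)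
    (hH : bil s t w x x = 0) (hn : bil a b d x (conjV x) ≠ 0) : s = 0 ∧ t = 0 ∧ w = 0 := by
  have hx' : bil a b d (conjV x) (conjV x) = 0 := by rw [bil_conj, hx, map_zero]
  have hH' : bil s t w (conjV x) (conjV x) = 0 := by rw [bil_conj, hH, map_zero]
  -- The trace identity kills H(x, x̄), and reality of H kills H(x̄, x̄). Since x and x̄ are
  -- independent by the Gram identity, all components of H vanish.
  have h1 := bil_trace a b d s t w x (conjV x) (conjV x)
  rw [htr, hx, hx', hH] at h1
  have h2 : bil s t w x (conjV x) = 0 := by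
    have : bil a b d x (conjV x) * bil s t w x (conjV x) = 0 := by
      push_cast at h1; linear_combination -(1 / 2) * h1
    exact (mul_eq_zero.1 this).resolve_left hn
  have hω : wedge x (conjV x) ^ 2 ≠ 0 := by
    intro h
    have h3 := bil_gram a b d x (conjV x)
    rw [hx, h] at h3
    exact hn (pow_eq_zero_iff two_ne_zero |>.1 (by linear_combination -h3))
  have e1 : wedge x (conjV x) ^ 2 * (s : ℂ) = 0 := by
    have : wedge x (conjV x) ^ 2 * (s : ℂ) = conjV x 3 ^ 2 * bil s t w x x
        - 2 * x 3 * conjV x 3 * bil s t w x (conjV x)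
        + x 3 ^ 2 * bil s t w (conjV x) (conjV x) := by
      simp only [bil, wedge]; ring
    rw [this, hH, hH', h2]; ring
  have e2 : wedge x (conjV x) ^ 2 * (t : ℂ) = 0 := by
    have : wedge x (conjV x) ^ 2 * (t : ℂ) = -conjV x 2 * conjV x 3 * bil s t w x x
        + (x 2 * conjV x 3 + x 3 * conjV x 2) * bil s t w x (conjV x)
        - x 2 * x 3 * bil s t w (conjV x) (conjV x) := by
      simp only [bil, wedge]; ring
    rw [this, hH, hH', h2]; ring
  have e3 : wedge x (conjV x) ^ 2 * (w : ℂ) = 0 := by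
    have : wedge x (conjV x) ^ 2 * (w : ℂ) = conjV x 2 ^ 2 * bil s t w x x
        - 2 * x 2 * conjV x 2 * bil s t w x (conjV x)
        + x 2 ^ 2 * bil s t w (conjV x) (conjV x) := by
      simp only [bil, wedge]; ring
    rw [this, hH, hH', h2]; ring
  exact ⟨by exact_mod_cast (mul_eq_zero.1 e1).resolve_left hω,
    by exact_mod_cast (mul_eq_zero.1 e2).resolve_left hω,
    by exact_mod_cast (mul_eq_zero.1 e3).resolve_left hω⟩

/-! ### Rigidity of canonical tetrads -/

namespace RosenForm

variable {R : RosenForm} {u : ℝ} {p : Coord} {T : Tetrad} {V : Set Coord}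

/-- In a canonical tetrad, `ℓ` is tangent to the wave fronts. -/
theorem l_zero (hT : T.IsCanonicalOn R.metric V) (hVR : V ⊆ R.region)
    (hvac : IsVacuumOn R.metric V) (hp : p ∈ V) : T.l p 0 = 0 := by
  by_contra hL
  have hric := hvac p hp
  have htr := trace_eq_zero (hVR hp) (hric 0 0)
  have hll := hT.l_l p hp
  have hlm := hT.l_m p hp
  have hmm := hT.m_m p hp
  have hmb := hT.m_mBar p hp
  have hlmb : inner4 R.metric p (T.lC p) (T.mBar p) = 0 := by
    have := congrArg (starRingEnd ℂ) hlm
    rw [inner4_eq] at this ⊢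
    simpa [bil, Tetrad.lC, Tetrad.mBar] using this
  have h0 := hT.psi0_eq p hp
  have h4 := hT.psi4_eq p hp
  rw [Tetrad.psi0, weylC_eq (hVR hp) hric] at h0
  rw [Tetrad.psi4, weylC_eq (hVR hp) hric] at h4
  rw [inner4_eq] at hll hlm hmm hmb hlmb
  -- The combination of ℓ and m without u-component. It represents the bivector ℓ∧m, so Ψ₀ = −H(x,
  -- x), while x is h-null with h(x, x̄) = (ℓ^u)². If ℓ^u ≠ 0, then Ψ₀ = 0 forces H = 0, against Ψ₄
  -- = 1.
  set x : Fin 4 → ℂ := fun i => T.lC p 0 * T.m p i - T.m p 0 * T.lC p i with hx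
  have hxc : ∀ i, conjV x i = T.lC p 0 * T.mBar p i - T.mBar p 0 * T.lC p i := by
    intro i; simp [conjV, hx, Tetrad.lC, Tetrad.mBar]
  have e1 : bil (R.a (p 0)) (R.b (p 0)) (R.d (p 0)) x x = 0 := by
    have e : bil (R.a (p 0)) (R.b (p 0)) (R.d (p 0)) x x
        = T.lC p 0 ^ 2 * bil (R.a (p 0)) (R.b (p 0)) (R.d (p 0)) (T.m p) (T.m p)
          - 2 * T.lC p 0 * T.m p 0 * bil (R.a (p 0)) (R.b (p 0)) (R.d (p 0)) (T.lC p) (T.m p)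
          + T.m p 0 ^ 2 * bil (R.a (p 0)) (R.b (p 0)) (R.d (p 0)) (T.lC p) (T.lC p) := by
      simp only [bil, hx]; ring
    rw [e]
    linear_combination T.lC p 0 ^ 2 * hmm - 2 * T.lC p 0 * T.m p 0 * hlm + T.m p 0 ^ 2 * hll
  have e2 : bil (R.H11 (p 0)) (R.H12 (p 0)) (R.H22 (p 0)) x x = 0 := by
    have e : bil (R.H11 (p 0)) (R.H12 (p 0)) (R.H22 (p 0)) x x
        = T.lC p 0 ^ 2 * bil (R.H11 (p 0)) (R.H12 (p 0)) (R.H22 (p 0)) (T.m p) (T.m p)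
          - T.lC p 0 * T.m p 0 * bil (R.H11 (p 0)) (R.H12 (p 0)) (R.H22 (p 0)) (T.lC p) (T.m p)
          - T.lC p 0 * T.m p 0 * bil (R.H11 (p 0)) (R.H12 (p 0)) (R.H22 (p 0)) (T.m p) (T.lC p)
          + T.m p 0 ^ 2 * bil (R.H11 (p 0)) (R.H12 (p 0)) (R.H22 (p 0)) (T.lC p) (T.lC p) := by
      simp only [bil, hx]; ring
    rw [e]
    linear_combination -h0
  have e3 : bil (R.a (p 0)) (R.b (p 0)) (R.d (p 0)) x (conjV x) = T.lC p 0 ^ 2 := by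
    have e : bil (R.a (p 0)) (R.b (p 0)) (R.d (p 0)) x (conjV x)
        = T.lC p 0 ^ 2 * bil (R.a (p 0)) (R.b (p 0)) (R.d (p 0)) (T.m p) (T.mBar p)
          - T.lC p 0 * T.m p 0 * bil (R.a (p 0)) (R.b (p 0)) (R.d (p 0)) (T.lC p) (T.mBar p)
          - T.lC p 0 * T.mBar p 0 * bil (R.a (p 0)) (R.b (p 0)) (R.d (p 0)) (T.lC p) (T.m p)
          + T.m p 0 * T.mBar p 0
            * bil (R.a (p 0)) (R.b (p 0)) (R.d (p 0)) (T.lC p) (T.lC p) := by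
      simp only [bil, hxc]; simp only [hx]; ring
    rw [e]
    linear_combination T.lC p 0 ^ 2 * hmb - T.lC p 0 * T.m p 0 * hlmb
      - T.lC p 0 * T.mBar p 0 * hlm + T.m p 0 * T.mBar p 0 * hll
  have hne : T.lC p 0 ^ 2 ≠ 0 := pow_ne_zero 2 (by simpa [Tetrad.lC] using hL)
  obtain ⟨z1, z2, z3⟩ := eq_zero_of_null (a := R.a (p 0)) (b := R.b (p 0)) (d := R.d (p 0))
    htr e1 e2 (by rw [e3]; exact hne)
  simp [bil, z1, z2, z3] at h4

theorem l_transverse (hT : T.IsCanonicalOn R.metric V) (hVR : V ⊆ R.region)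
    (hvac : IsVacuumOn R.metric V) (hp : p ∈ V) : T.l p 2 = 0 ∧ T.l p 3 = 0 := by
  have h0 := l_zero hT hVR hvac hp
  have hll := hT.l_l p hp
  rw [inner4_eq] at hll
  simp only [Tetrad.lC, bil, h0] at hll
  have hr : R.a (p 0) * T.l p 2 * T.l p 2 + R.b (p 0) * (T.l p 2 * T.l p 3 + T.l p 3 * T.l p 2)
      + R.d (p 0) * T.l p 3 * T.l p 3 = 0 := by
    have : ((R.a (p 0) * T.l p 2 * T.l p 2 + R.b (p 0) * (T.l p 2 * T.l p 3 + T.l p 3 * T.l p 2)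
      + R.d (p 0) * T.l p 3 * T.l p 3 : ℝ) : ℂ) = 0 := by
      push_cast at hll ⊢
      linear_combination hll
    exact_mod_cast this
  have ha := R.a_pos _ (hVR hp)
  have hd := R.det_pos _ (hVR hp)
  have h3 : T.l p 3 = 0 := by
    have : (R.a (p 0) * R.d (p 0) - R.b (p 0) ^ 2) * T.l p 3 ^ 2 = 0 := by
      have e1 : (R.a (p 0) * T.l p 2 + R.b (p 0) * T.l p 3) ^ 2
        + (R.a (p 0) * R.d (p 0) - R.b (p 0) ^ 2) * T.l p 3 ^ 2 = 0 := by
          linear_combination R.a (p 0) * hr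
      nlinarith [sq_nonneg (R.a (p 0) * T.l p 2 + R.b (p 0) * T.l p 3),
        mul_nonneg hd.le (sq_nonneg (T.l p 3))]
    exact pow_eq_zero_iff two_ne_zero |>.1 ((mul_eq_zero.1 this).resolve_left hd.ne')
  refine ⟨?_, h3⟩
  rw [h3] at hr
  have : R.a (p 0) * T.l p 2 ^ 2 = 0 := by linear_combination hr
  exact pow_eq_zero_iff two_ne_zero |>.1 ((mul_eq_zero.1 this).resolve_left ha.ne')

/-- Since ℓ is a nonzero multiple of ∂_r, the product ℓ·m is a nonzero multiple of m^u. -/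
theorem m_zero (hT : T.IsCanonicalOn R.metric V) (hVR : V ⊆ R.region)
    (hvac : IsVacuumOn R.metric V) (hp : p ∈ V) : T.m p 0 = 0 := by
  have h0 := l_zero hT hVR hvac hp
  obtain ⟨h2, h3⟩ := l_transverse hT hVR hvac hp
  have hlm := hT.l_m p hp
  have hln := hT.l_n p hp
  rw [inner4_eq] at hlm hln
  simp only [Tetrad.lC, Tetrad.nC, bil, h0, h2, h3] at hlm hln
  push_cast at hlm hln
  have hk : (R.k (p 0) : ℂ) * T.l p 1 ≠ 0 := by
    intro h
    have : (0 : ℂ) = -1 := by linear_combination hln - (T.n p 0 : ℂ) * h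
    norm_num at this
  have : (R.k (p 0) : ℂ) * T.l p 1 * T.m p 0 = 0 := by linear_combination hlm
  exact (mul_eq_zero.1 this).resolve_left hk

/-- The transverse part of `m` in a canonical tetrad. -/
theorem m_transverse (hT : T.IsCanonicalOn R.metric V) (hVR : V ⊆ R.region)
    (hvac : IsVacuumOn R.metric V) (hp : p ∈ V) :
    bil (R.a (p 0)) (R.b (p 0)) (R.d (p 0)) (T.m p) (T.m p) = 0 ∧
    bil (R.a (p 0)) (R.b (p 0)) (R.d (p 0)) (T.m p) (conjV (T.m p)) = 1 ∧
    (T.n p 0 : ℂ) ^ 2 * bil (R.H11 (p 0)) (R.H12 (p 0)) (R.H22 (p 0)) (T.m p) (T.m p) = -1 := by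
  have hm0 := m_zero hT hVR hvac hp
  have hmm := hT.m_m p hp
  have hmb := hT.m_mBar p hp
  have h4 := hT.psi4_eq p hp
  rw [Tetrad.psi4, weylC_eq (hVR hp) (hvac p hp)] at h4
  rw [inner4_eq] at hmm hmb
  have hmb0 : T.mBar p 0 = 0 := by simp [Tetrad.mBar, hm0]
  have hmbar : T.mBar p = conjV (T.m p) := rfl
  rw [hm0] at hmm hmb
  rw [hmb0] at hmb h4
  refine ⟨by linear_combination hmm, by rw [← hmbar]; linear_combination hmb, ?_⟩
  have h5 : (T.n p 0 : ℂ) ^ 2 * bil (R.H11 (p 0)) (R.H12 (p 0)) (R.H22 (p 0)) (T.mBar p) (T.mBar p)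
      = -1 := by
    simp only [Tetrad.nC] at h4
    linear_combination -h4
  have h6 := congrArg (starRingEnd ℂ) h5
  rw [hmbar, bil_conj] at h6
  simpa using h6

end RosenForm

/-! ### The spin coefficient and the rotation of the polarization axes -/

/-- The derivative of the vector field `Y` along the real vector `v`, componentwise. -/
def dirDeriv (Y : Coord → Fin 4 → ℂ) (v : Coord) (p : Coord) : Fin 4 → ℂ :=
  fun a => ∑ b, (v b : ℂ) * pd b (fun q => Y q a) p

theorem hasDerivAt_line {E : Type*} [NormedAddCommGroup E] [NormedSpace ℝ E] {f : Coord → E}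
    {p : Coord} (hf : DifferentiableAt ℝ f p) (v : Coord) :
    HasDerivAt (fun t : ℝ => f (p + t • v)) (∑ b, v b • pd b f p) 0 := by
  rw [← fderiv_eq_sum_pd]
  exact hf.hasFDerivAt.hasLineDerivAt v

/-- The 3×3 determinant of three symmetric forms evaluated on xx, xy, yy: passing to the basis x, y
of the plane multiplies determinants on symmetric squares by the cube of the determinant of x, y. -/
theorem bil_det (s t w s' t' w' s'' t'' w'' : ℝ) (x y : Fin 4 → ℂ) :
    bil s t w x x * (bil s' t' w' x y * bil s'' t'' w'' y y
        - bil s' t' w' y y * bil s'' t'' w'' x y)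
      - bil s t w x y * (bil s' t' w' x x * bil s'' t'' w'' y y
        - bil s' t' w' y y * bil s'' t'' w'' x x)
      + bil s t w y y * (bil s' t' w' x x * bil s'' t'' w'' x y
        - bil s' t' w' x y * bil s'' t'' w'' x x)
      = wedge x y ^ 3 * ((s * (t' * w'' - w' * t'') - t * (s' * w'' - w' * s'')
        + w * (s' * t'' - t' * s'') : ℝ) : ℂ) := by
  simp only [bil, wedge]; push_cast; ring

namespace RosenForm

variable {R : RosenForm} {u : ℝ} {p : Coord} {T : Tetrad} {V : Set Coord}

variable (R) in
/-- The determinant of `h`, `H`, `H'` as vectors of the space of symmetric forms. It measures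
the rotation of the polarization axes. -/
def pol (u : ℝ) : ℝ :=
  R.a u * (R.H12 u * deriv R.H22 u - R.H22 u * deriv R.H12 u)
    - R.b u * (R.H11 u * deriv R.H22 u - R.H22 u * deriv R.H11 u)
    + R.d u * (R.H11 u * deriv R.H12 u - R.H12 u * deriv R.H11 u)

theorem inner4_covDeriv_m (hT : T.IsCanonicalOn R.metric V) (hV : IsOpen V) (hVR : V ⊆ R.region)
    (hvac : IsVacuumOn R.metric V) (hp : p ∈ V) :
    inner4 R.metric p (covDeriv R.metric (T.nC p) T.m p) (T.mBar p)
      = bil (R.a (p 0)) (R.b (p 0)) (R.d (p 0)) (dirDeriv T.m (T.n p) p) (conjV (T.m p))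
        + ((T.n p 0 / 2 : ℝ) : ℂ) * bil (deriv R.a (p 0)) (deriv R.b (p 0)) (deriv R.d (p 0))
          (T.m p) (conjV (T.m p)) := by
  have hm0 := m_zero hT hVR hvac hp
  have hpd : ∀ b, pd b (fun q => T.m q 0) p = 0 := by
    intro b
    rw [pd_congr_of_isOpen hV (g := fun _ => 0) (fun q hq => m_zero hT hVR hvac hq) hp]
    simp [pd]
  have hchr : ∀ a b c, christoffel R.metric a b c p = R.connMat (p 0) b a c := by
    intro a b c
    rw [← conn_metric (hVR hp)]
    rfl
  have hmb : T.mBar p = conjV (T.m p) := rfl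
  have hmb0 : conjV (T.m p) 0 = 0 := by simp [conjV, hm0]
  have c0 : covDeriv R.metric (T.nC p) T.m p 0 = 0 := by
    simp only [covDeriv, hchr, hpd]
    simp [Fin.sum_univ_four, connMat, hm0]
  have c2 : covDeriv R.metric (T.nC p) T.m p 2 = dirDeriv T.m (T.n p) p 2
      + T.n p 0 * (R.L11 (p 0) * T.m p 2 + R.L12 (p 0) * T.m p 3) := by
    simp only [covDeriv, hchr, dirDeriv, Tetrad.nC]
    simp [Fin.sum_univ_four, connMat, hm0]
    ring
  have c3 : covDeriv R.metric (T.nC p) T.m p 3 = dirDeriv T.m (T.n p) p 3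
      + T.n p 0 * (R.L21 (p 0) * T.m p 2 + R.L22 (p 0) * T.m p 3) := by
    simp only [covDeriv, hchr, dirDeriv, Tetrad.nC]
    simp [Fin.sum_univ_four, connMat, hm0]
    ring
  rw [inner4_eq, hmb, c0, hmb0]
  simp only [bil, c2, c3]
  have e : ∀ {x y : ℝ}, x = y → (x : ℂ) = (y : ℂ) := fun h => by rw [h]
  have e1 := e (hL11 (hVR hp))
  have e2 := e (hL12 (hVR hp))
  have e3 := e (hL21 (hVR hp))
  have e4 := e (hL22 (hVR hp))
  push_cast at e1 e2 e3 e4 ⊢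
  linear_combination (T.n p 0 : ℂ) * (T.m p 2 * conjV (T.m p) 2 * e1
    + T.m p 3 * conjV (T.m p) 2 * e2 + T.m p 2 * conjV (T.m p) 3 * e3
    + T.m p 3 * conjV (T.m p) 3 * e4)

theorem im_inner4_covDeriv_l {g : MetricField} (hl : ∀ a, DifferentiableAt ℝ (fun q => T.l q a) p) :
    (inner4 g p (covDeriv g (T.nC p) T.lC p) (T.nC p)).im = 0 := by
  have h : ∀ a, covDeriv g (T.nC p) T.lC p a
      = ((∑ b, T.n p b * (pd b (fun q => T.l q a) p + ∑ c, christoffel g a b c p * T.l p c) : ℝ)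
        : ℂ) := by
    intro a
    simp only [covDeriv, Tetrad.nC, Tetrad.lC, pd_ofReal (hl a)]
    push_cast
    rfl
  simp only [inner4, h, Tetrad.nC, ← Complex.ofReal_mul, ← Complex.ofReal_sum, Complex.ofReal_im]

/-- The ℓ-term of γ is real, and so is the Christoffel contribution ½n^u h'(m, m̄), being Hermitian
in m. Only the directional derivative of m can contribute an imaginary part. -/
theorem im_gamma (hT : T.IsCanonicalOn R.metric V) (hV : IsOpen V) (hVR : V ⊆ R.region)
    (hvac : IsVacuumOn R.metric V) (hp : p ∈ V) :
    2 * (T.gamma R.metric p).im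
      = (bil (R.a (p 0)) (R.b (p 0)) (R.d (p 0)) (dirDeriv T.m (T.n p) p) (conjV (T.m p))).im := by
  have hl : ∀ a, DifferentiableAt ℝ (fun q => T.l q a) p := fun a =>
    differentiableAt_pi.1 (differentiableAt_of_contDiffOn hV hT.smooth_l hp) a
  have hreal : (bil (deriv R.a (p 0)) (deriv R.b (p 0)) (deriv R.d (p 0))
          (T.m p) (conjV (T.m p))).im = 0 := by
    rw [← Complex.conj_eq_iff_im, ← bil_conj, bil_comm]
    congr 1
    funext i; simp [conjV]
  have h1 : ((1 : ℂ) / 2) = ((1 / 2 : ℝ) : ℂ) := by push_cast; ring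
  rw [Tetrad.gamma, h1, Complex.im_ofReal_mul, Complex.sub_im, im_inner4_covDeriv_l hl,
    inner4_covDeriv_m hT hV hVR hvac hp, Complex.add_im, Complex.im_ofReal_mul, hreal]
  ring

/-- The spin coefficient `γ` of a canonical tetrad is real exactly where the polarization axes
do not rotate. -/
theorem im_gamma_eq_zero_iff (hT : T.IsCanonicalOn R.metric V) (hV : IsOpen V)
    (hVR : V ⊆ R.region) (hvac : IsVacuumOn R.metric V) (hp : p ∈ V) :
    (T.gamma R.metric p).im = 0 ↔ R.pol (p 0) = 0 := by
  have hγ := im_gamma hT hV hVR hvac hp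
  obtain ⟨hmm, hmb, hH⟩ := m_transverse hT hVR hvac hp
  have htr := trace_eq_zero (hVR hp) (hvac p hp 0 0)
  rw [trace] at htr
  have hmm' : bil (R.a (p 0)) (R.b (p 0)) (R.d (p 0)) (conjV (T.m p)) (conjV (T.m p)) = 0 := by
    rw [bil_conj, hmm, map_zero]
  set m := T.m p with hm
  set m' := dirDeriv T.m (T.n p) p with hm'
  set n0 := T.n p 0 with hn0
  set F := bil (R.H11 (p 0)) (R.H12 (p 0)) (R.H22 (p 0)) m m with hF
  set F' := bil (deriv R.H11 (p 0)) (deriv R.H12 (p 0)) (deriv R.H22 (p 0)) m m with hF'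
  set α := bil (R.a (p 0)) (R.b (p 0)) (R.d (p 0)) m' (conjV m) with hα
  have hn : n0 ≠ 0 := by
    intro h
    rw [h] at hH
    norm_num at hH
  have hnC : (n0 : ℂ) ≠ 0 := by exact_mod_cast hn
  have t1 := bil_trace (R.a (p 0)) (R.b (p 0)) (R.d (p 0)) (R.H11 (p 0)) (R.H12 (p 0))
    (R.H22 (p 0)) m (conjV m) (conjV m)
  -- With the trace, h(m, m) and H(m, m̄) equal to zero this reads H(m, m') = h(m', m̄) H(m, m),
  -- which brings in the quantity `α` that determines Im γ.
  have t2 := bil_trace (R.a (p 0)) (R.b (p 0)) (R.d (p 0)) (R.H11 (p 0)) (R.H12 (p 0))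
    (R.H22 (p 0)) m (conjV m) m'
  rw [htr, hmm, hmm', hmb] at t1
  rw [htr, hmm, hmb, bil_comm (R.a (p 0)) (R.b (p 0)) (R.d (p 0)) (conjV m) m', ← hα, ← hF] at t2
  push_cast at t1 t2
  have hHb : bil (R.H11 (p 0)) (R.H12 (p 0)) (R.H22 (p 0)) m (conjV m) = 0 := by
    linear_combination -(1 / 2) * t1
  rw [hHb] at t2
  have hdm : ∀ a, DifferentiableAt ℝ (fun q => T.m q a) p := fun a =>
    differentiableAt_pi.1 (differentiableAt_of_contDiffOn hV hT.smooth_m hp) a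
  have hdn : DifferentiableAt ℝ (fun q => T.n q 0) p :=
    differentiableAt_pi.1 (differentiableAt_of_contDiffOn hV hT.smooth_n hp) 0
  set n0' := ∑ b, T.n p b • pd b (fun q => T.n q 0) p with hn0'
  have D0 : HasDerivAt (fun t : ℝ => (T.n (p + t • T.n p) 0 : ℂ)) (n0' : ℂ) 0 :=
    (hasDerivAt_line hdn (T.n p)).ofReal_comp
  have Dm : ∀ a, HasDerivAt (fun t : ℝ => T.m (p + t • T.n p) a) (m' a) 0 := by
    intro a
    have := hasDerivAt_line (hdm a) (T.n p)
    refine this.congr_deriv ?_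
    simp only [Complex.real_smul, hm', dirDeriv]
  have Du : HasDerivAt (fun t : ℝ => (p + t • T.n p) 0) n0 0 := by
    have := ((hasDerivAt_id (0 : ℝ)).mul_const n0).const_add (p 0)
    simpa using this
  have DH : ∀ f : ℝ → ℝ, ContDiffOn ℝ ∞ f R.I →
      HasDerivAt (fun t : ℝ => (f ((p + t • T.n p) 0) : ℂ)) ((deriv f (p 0) * n0 : ℝ) : ℂ) 0 := by
    intro f hf
    have h1 : HasDerivAt f (deriv f (p 0)) ((p + (0 : ℝ) • T.n p) 0) := by
      have := (diff hf (hVR hp)).hasDerivAt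
      simpa using this
    exact (h1.comp (0 : ℝ) Du).ofReal_comp
  -- The derivative at t = 0 of (n^u)² H(m, m) along the line p + t n(p). This function is
  -- identically −1 near t = 0, so the derivative is zero.
  have D := (D0.fun_pow 2).fun_mul (((((DH _ R.smooth_H11).fun_mul (Dm 2)).fun_mul (Dm 2)).fun_add
    ((DH _ R.smooth_H12).fun_mul (((Dm 2).fun_mul (Dm 3)).fun_add ((Dm 3).fun_mul (Dm 2))))).fun_add
    (((DH _ R.smooth_H22).fun_mul (Dm 3)).fun_mul (Dm 3)))
  have hev : ∀ᶠ t : ℝ in nhds 0, p + t • T.n p ∈ V := by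
    have hc : Continuous fun t : ℝ => p + t • T.n p := by fun_prop
    refine hc.continuousAt.eventually_mem (hV.mem_nhds ?_)
    simpa using hp
  have hconst := D.congr_of_eventuallyEq (f₁ := fun _ => (-1 : ℂ)) (hev.mono fun t ht =>
    ((m_transverse hT hVR hvac ht).2.2).symm)
  have hzero := hconst.unique (hasDerivAt_const (0 : ℝ) (-1 : ℂ))
  simp only [zero_smul, add_zero] at hzero
  have E : 2 * (n0 : ℂ) * n0' * F + (n0 : ℂ) ^ 2 * (n0 * F'
      + 2 * bil (R.H11 (p 0)) (R.H12 (p 0)) (R.H22 (p 0)) m m') = 0 := by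
    rw [← hzero, hF, hF']
    simp only [bil]
    push_cast
    ring
  have hpoly : 2 * α * n0 = (n0 : ℂ) ^ 4 * F' - 2 * n0' := by
    linear_combination -(n0 : ℂ) * E + (2 * n0' + 2 * n0 * α) * hH - 2 * (n0 : ℂ) ^ 3 * t2
  have E2 : 2 * α = ((n0 ^ 3 : ℝ) : ℂ) * F' - ((2 * n0' / n0 : ℝ) : ℂ) := by
    push_cast
    field_simp
    linear_combination hpoly
  -- The rescaling of n enters only through n0'/n0, which is real and disappears here.
  have E3 : 2 * α.im = n0 ^ 3 * F'.im := by
    have h2 : ((2 : ℝ) : ℂ) * α = ((n0 ^ 3 : ℝ) : ℂ) * F' - ((2 * n0' / n0 : ℝ) : ℂ) := by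
      rw [← E2]; push_cast; ring
    have := congrArg Complex.im h2
    simpa only [Complex.sub_im, Complex.im_ofReal_mul, Complex.ofReal_im, sub_zero] using this
  -- In the basis m, m̄ one has h(m,m) = 0, h(m,m̄) = 1 and H(m,m̄) = 0, and F = H(m,m) is real, so
  -- the determinant reduces to a nonzero multiple of Im H'(m,m).
  have hdet := bil_det (R.a (p 0)) (R.b (p 0)) (R.d (p 0)) (R.H11 (p 0)) (R.H12 (p 0))
    (R.H22 (p 0)) (deriv R.H11 (p 0)) (deriv R.H12 (p 0)) (deriv R.H22 (p 0)) m (conjV m)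
  rw [hmm, hmm', hmb, bil_conj, bil_conj, ← hF, ← hF'] at hdet
  have hω : wedge m (conjV m) ≠ 0 := by
    intro h
    have h3 := bil_gram (R.a (p 0)) (R.b (p 0)) (R.d (p 0)) m (conjV m)
    rw [hmm, hmb, h] at h3
    norm_num at h3
  have hFreal : starRingEnd ℂ F = F := by
    have : F = ((-1 / n0 ^ 2 : ℝ) : ℂ) := by
      push_cast
      field_simp
      linear_combination hH
    rw [this, Complex.conj_ofReal]
  have hFne : F ≠ 0 := by
    intro h; rw [h] at hH; norm_num at hH
  rw [hFreal] at hdet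
  have hdet' : -(F * (starRingEnd ℂ F' - F')) = wedge m (conjV m) ^ 3 * (R.pol (p 0) : ℂ) := by
    rw [pol, ← hdet]; ring
  have hiff : R.pol (p 0) = 0 ↔ F'.im = 0 := by
    rw [← Complex.conj_eq_iff_im]
    constructor
    · intro h
      rw [h] at hdet'
      have : F * (starRingEnd ℂ F' - F') = 0 := by push_cast at hdet'; linear_combination -hdet'
      exact sub_eq_zero.1 ((mul_eq_zero.1 this).resolve_left hFne)
    · intro h
      rw [h, sub_self] at hdet'
      have : wedge m (conjV m) ^ 3 * (R.pol (p 0) : ℂ) = 0 := by rw [← hdet']; ring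
      exact_mod_cast (mul_eq_zero.1 this).resolve_left (pow_ne_zero 3 hω)
  rw [hiff]
  constructor
  · intro h
    have : n0 ^ 3 * F'.im = 0 := by rw [← E3, ← hγ, h]; ring
    exact (mul_eq_zero.1 this).resolve_left (pow_ne_zero 3 hn)
  · intro h
    rw [h] at E3
    linarith

end RosenForm

/-! ### Existence of canonical tetrads -/

theorem contDiffOn_mul_inv_norm {I : Set ℝ} {y z : ℝ → ℂ} (hy : ContDiffOn ℝ ∞ y I)
    (hz : ContDiffOn ℝ ∞ z I) (hne : ∀ u ∈ I, y u ≠ 0) :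
    ContDiffOn ℝ ∞ (fun u => z u * ((‖y u‖⁻¹ : ℝ) : ℂ)) I :=
  hz.mul (Complex.ofRealCLM.contDiff.comp_contDiffOn
    ((hy.norm ℝ hne).inv fun u hu => norm_ne_zero_iff.2 (hne u hu)))

/-- A nonvanishing complex function can be rotated locally onto the negative real axis by the
square of a smooth unit function. -/
theorem exists_local_unit_sqrt {I : Set ℝ} (hI : IsOpen I) {y : ℝ → ℂ} (hy : ContDiffOn ℝ ∞ y I)
    (hne : ∀ u ∈ I, y u ≠ 0) {u₀ : ℝ} (hu₀ : u₀ ∈ I) :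
    ∃ (J : Set ℝ) (ζ : ℝ → ℂ), IsOpen J ∧ u₀ ∈ J ∧ J ⊆ I ∧ ContDiffOn ℝ ∞ ζ J ∧
      ∀ u ∈ J, ζ u * starRingEnd ℂ (ζ u) = 1 ∧ ζ u ^ 2 * y u = -(‖y u‖ : ℂ) := by
  -- The unit number that carries y to −‖y‖. A smooth square root of s is needed.
  set s : ℝ → ℂ := fun u => -starRingEnd ℂ (y u) * ((‖y u‖⁻¹ : ℝ) : ℂ) with hs
  have hnorm : ∀ u ∈ I, (‖y u‖ : ℂ) ≠ 0 := fun u hu => by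
    exact_mod_cast norm_ne_zero_iff.2 (hne u hu)
  have hsm : ContDiffOn ℝ ∞ s I := contDiffOn_mul_inv_norm hy
    (Complex.conjCLE.contDiff.comp_contDiffOn hy).neg hne
  have hsy : ∀ u ∈ I, s u * y u = -(‖y u‖ : ℂ) := by
    intro u hu
    have := hnorm u hu
    have h1 := Complex.conj_mul' (y u)
    simp only [hs]
    push_cast
    field_simp
    linear_combination -h1
  have hsu : ∀ u ∈ I, s u * starRingEnd ℂ (s u) = 1 := by
    intro u hu
    have := hnorm u hu
    have h1 := Complex.conj_mul' (y u)
    simp only [hs, map_mul, map_neg, Complex.conj_conj, Complex.conj_ofReal]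
    push_cast
    field_simp
    linear_combination h1
  obtain ⟨ζ₀, hζ₀⟩ := IsAlgClosed.exists_pow_nat_eq (s u₀) (n := 2) (by norm_num)
  have hζu : ζ₀ * starRingEnd ℂ ζ₀ = 1 := by
    have h1 := hsu u₀ hu₀
    rw [← hζ₀, map_pow, ← mul_pow, Complex.mul_conj, ← Complex.ofReal_pow] at h1
    have h2 : Complex.normSq ζ₀ ^ 2 = 1 := by exact_mod_cast h1
    rw [Complex.mul_conj]
    exact_mod_cast (pow_eq_one_iff_of_nonneg (Complex.normSq_nonneg _) two_ne_zero).1 h2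
  -- For unit numbers, 1 + s·s̄₀ bisects the angle between 1 and s/s₀, so ζ₀w/‖w‖ is a square root
  -- of s wherever w ≠ 0, in particular near `u₀`, where w = 2.
  set w : ℝ → ℂ := fun u => 1 + s u * starRingEnd ℂ (s u₀) with hw
  have hwm : ContDiffOn ℝ ∞ w I := contDiffOn_const.add (hsm.mul contDiffOn_const)
  refine ⟨I ∩ w ⁻¹' {0}ᶜ, fun u => ζ₀ * w u * ((‖w u‖⁻¹ : ℝ) : ℂ),
    hwm.continuousOn.isOpen_inter_preimage hI isOpen_compl_singleton, ⟨hu₀, ?_⟩,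
    Set.inter_subset_left, ?_, ?_⟩
  · simp only [Set.mem_preimage, Set.mem_compl_iff, Set.mem_singleton_iff, hw, hsu u₀ hu₀]
    norm_num
  · exact contDiffOn_mul_inv_norm (hwm.mono Set.inter_subset_left)
      (contDiffOn_const.mul (hwm.mono Set.inter_subset_left)) fun u hu => hu.2
  · rintro u ⟨hu, hwu⟩
    have hwn : (‖w u‖ : ℂ) ≠ 0 := by exact_mod_cast norm_ne_zero_iff.2 hwu
    have h1 := Complex.mul_conj' (w u)
    have hconj : starRingEnd ℂ (w u) = 1 + starRingEnd ℂ (s u) * s u₀ := by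
      simp [hw]
    refine ⟨?_, ?_⟩
    · simp only [map_mul, Complex.conj_ofReal]
      push_cast
      field_simp
      linear_combination (w u * starRingEnd ℂ (w u)) * hζu + h1
    · have h3 : ζ₀ ^ 2 * w u ^ 2 = s u * (w u * starRingEnd ℂ (w u)) := by
        rw [hζ₀, hconj]
        have h4 : s u₀ * w u = s u + s u₀ := by
          simp only [hw]; linear_combination s u * hsu u₀ hu₀
        linear_combination w u * h4 - w u * s u₀ * hsu u hu
      push_cast
      field_simp
      rw [h3, h1, mul_assoc, mul_comm _ (y u), ← mul_assoc, hsy u hu]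
      ring

namespace RosenForm

variable {R : RosenForm} {u : ℝ} {p : Coord}

theorem profile_ne_zero (hp : p ∈ R.region) (hric : ∀ a b, ricci R.metric a b p = 0)
    (hw : ∃ a b c d, weyl R.metric a b c d p ≠ 0) :
    ¬(R.H11 (p 0) = 0 ∧ R.H12 (p 0) = 0 ∧ R.H22 (p 0) = 0) := by
  rintro ⟨h1, h2, h3⟩
  obtain ⟨a, b, c, d, h⟩ := hw
  refine h ?_
  have hz : R.profile (p 0) = 0 := by
    ext i j
    fin_cases i <;> fin_cases j <;> simp [profile, h1, h2, h3]
  simp [weyl, scalarCurvature, hric, riemann_eq hp, hz]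

variable (R) in
/-- A complex null direction of the transverse metric. -/
def nullDir (u : ℝ) : Fin 4 → ℂ := ![0, 0, -R.b u + Complex.I * Real.sqrt (R.det u), R.a u]

theorem bil_nullDir (hu : u ∈ R.I) :
    bil (R.a u) (R.b u) (R.d u) (R.nullDir u) (R.nullDir u) = 0 ∧
    bil (R.a u) (R.b u) (R.d u) (R.nullDir u) (conjV (R.nullDir u))
      = ((2 * R.a u * R.det u : ℝ) : ℂ) := by
  have h : ((Real.sqrt (R.det u) : ℝ) : ℂ) ^ 2 = ((R.det u : ℝ) : ℂ) := by
    exact_mod_cast Real.sq_sqrt (R.det_pos u hu).le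
  have hI := Complex.I_sq
  have hdet : (R.det u : ℂ) = R.a u * R.d u - R.b u ^ 2 := by rw [det]; push_cast; ring
  constructor
  · simp [bil, nullDir]
    linear_combination (R.a u : ℂ) * Complex.I ^ 2 * h + (R.a u : ℂ) * R.det u * hI
      - (R.a u : ℂ) * hdet
  · simp [bil, nullDir, conjV]
    linear_combination -(R.a u : ℂ) * Complex.I ^ 2 * h - (R.a u : ℂ) * R.det u * hI
      - (R.a u : ℂ) * hdet

variable (R) in
theorem smooth_nullDir (i : Fin 4) : ContDiffOn ℝ ∞ (fun u => R.nullDir u i) R.I := by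
  have hof : ∀ f : ℝ → ℝ, ContDiffOn ℝ ∞ f R.I → ContDiffOn ℝ ∞ (fun u => (f u : ℂ)) R.I :=
    fun f hf => Complex.ofRealCLM.contDiff.comp_contDiffOn hf
  fin_cases i
  · exact contDiffOn_const
  · exact contDiffOn_const
  · exact (hof _ R.smooth_b).neg.add (contDiffOn_const.mul
      (hof _ (R.smooth_det.sqrt fun u hu => det_ne hu)))
  · exact hof _ R.smooth_a

/-- Canonical tetrads exist around every point. -/
theorem exists_canonical (hvac : IsVacuumOn R.metric R.region)
    (hw : WeylNowhereZeroOn R.metric R.region) (hp : p ∈ R.region) :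
    ∃ z, IsCartanGamma R.metric R.region p z := by
  have hof : ∀ {J : Set ℝ} (f : ℝ → ℝ), ContDiffOn ℝ ∞ f J →
      ContDiffOn ℝ ∞ (fun u => (f u : ℂ)) J :=
    fun f hf => Complex.ofRealCLM.contDiff.comp_contDiffOn hf
  have hpt : ∀ u ∈ R.I, ∃ q : Coord, q ∈ R.region ∧ q 0 = u := fun u hu => ⟨fun _ => u, hu, rfl⟩
  have htr : ∀ u ∈ R.I, R.trace u = 0 := by
    intro u hu
    obtain ⟨q, hq, rfl⟩ := hpt u hu
    exact trace_eq_zero hq (hvac q hq 0 0)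
  set y : ℝ → ℂ := fun u => bil (R.H11 u) (R.H12 u) (R.H22 u) (R.nullDir u) (R.nullDir u) with hy
  have hysm : ContDiffOn ℝ ∞ y R.I := by
    have h2 := R.smooth_nullDir 2
    have h3 := R.smooth_nullDir 3
    exact ((((hof _ R.smooth_H11).mul h2).mul h2).add
      ((hof _ R.smooth_H12).mul ((h2.mul h3).add (h3.mul h2)))).add
      (((hof _ R.smooth_H22).mul h3).mul h3)
  have hane : ∀ u ∈ R.I, 0 < 2 * R.a u * R.det u := fun u hu =>
    mul_pos (mul_pos two_pos (R.a_pos u hu)) (R.det_pos u hu)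
  have hyne : ∀ u ∈ R.I, y u ≠ 0 := by
    intro u hu h
    obtain ⟨q, hq, rfl⟩ := hpt u hu
    refine profile_ne_zero hq (hvac q hq) (hw q hq) (eq_zero_of_null (htr _ hu)
      (bil_nullDir hu).1 h ?_)
    rw [(bil_nullDir hu).2]
    exact_mod_cast (hane _ hu).ne'
  obtain ⟨J, ζ, hJ, huJ, hJI, hζ, hζp⟩ := exists_local_unit_sqrt R.isOpen hysm hyne hp
  -- The factor c normalizes h(m, m̄) to 1, the phase ζ makes H(m, m) negative, and n0 then scales
  -- (n^u)² H(m, m) to −1.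
  set c : ℝ → ℝ := fun u => (Real.sqrt (2 * R.a u * R.det u))⁻¹ with hc
  set n0 : ℝ → ℝ := fun u => Real.sqrt (2 * R.a u * R.det u) * (Real.sqrt ‖y u‖)⁻¹ with hn0
  have hq1 : ContDiffOn ℝ ∞ (fun u => Real.sqrt (2 * R.a u * R.det u)) R.I :=
    ((contDiffOn_const.mul R.smooth_a).mul R.smooth_det).sqrt fun u hu => (hane u hu).ne'
  have hq1ne : ∀ u ∈ R.I, Real.sqrt (2 * R.a u * R.det u) ≠ 0 := fun u hu =>
    (Real.sqrt_pos.2 (hane u hu)).ne'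
  have hcsm : ContDiffOn ℝ ∞ c R.I := hq1.inv hq1ne
  have hypos : ∀ u ∈ R.I, 0 < ‖y u‖ := fun u hu => norm_pos_iff.2 (hyne u hu)
  have hq2ne : ∀ u ∈ R.I, Real.sqrt ‖y u‖ ≠ 0 := fun u hu => (Real.sqrt_pos.2 (hypos u hu)).ne'
  have hn0sm : ContDiffOn ℝ ∞ n0 R.I :=
    hq1.mul (((hysm.norm ℝ hyne).sqrt fun u hu => (hypos u hu).ne').inv hq2ne)
  have hn0ne : ∀ u ∈ R.I, n0 u ≠ 0 := fun u hu => mul_ne_zero (hq1ne u hu) (inv_ne_zero (hq2ne u hu))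
  -- Since g_uu = 0, the vector n0 ∂_u is null; ℓ is the multiple of ∂_r with ℓ·n = −1.
  set T : Tetrad :=
    { l := fun q => ![0, -(R.k (q 0) * n0 (q 0))⁻¹, 0, 0]
      n := fun q => ![n0 (q 0), 0, 0, 0]
      m := fun q => ![0, 0, c (q 0) * ζ (q 0) * R.nullDir (q 0) 2,
        c (q 0) * ζ (q 0) * R.nullDir (q 0) 3] } with hT
  set V : Set Coord := {q | q 0 ∈ J} with hV
  have hVR : V ⊆ R.region := fun q hq => hJI hq
  have hu0 : ContDiffOn ℝ ∞ (fun q : Coord => q 0) V := (contDiff_apply ℝ ℝ 0).contDiffOn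
  have lift : ∀ {E : Type} [NormedAddCommGroup E] [NormedSpace ℝ E] (f : ℝ → E),
      ContDiffOn ℝ ∞ f J → ContDiffOn ℝ ∞ (fun q : Coord => f (q 0)) V :=
    fun f hf => hf.comp hu0 fun q hq => hq
  have hsm_m : ∀ i, ContDiffOn ℝ ∞ (fun u => (c u : ℂ) * ζ u * R.nullDir u i) J := fun i =>
    ((hof _ (hcsm.mono hJI)).mul hζ).mul ((R.smooth_nullDir i).mono hJI)
  refine ⟨_, V, T, hJ.preimage (continuous_apply 0), huJ, hVR, ?_, rfl⟩
  have hm0 : ∀ q, T.m q 0 = 0 := fun q => rfl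
  have hm1 : ∀ q, T.m q 1 = 0 := fun q => rfl
  have hl0 : ∀ q, T.lC q 0 = 0 := fun q => by simp [Tetrad.lC, hT]
  have hl1 : ∀ q, T.lC q 1 = -((R.k (q 0) : ℂ) * n0 (q 0))⁻¹ := fun q => by simp [Tetrad.lC, hT]
  have hl2 : ∀ q, T.lC q 2 = 0 := fun q => by simp [Tetrad.lC, hT]
  have hl3 : ∀ q, T.lC q 3 = 0 := fun q => by simp [Tetrad.lC, hT]
  have hnn0 : ∀ q, T.nC q 0 = n0 (q 0) := fun q => by simp [Tetrad.nC, hT]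
  have hn1 : ∀ q, T.nC q 1 = 0 := fun q => by simp [Tetrad.nC, hT]
  have hn2 : ∀ q, T.nC q 2 = 0 := fun q => by simp [Tetrad.nC, hT]
  have hn3 : ∀ q, T.nC q 3 = 0 := fun q => by simp [Tetrad.nC, hT]
  have hmb0 : ∀ q, T.mBar q 0 = 0 := fun q => by simp [Tetrad.mBar, hT]
  have hmbil : ∀ (s t w : ℝ) q, bil s t w (T.m q) (T.m q)
      = (c (q 0) * ζ (q 0)) ^ 2 * bil s t w (R.nullDir (q 0)) (R.nullDir (q 0)) := by
    intro s t w q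
    simp [bil, hT]
    ring
  have hmbil' : ∀ (s t w : ℝ) q, bil s t w (T.m q) (T.mBar q)
      = (c (q 0)) ^ 2 * (ζ (q 0) * starRingEnd ℂ (ζ (q 0)))
        * bil s t w (R.nullDir (q 0)) (conjV (R.nullDir (q 0))) := by
    intro s t w q
    simp [bil, hT, Tetrad.mBar, conjV]
    ring
  have hm4 : ∀ q ∈ V, (n0 (q 0) : ℂ) ^ 2 * bil (R.H11 (q 0)) (R.H12 (q 0)) (R.H22 (q 0))
      (T.m q) (T.m q) = -1 := by
    intro q hq
    have h1 := (hζp _ hq).2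
    have h2 : (n0 (q 0) * c (q 0)) ^ 2 * ‖y (q 0)‖ = 1 := by
      have e1 := hq1ne _ (hJI hq)
      have e2 := hq2ne _ (hJI hq)
      have e3 := Real.sq_sqrt (hypos _ (hJI hq)).le
      simp only [hn0, hc]
      field_simp
      exact e3.symm
    have h3 : ((n0 (q 0) : ℂ) * c (q 0)) ^ 2 * (‖y (q 0)‖ : ℂ) = 1 := by exact_mod_cast h2
    rw [hmbil]
    change (n0 (q 0) : ℂ) ^ 2 * ((c (q 0) * ζ (q 0)) ^ 2 * y (q 0)) = -1
    linear_combination (n0 (q 0) * c (q 0) : ℂ) ^ 2 * h1 - h3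
  have hm4' : ∀ q ∈ V, (n0 (q 0) : ℂ) ^ 2 * bil (R.H11 (q 0)) (R.H12 (q 0)) (R.H22 (q 0))
      (T.mBar q) (T.mBar q) = -1 := by
    intro q hq
    have := congrArg (starRingEnd ℂ) (hm4 q hq)
    rw [map_mul, ← bil_conj] at this
    change _ * bil _ _ _ (conjV (T.m q)) (conjV (T.m q)) = -1
    simpa using this
  have hric : ∀ q ∈ V, ∀ a b, ricci R.metric a b q = 0 := fun q hq => hvac q (hVR hq)
  exact {
    smooth_l := contDiffOn_pi.2 fun i => by
      fin_cases i
      · exact contDiffOn_const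
      · exact lift (fun u => -(R.k u * n0 u)⁻¹) (((R.smooth_k.mul hn0sm).inv fun u hu =>
          mul_ne_zero (R.k_ne u hu) (hn0ne u hu)).neg.mono hJI)
      · exact contDiffOn_const
      · exact contDiffOn_const
    smooth_n := contDiffOn_pi.2 fun i => by
      fin_cases i
      · exact lift n0 (hn0sm.mono hJI)
      · exact contDiffOn_const
      · exact contDiffOn_const
      · exact contDiffOn_const
    smooth_m := contDiffOn_pi.2 fun i => by
      fin_cases i
      · exact contDiffOn_const
      · exact contDiffOn_const
      · exact lift _ (hsm_m 2)
      · exact lift _ (hsm_m 3)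
    l_l := fun q hq => by rw [inner4_eq]; simp [bil, hl0, hl2, hl3]
    n_n := fun q hq => by rw [inner4_eq]; simp [bil, hn1, hn2, hn3]
    l_n := fun q hq => by
      have h1 : (R.k (q 0) : ℂ) ≠ 0 := by exact_mod_cast R.k_ne _ (hVR hq)
      have h2 : (n0 (q 0) : ℂ) ≠ 0 := by exact_mod_cast hn0ne _ (hVR hq)
      rw [inner4_eq]
      simp only [bil, hl0, hl1, hl2, hl3, hnn0, hn1, hn2, hn3]
      field_simp
      ring
    l_m := fun q hq => by rw [inner4_eq]; simp [bil, hl0, hl2, hl3, hm0]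
    n_m := fun q hq => by rw [inner4_eq]; simp [bil, hn1, hn2, hn3, hm0, hm1]
    m_m := fun q hq => by
      rw [inner4_eq, hmbil, (bil_nullDir (hVR hq)).1, hm0]; ring
    m_mBar := fun q hq => by
      have h1 := hq1ne _ (hVR hq)
      have h2 := Real.sq_sqrt (hane _ (hVR hq)).le
      have h3 : c (q 0) ^ 2 * (2 * R.a (q 0) * R.det (q 0)) = 1 := by
        rw [← h2]
        simp only [hc]
        field_simp
      have h4 : ((c (q 0) ^ 2 * (2 * R.a (q 0) * R.det (q 0)) : ℝ) : ℂ) = 1 := by rw [h3]; simp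
      rw [inner4_eq, hmbil', (bil_nullDir (hVR hq)).2, (hζp _ hq).1, hm0, hmb0]
      push_cast at h4 ⊢
      linear_combination h4
    psi0_eq := fun q hq => by rw [Tetrad.psi0, weylC_eq (hVR hq) (hric q hq), hl0, hm0]; ring
    psi1_eq := fun q hq => by rw [Tetrad.psi1, weylC_eq (hVR hq) (hric q hq), hl0, hm0]; ring
    psi2_eq := fun q hq => by rw [Tetrad.psi2, weylC_eq (hVR hq) (hric q hq), hl0, hm0]; ring
    psi3_eq := fun q hq => by
      rw [Tetrad.psi3, weylC_eq (hVR hq) (hric q hq), hl0, hmb0]; simp [bil, hl2, hl3]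
    psi4_eq := fun q hq => by
      rw [Tetrad.psi4, weylC_eq (hVR hq) (hric q hq), hmb0, hnn0]
      linear_combination -hm4' q hq }

end RosenForm

/-! ### Push-forward of canonical tetrads -/

/-- The push-forward of a tetrad by a change of coordinates. -/
def Tetrad.pushforward (T : Tetrad) (e : OpenPartialHomeomorph Coord Coord) : Tetrad where
  l q := fun i => ∑ a, jac e (e.symm q) i a * T.l (e.symm q) a
  n q := fun i => ∑ a, jac e (e.symm q) i a * T.n (e.symm q) a
  m q := push e (e.symm q) (T.m (e.symm q))

section

variable {T : Tetrad} {e : OpenPartialHomeomorph Coord Coord} {g g' : MetricField}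
  {V U' : Set Coord} {p : Coord}

theorem pushforward_lC (hp : p ∈ e.source) :
    (T.pushforward e).lC (e p) = push e p (T.lC p) := by
  funext i
  simp [Tetrad.lC, Tetrad.pushforward, push, e.left_inv hp]

theorem pushforward_nC (hp : p ∈ e.source) :
    (T.pushforward e).nC (e p) = push e p (T.nC p) := by
  funext i
  simp [Tetrad.nC, Tetrad.pushforward, push, e.left_inv hp]

theorem pushforward_m (hp : p ∈ e.source) :
    (T.pushforward e).m (e p) = push e p (T.m p) := by
  simp [Tetrad.pushforward, e.left_inv hp]

theorem pushforward_mBar (hp : p ∈ e.source) :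
    (T.pushforward e).mBar (e p) = push e p (T.mBar p) := by
  funext i
  simp [Tetrad.mBar, Tetrad.pushforward, push, e.left_inv hp]

/-- Canonical tetrads and their spin coefficient `γ` are preserved by coordinate changes. -/
theorem Tetrad.IsCanonicalOn.pushforward (hT : T.IsCanonicalOn g V)
    (h : IsPullback e g g' V U') (hV : V ⊆ e.source)
    (hsymm : ContDiffOn ℝ ∞ e.symm e.target) (hvac : IsVacuumOn g V) :
    (T.pushforward e).IsCanonicalOn g' (e '' V) ∧
      ∀ p ∈ V, (T.pushforward e).gamma g' (e p) = T.gamma g p := by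
  have hO := h.metric.isOpen
  have hVo : IsOpen (e '' V) := e.isOpen_image_of_subset_source hO hV
  have hmap : Set.MapsTo e.symm (e '' V) V := by
    rintro _ ⟨p, hp, rfl⟩
    rwa [e.left_inv (hV hp)]
  have hsub : e '' V ⊆ e.target := by
    rintro _ ⟨p, hp, rfl⟩
    exact e.map_source (hV hp)
  have hs : ContDiffOn ℝ ∞ e.symm (e '' V) := hsymm.mono hsub
  have hJ : ∀ i a, ContDiffOn ℝ ∞ (fun q => jac e (e.symm q) i a) (e '' V) := fun i a =>
    (h.smooth_jac i a).comp hs hmap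
  have hJc : ∀ i a, ContDiffOn ℝ ∞ (fun q => (jac e (e.symm q) i a : ℂ)) (e '' V) := fun i a =>
    Complex.ofRealCLM.contDiff.comp_contDiffOn (hJ i a)
  have hl' : ContDiffOn ℝ ∞ (T.pushforward e).l (e '' V) := contDiffOn_pi.2 fun i =>
    ContDiffOn.sum (s := Finset.univ) fun a _ => (hJ i a).mul ((contDiffOn_pi.1 hT.smooth_l a).comp hs hmap)
  have hn' : ContDiffOn ℝ ∞ (T.pushforward e).n (e '' V) := contDiffOn_pi.2 fun i =>
    ContDiffOn.sum (s := Finset.univ) fun a _ => (hJ i a).mul ((contDiffOn_pi.1 hT.smooth_n a).comp hs hmap)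
  have hm' : ContDiffOn ℝ ∞ (T.pushforward e).m (e '' V) := contDiffOn_pi.2 fun i =>
    ContDiffOn.sum (s := Finset.univ) fun a _ => (hJc i a).mul ((contDiffOn_pi.1 hT.smooth_m a).comp hs hmap)
  refine ⟨?_, ?_⟩
  · exact {
      smooth_l := hl'
      smooth_n := hn'
      smooth_m := hm'
      l_l := by
        rintro _ ⟨p, hp, rfl⟩
        rw [pushforward_lC (hV hp), ← h.inner4_eq hp, hT.l_l p hp]
      n_n := by
        rintro _ ⟨p, hp, rfl⟩
        rw [pushforward_nC (hV hp), ← h.inner4_eq hp, hT.n_n p hp]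
      l_n := by
        rintro _ ⟨p, hp, rfl⟩
        rw [pushforward_lC (hV hp), pushforward_nC (hV hp), ← h.inner4_eq hp, hT.l_n p hp]
      l_m := by
        rintro _ ⟨p, hp, rfl⟩
        rw [pushforward_lC (hV hp), pushforward_m (hV hp), ← h.inner4_eq hp, hT.l_m p hp]
      n_m := by
        rintro _ ⟨p, hp, rfl⟩
        rw [pushforward_nC (hV hp), pushforward_m (hV hp), ← h.inner4_eq hp, hT.n_m p hp]
      m_m := by
        rintro _ ⟨p, hp, rfl⟩
        rw [pushforward_m (hV hp), ← h.inner4_eq hp, hT.m_m p hp]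
      m_mBar := by
        rintro _ ⟨p, hp, rfl⟩
        rw [pushforward_m (hV hp), pushforward_mBar (hV hp), ← h.inner4_eq hp, hT.m_mBar p hp]
      psi0_eq := by
        rintro _ ⟨p, hp, rfl⟩
        rw [Tetrad.psi0, pushforward_lC (hV hp), pushforward_m (hV hp),
          ← h.weylC_eq hp (hvac p hp)]
        exact hT.psi0_eq p hp
      psi1_eq := by
        rintro _ ⟨p, hp, rfl⟩
        rw [Tetrad.psi1, pushforward_lC (hV hp), pushforward_nC (hV hp), pushforward_m (hV hp),
          ← h.weylC_eq hp (hvac p hp)]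
        exact hT.psi1_eq p hp
      psi2_eq := by
        rintro _ ⟨p, hp, rfl⟩
        rw [Tetrad.psi2, pushforward_lC (hV hp), pushforward_nC (hV hp), pushforward_m (hV hp),
          pushforward_mBar (hV hp), ← h.weylC_eq hp (hvac p hp)]
        exact hT.psi2_eq p hp
      psi3_eq := by
        rintro _ ⟨p, hp, rfl⟩
        rw [Tetrad.psi3, pushforward_lC (hV hp), pushforward_nC (hV hp),
          pushforward_mBar (hV hp), ← h.weylC_eq hp (hvac p hp)]
        exact hT.psi3_eq p hp
      psi4_eq := by
        rintro _ ⟨p, hp, rfl⟩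
        rw [Tetrad.psi4, pushforward_nC (hV hp),
          pushforward_mBar (hV hp), ← h.weylC_eq hp (hvac p hp)]
        exact hT.psi4_eq p hp }
  · intro p hp
    have hep : e p ∈ e '' V := ⟨p, hp, rfl⟩
    have dof : ∀ {f : Coord → ℝ} {q : Coord}, DifferentiableAt ℝ f q →
        DifferentiableAt ℝ (fun q => (f q : ℂ)) q := fun hf =>
      Complex.ofRealCLM.differentiableAt.comp _ hf
    have hcm := h.push_covDeriv hp (T.nC p) (Y := T.m) (Y' := (T.pushforward e).m)
      (fun a => differentiableAt_of_contDiffOn hO (contDiffOn_pi.1 hT.smooth_m a) hp)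
      (fun a => differentiableAt_of_contDiffOn hVo (contDiffOn_pi.1 hm' a) hep)
      (fun q hq => pushforward_m (hV hq))
    have hcl := h.push_covDeriv hp (T.nC p) (Y := T.lC) (Y' := (T.pushforward e).lC)
      (fun a => dof (differentiableAt_of_contDiffOn hO (contDiffOn_pi.1 hT.smooth_l a) hp))
      (fun a => dof (differentiableAt_of_contDiffOn hVo (contDiffOn_pi.1 hl' a) hep))
      (fun q hq => pushforward_lC (hV hq))
    rw [Tetrad.gamma, Tetrad.gamma, pushforward_nC (hV hp), pushforward_mBar (hV hp), hcm, hcl,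
      ← h.inner4_eq hp, ← h.inner4_eq hp]

end

/-! Bondi–Pirani–Robinson forms as Rosen forms. -/

namespace BPRForm

variable (B : BPRForm)

theorem ne_zero {u : ℝ} (hu : u ∈ B.I) : u ≠ 0 := fun h => B.zero_notMem (h ▸ hu)

/-- The Rosen form underlying a Bondi–Pirani–Robinson form. -/
def toRosen : RosenForm where
  I := B.I
  isOpen := B.isOpen
  k u := -(Real.exp (2 * B.Y u) / 2)
  a u := u ^ 2 * Real.cosh (2 * B.Z u) + u ^ 2 * (Real.sinh (2 * B.Z u) * Real.cos (2 * B.W u))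
  b u := -(u ^ 2 * (Real.sinh (2 * B.Z u) * Real.sin (2 * B.W u)))
  d u := u ^ 2 * Real.cosh (2 * B.Z u) - u ^ 2 * (Real.sinh (2 * B.Z u) * Real.cos (2 * B.W u))
  smooth_k := ((contDiffOn_const.mul B.smooth_Y).exp.div_const 2).neg
  smooth_a := ((contDiffOn_id.pow 2).mul (contDiffOn_const.mul B.smooth_Z).cosh).add
    ((contDiffOn_id.pow 2).mul ((contDiffOn_const.mul B.smooth_Z).sinh.mul
      (contDiffOn_const.mul B.smooth_W).cos))
  smooth_b := ((contDiffOn_id.pow 2).mul ((contDiffOn_const.mul B.smooth_Z).sinh.mul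
      (contDiffOn_const.mul B.smooth_W).sin)).neg
  smooth_d := ((contDiffOn_id.pow 2).mul (contDiffOn_const.mul B.smooth_Z).cosh).sub
    ((contDiffOn_id.pow 2).mul ((contDiffOn_const.mul B.smooth_Z).sinh.mul
      (contDiffOn_const.mul B.smooth_W).cos))
  k_ne u _ := by
    have := Real.exp_pos (2 * B.Y u)
    exact (neg_neg_of_pos (by positivity)).ne
  a_pos u hu := by
    have hu0 : 0 < u ^ 2 := by have := B.ne_zero hu; positivity
    have h1 := Real.cosh_sq (2 * B.Z u)
    have h2 := Real.cosh_pos (2 * B.Z u)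
    have h3 := Real.sin_sq_add_cos_sq (2 * B.W u)
    have h4 : |Real.sinh (2 * B.Z u) * Real.cos (2 * B.W u)| < Real.cosh (2 * B.Z u) := by
      refine abs_lt_of_sq_lt_sq ?_ h2.le
      nlinarith [sq_nonneg (Real.sinh (2 * B.Z u) * Real.sin (2 * B.W u))]
    have h5 := (abs_lt.1 h4).1
    rw [← mul_add]
    exact mul_pos hu0 (by linarith)
  det_pos u hu := by
    have hu0 : 0 < u ^ 4 := by have := B.ne_zero hu; positivity
    have h1 := Real.cosh_sq (2 * B.Z u)
    have h3 := Real.sin_sq_add_cos_sq (2 * B.W u)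
    have h4 : (u ^ 2 * Real.cosh (2 * B.Z u)
        + u ^ 2 * (Real.sinh (2 * B.Z u) * Real.cos (2 * B.W u)))
        * (u ^ 2 * Real.cosh (2 * B.Z u) - u ^ 2 * (Real.sinh (2 * B.Z u) * Real.cos (2 * B.W u)))
        - (-(u ^ 2 * (Real.sinh (2 * B.Z u) * Real.sin (2 * B.W u)))) ^ 2 = u ^ 4 := by
      linear_combination u ^ 4 * h1 - u ^ 4 * Real.sinh (2 * B.Z u) ^ 2 * h3
    rw [h4]
    exact hu0

end BPRForm

/-! ### Constant principal axes give linear polarization -/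

namespace RosenForm

variable {R : RosenForm} {u : ℝ}

theorem deriv_relation {f g h : ℝ → ℝ} (hf : ContDiffOn ℝ ∞ f R.I) (hg : ContDiffOn ℝ ∞ g R.I)
    (hh : ContDiffOn ℝ ∞ h R.I) {s c : ℝ} (H : ∀ u ∈ R.I, s * (f u - h u) + 2 * c * g u = 0)
    (hu : u ∈ R.I) : s * (deriv f u - deriv h u) + 2 * c * deriv g u = 0 := by
  have h1 := (((diff hf hu).hasDerivAt.fun_sub (diff hh hu).hasDerivAt).const_mul s).fun_add
    ((diff hg hu).hasDerivAt.const_mul (2 * c))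
  have h2 : (fun u => s * (f u - h u) + 2 * c * g u) =ᶠ[nhds u] fun _ => 0 :=
    Filter.eventually_of_mem (R.isOpen.mem_nhds hu) H
  exact h1.unique ((hasDerivAt_const u (0 : ℝ)).congr_of_eventuallyEq h2)

/-- If the transverse metric has constant principal axes, the polarization does not rotate. -/
theorem pol_eq_zero {s c : ℝ} (hsc : s ^ 2 + c ^ 2 = 1)
    (H : ∀ u ∈ R.I, s * (R.a u - R.d u) + 2 * c * R.b u = 0) (hu : u ∈ R.I) : R.pol u = 0 := by
  have H1 : ∀ u ∈ R.I, s * (deriv R.a u - deriv R.d u) + 2 * c * deriv R.b u = 0 := fun u hu =>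
    deriv_relation R.smooth_a R.smooth_b R.smooth_d H hu
  have H2 : ∀ u ∈ R.I, s * (deriv (deriv R.a) u - deriv (deriv R.d) u)
      + 2 * c * deriv (deriv R.b) u = 0 := fun u hu =>
    deriv_relation (smooth_deriv R.smooth_a) (smooth_deriv R.smooth_b) (smooth_deriv R.smooth_d)
      H1 hu
  have HH : ∀ u ∈ R.I, s * (R.H11 u - R.H22 u) + 2 * c * R.H12 u = 0 := by
    intro u hu
    have hdet := det_ne hu
    have e0 := H u hu
    have e1 := H1 u hu
    -- The relation places h and h' in a plane of simultaneously diagonalizable, hence commuting,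
    -- matrices; such a plane also contains h'h⁻¹h'.
    have hM : s * ((deriv R.a u * R.L11 u + deriv R.b u * R.L21 u)
        - (deriv R.b u * R.L12 u + deriv R.d u * R.L22 u))
        + 2 * c * (deriv R.a u * R.L12 u + deriv R.b u * R.L22 u) = 0 := by
      simp only [L11, L12, L21, L22]
      field_simp
      linear_combination (deriv R.b u ^ 2 - (deriv R.a u ^ 2 + deriv R.d u ^ 2) / 2
        + (deriv R.a u - deriv R.d u) ^ 2 / 2) * e0
        + (-2 * R.b u * deriv R.b u + (R.a u + R.d u) * (deriv R.a u + deriv R.d u) / 2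
        - (deriv R.a u - deriv R.d u) * (R.a u - R.d u) / 2) * e1
    simp only [H11, H12, H22]
    linear_combination (1 / 2) * H2 u hu - (1 / 2) * hM - R.kap u / 2 * e1
  have HH' := deriv_relation R.smooth_H11 R.smooth_H12 R.smooth_H22 HH hu
  have h0 := H u hu
  have h1 := HH u hu
  -- Three vectors of a plane have determinant zero. The normal has components proportional to s and
  -- c, not both zero; each multiple vanishes separately, and s² + c² = 1 combines them.
  have es : s * R.pol u = 0 := by
    rw [pol]
    linear_combination (R.H12 u * deriv R.H22 u - R.H22 u * deriv R.H12 u) * h0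
      - (R.b u * deriv R.H22 u - R.d u * deriv R.H12 u) * h1
      + (R.b u * R.H22 u - R.d u * R.H12 u) * HH'
  have ec : 2 * c * R.pol u = 0 := by
    rw [pol]
    linear_combination -(R.H11 u * deriv R.H22 u - R.H22 u * deriv R.H11 u) * h0
      + (R.a u * deriv R.H22 u - R.d u * deriv R.H11 u) * h1
      - (R.a u * R.H22 u - R.d u * R.H11 u) * HH'
  linear_combination s * es + c / 2 * ec - R.pol u * hsc

end RosenForm

namespace BPRForm

variable {B : BPRForm}

theorem pol_eq_zero (hW : ∀ u ∈ B.I, deriv B.W u = 0) {u : ℝ} (hu : u ∈ B.I) :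
    B.toRosen.pol u = 0 := by
  obtain ⟨u₀, hu₀⟩ := B.nonempty
  have hconst : ∀ v ∈ B.I, B.W v = B.W u₀ := fun v hv =>
    B.isOpen.is_const_of_deriv_eq_zero B.ordConnected.isPreconnected
      (fun w hw => (differentiableAt_of_contDiffOn B.isOpen B.smooth_W hw).differentiableWithinAt)
      hW hv hu₀
  refine RosenForm.pol_eq_zero (R := B.toRosen) (s := Real.sin (2 * B.W u₀))
    (c := Real.cos (2 * B.W u₀)) (Real.sin_sq_add_cos_sq _) ?_ hu
  intro v hv
  simp only [toRosen, hconst v hv]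
  ring

/-- Coordinates with `W' = 0` around every point force linear polarization. -/
theorem isLinearlyPolarizedOn_of_local (hvac : IsVacuumOn B.metric B.region)
    (hweyl : WeylNowhereZeroOn B.metric B.region) (h : HasLocalConstantWForm B) :
    IsLinearlyPolarizedOn B.metric B.region := by
  intro p hp
  refine ⟨B.toRosen.exists_canonical hvac hweyl hp, ?_⟩
  rintro _ ⟨V, T, hV, hpV, hVB, hT, rfl⟩
  obtain ⟨B', e, hW, hpe, -, het, he⟩ := h p hp
  -- The given tetrad need not live on the domain of the W' = 0 coordinates. Only its value of γ at
  -- p matters, so it may be restricted.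
  set V' := V ∩ e.source with hV'
  have hV'o : IsOpen V' := hV.inter e.open_source
  have hpV' : p ∈ V' := ⟨hpV, hpe⟩
  have hV's : V' ⊆ e.source := Set.inter_subset_right
  have hV'V : V' ⊆ V := Set.inter_subset_left
  have hpull : IsPullback e B.metric B'.metric V' B'.region := {
    metric := B.toRosen.isMetricOn.mono hV'o (hV'V.trans hVB)
    metric' := B'.toRosen.isMetricOn
    smooth := he.smooth.mono hV's
    mapsTo := fun q hq => het (e.map_source (hV's hq))
    eq := fun q hq => by
      ext a b
      rw [he.metric_eq q (hV's hq) a b]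
      simp only [Matrix.mul_apply, Matrix.transpose_apply, jac, Matrix.of_apply, Finset.sum_mul]
      rw [Finset.sum_comm]
      exact Finset.sum_congr rfl fun _ _ => Finset.sum_congr rfl fun _ _ => by ring }
  have hT' : T.IsCanonicalOn B.metric V' := {
    smooth_l := hT.smooth_l.mono hV'V
    smooth_n := hT.smooth_n.mono hV'V
    smooth_m := hT.smooth_m.mono hV'V
    l_l := fun q hq => hT.l_l q (hV'V hq)
    n_n := fun q hq => hT.n_n q (hV'V hq)
    l_n := fun q hq => hT.l_n q (hV'V hq)
    l_m := fun q hq => hT.l_m q (hV'V hq)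
    n_m := fun q hq => hT.n_m q (hV'V hq)
    m_m := fun q hq => hT.m_m q (hV'V hq)
    m_mBar := fun q hq => hT.m_mBar q (hV'V hq)
    psi0_eq := fun q hq => hT.psi0_eq q (hV'V hq)
    psi1_eq := fun q hq => hT.psi1_eq q (hV'V hq)
    psi2_eq := fun q hq => hT.psi2_eq q (hV'V hq)
    psi3_eq := fun q hq => hT.psi3_eq q (hV'V hq)
    psi4_eq := fun q hq => hT.psi4_eq q (hV'V hq) }
  have hvac' : IsVacuumOn B.metric V' := fun q hq => hvac q (hVB (hV'V hq))
  obtain ⟨hcan, hgam⟩ := hT'.pushforward hpull hV's he.smooth_symm hvac'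
  have hvac2 : IsVacuumOn B'.metric (e '' V') := by
    rintro _ ⟨q, hq, rfl⟩ a b
    exact hpull.ricci_eq_zero hq (hvac' q hq) a b
  have himg : e '' V' ⊆ B'.region := by
    rintro _ ⟨q, hq, rfl⟩
    exact het (e.map_source (hV's hq))
  rw [← hgam p hpV']
  have hep : e p ∈ e '' V' := ⟨p, hpV', rfl⟩
  exact (RosenForm.im_gamma_eq_zero_iff (R := B'.toRosen) hcan
    (e.isOpen_image_of_subset_source hV'o hV's) himg hvac2 hep).2
    (pol_eq_zero hW (himg hep))

end BPRForm

/-! ### Parallel coframes and the wave profile -/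

/-- A smooth function on an open interval has a smooth primitive. -/
theorem exists_smooth_primitive {I : Set ℝ} (hI : IsOpen I) (hoc : I.OrdConnected)
    (hne : I.Nonempty) {f : ℝ → ℝ} (hf : ContDiffOn ℝ ∞ f I) :
    ∃ φ : ℝ → ℝ, ContDiffOn ℝ ∞ φ I ∧ ∀ u ∈ I, HasDerivAt φ (f u) u := by
  obtain ⟨u₀, hu₀⟩ := hne
  have hd : ∀ u ∈ I, HasDerivAt (fun v => ∫ t in u₀..v, f t) (f u) u := fun u hu =>
    intervalIntegral.integral_hasDerivAt_right
      ((hf.continuousOn.mono (hoc.uIcc_subset hu₀ hu)).intervalIntegrable)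
      (hf.continuousOn.stronglyMeasurableAtFilter hI u hu)
      (hf.continuousOn.continuousAt (hI.mem_nhds hu))
  refine ⟨_, ?_, hd⟩
  rw [contDiffOn_infty_iff_deriv_of_isOpen hI]
  exact ⟨fun u hu => (hd u hu).differentiableAt.differentiableWithinAt,
    hf.congr fun u hu => (hd u hu).deriv⟩

/-- A parallel orthonormal coframe `(p, q)` of the transverse metric; its derivative is the
symmetric matrix with diagonal entries `1/u ± X` and off-diagonal entry `K`. -/
structure Coframe (B : BPRForm) where
  p1 : ℝ → ℝ
  p2 : ℝ → ℝ
  q1 : ℝ → ℝ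
  q2 : ℝ → ℝ
  X : ℝ → ℝ
  K : ℝ → ℝ
  smooth_X : ContDiffOn ℝ ∞ X B.I
  smooth_K : ContDiffOn ℝ ∞ K B.I
  smooth_p1 : ContDiffOn ℝ ∞ p1 B.I
  smooth_p2 : ContDiffOn ℝ ∞ p2 B.I
  smooth_q1 : ContDiffOn ℝ ∞ q1 B.I
  smooth_q2 : ContDiffOn ℝ ∞ q2 B.I
  deriv_p1 : ∀ u ∈ B.I, HasDerivAt p1 ((1 / u + X u) * p1 u + K u * q1 u) u
  deriv_p2 : ∀ u ∈ B.I, HasDerivAt p2 ((1 / u + X u) * p2 u + K u * q2 u) u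
  deriv_q1 : ∀ u ∈ B.I, HasDerivAt q1 (K u * p1 u + (1 / u - X u) * q1 u) u
  deriv_q2 : ∀ u ∈ B.I, HasDerivAt q2 (K u * p2 u + (1 / u - X u) * q2 u) u
  a_eq : ∀ u ∈ B.I, B.toRosen.a u = p1 u ^ 2 + q1 u ^ 2
  b_eq : ∀ u ∈ B.I, B.toRosen.b u = p1 u * p2 u + q1 u * q2 u
  d_eq : ∀ u ∈ B.I, B.toRosen.d u = p2 u ^ 2 + q2 u ^ 2
  area : ∀ u ∈ B.I, p1 u * q2 u - p2 u * q1 u = u ^ 2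

namespace BPRForm

variable (B : BPRForm)

/-- The rotated frame: angle `φ` must satisfy `φ' = W' cosh 2Z` for the frame to be parallel. -/
theorem exists_coframe {φ : ℝ → ℝ} (hφ : ContDiffOn ℝ ∞ φ B.I)
    (hφd : ∀ u ∈ B.I, HasDerivAt φ (deriv B.W u * Real.cosh (2 * B.Z u)) u) :
    ∃ C : Coframe B,
      (∀ u, C.X u = deriv B.Z u * Real.cos (2 * φ u)
        - deriv B.W u * Real.sinh (2 * B.Z u) * Real.sin (2 * φ u)) ∧
      (∀ u, C.K u = -(deriv B.Z u * Real.sin (2 * φ u))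
        - deriv B.W u * Real.sinh (2 * B.Z u) * Real.cos (2 * φ u)) := by
  have hZ' := B.smooth_Z.deriv_of_isOpen B.isOpen (m := ∞) (by simp)
  have hW' := B.smooth_W.deriv_of_isOpen B.isOpen (m := ∞) (by simp)
  have h2Z : ContDiffOn ℝ ∞ (fun u => 2 * B.Z u) B.I := contDiffOn_const.mul B.smooth_Z
  have h2φ : ContDiffOn ℝ ∞ (fun u => 2 * φ u) B.I := contDiffOn_const.mul hφ
  have hE := B.smooth_Z.exp
  have hF := B.smooth_Z.neg.exp
  have hidd : ContDiffOn ℝ ∞ (fun u : ℝ => u) B.I := contDiffOn_id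
  have dZ : ∀ u ∈ B.I, HasDerivAt B.Z (deriv B.Z u) u := fun u hu =>
    (differentiableAt_of_contDiffOn B.isOpen B.smooth_Z hu).hasDerivAt
  have dW : ∀ u ∈ B.I, HasDerivAt B.W (deriv B.W u) u := fun u hu =>
    (differentiableAt_of_contDiffOn B.isOpen B.smooth_W hu).hasDerivAt
  have EF : ∀ u, Real.exp (B.Z u) * Real.exp (-B.Z u) = 1 := fun u => by
    rw [← Real.exp_add]; simp
  have hsinh : ∀ u, Real.sinh (2 * B.Z u)
      = (Real.exp (B.Z u) ^ 2 - Real.exp (-B.Z u) ^ 2) / 2 := fun u => by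
    rw [Real.sinh_eq, ← Real.exp_nat_mul, ← Real.exp_nat_mul]; push_cast; ring_nf
  have hcosh : ∀ u, Real.cosh (2 * B.Z u)
      = (Real.exp (B.Z u) ^ 2 + Real.exp (-B.Z u) ^ 2) / 2 := fun u => by
    rw [Real.cosh_eq, ← Real.exp_nat_mul, ← Real.exp_nat_mul]; push_cast; ring_nf
  have hcs : ∀ x, Real.sin x ^ 2 + Real.cos x ^ 2 = 1 := Real.sin_sq_add_cos_sq
  -- The rows are u times the rotation by φ applied to diag(e^Z, e^{−Z}) times the rotation by W, a
  -- square root of h for every φ. The condition on φ' cancels the antisymmetric part of E'E⁻¹, and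
  -- X, K are the trace-free symmetric part.
  refine ⟨
    { p1 := fun u => u * (Real.exp (B.Z u) * Real.cos (φ u) * Real.cos (B.W u)
        + Real.exp (-B.Z u) * Real.sin (φ u) * Real.sin (B.W u))
      p2 := fun u => u * (Real.exp (-B.Z u) * Real.sin (φ u) * Real.cos (B.W u)
        - Real.exp (B.Z u) * Real.cos (φ u) * Real.sin (B.W u))
      q1 := fun u => u * (Real.exp (-B.Z u) * Real.cos (φ u) * Real.sin (B.W u)
        - Real.exp (B.Z u) * Real.sin (φ u) * Real.cos (B.W u))
      q2 := fun u => u * (Real.exp (B.Z u) * Real.sin (φ u) * Real.sin (B.W u)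
        + Real.exp (-B.Z u) * Real.cos (φ u) * Real.cos (B.W u))
      X := fun u => deriv B.Z u * Real.cos (2 * φ u)
        - deriv B.W u * Real.sinh (2 * B.Z u) * Real.sin (2 * φ u)
      K := fun u => -(deriv B.Z u * Real.sin (2 * φ u))
        - deriv B.W u * Real.sinh (2 * B.Z u) * Real.cos (2 * φ u)
      smooth_X := (hZ'.mul h2φ.cos).sub ((hW'.mul h2Z.sinh).mul h2φ.sin)
      smooth_K := (hZ'.mul h2φ.sin).neg.sub ((hW'.mul h2Z.sinh).mul h2φ.cos)
      smooth_p1 := hidd.mul (((hE.mul hφ.cos).mul B.smooth_W.cos).add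
        ((hF.mul hφ.sin).mul B.smooth_W.sin))
      smooth_p2 := hidd.mul (((hF.mul hφ.sin).mul B.smooth_W.cos).sub
        ((hE.mul hφ.cos).mul B.smooth_W.sin))
      smooth_q1 := hidd.mul (((hF.mul hφ.cos).mul B.smooth_W.sin).sub
        ((hE.mul hφ.sin).mul B.smooth_W.cos))
      smooth_q2 := hidd.mul (((hE.mul hφ.sin).mul B.smooth_W.sin).add
        ((hF.mul hφ.cos).mul B.smooth_W.cos))
      deriv_p1 := ?_
      deriv_p2 := ?_
      deriv_q1 := ?_
      deriv_q2 := ?_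
      a_eq := ?_
      b_eq := ?_
      d_eq := ?_
      area := ?_ }, fun u => rfl, fun u => rfl⟩
  all_goals intro u hu
  · refine ((hasDerivAt_id' u).fun_mul ((((dZ u hu).exp.fun_mul (hφd u hu).cos).fun_mul
      (dW u hu).cos).fun_add (((dZ u hu).fun_neg.exp.fun_mul (hφd u hu).sin).fun_mul
      (dW u hu).sin))).congr_deriv ?_
    rw [hsinh, hcosh, Real.cos_two_mul', Real.sin_two_mul]
    linear_combination u * (-deriv B.Z u * (Real.exp (B.Z u) * Real.cos (φ u) * Real.cos (B.W u) - Real.exp (-B.Z u) * Real.sin (φ u) * Real.sin (B.W u))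
      + deriv B.W u * ((Real.exp (B.Z u) ^ 2 - Real.exp (-B.Z u) ^ 2) / 2) * (Real.exp (B.Z u) * Real.sin (φ u) * Real.cos (B.W u) + Real.exp (-B.Z u) * Real.cos (φ u) * Real.sin (B.W u))) * hcs (φ u) + u * deriv B.W u * (Real.exp (B.Z u) * Real.cos (φ u) * Real.sin (B.W u) - Real.exp (-B.Z u) * Real.sin (φ u) * Real.cos (B.W u)) * EF u
      - (Real.exp (B.Z u) * Real.cos (φ u) * Real.cos (B.W u) + Real.exp (-B.Z u) * Real.sin (φ u) * Real.sin (B.W u)) * mul_inv_cancel₀ (B.ne_zero hu)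
  · refine ((hasDerivAt_id' u).fun_mul ((((dZ u hu).fun_neg.exp.fun_mul (hφd u hu).sin).fun_mul
      (dW u hu).cos).fun_sub (((dZ u hu).exp.fun_mul (hφd u hu).cos).fun_mul
      (dW u hu).sin))).congr_deriv ?_
    rw [hsinh, hcosh, Real.cos_two_mul', Real.sin_two_mul]
    linear_combination u * (-deriv B.Z u * (-(Real.exp (B.Z u) * Real.cos (φ u) * Real.sin (B.W u)) - Real.exp (-B.Z u) * Real.sin (φ u) * Real.cos (B.W u))
      + deriv B.W u * ((Real.exp (B.Z u) ^ 2 - Real.exp (-B.Z u) ^ 2) / 2) * (-(Real.exp (B.Z u) * Real.sin (φ u) * Real.sin (B.W u)) + Real.exp (-B.Z u) * Real.cos (φ u) * Real.cos (B.W u))) * hcs (φ u) + u * deriv B.W u * (Real.exp (B.Z u) * Real.cos (φ u) * Real.cos (B.W u) + Real.exp (-B.Z u) * Real.sin (φ u) * Real.sin (B.W u)) * EF u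
      - (Real.exp (-B.Z u) * Real.sin (φ u) * Real.cos (B.W u) - Real.exp (B.Z u) * Real.cos (φ u) * Real.sin (B.W u)) * mul_inv_cancel₀ (B.ne_zero hu)
  · refine ((hasDerivAt_id' u).fun_mul ((((dZ u hu).fun_neg.exp.fun_mul (hφd u hu).cos).fun_mul
      (dW u hu).sin).fun_sub (((dZ u hu).exp.fun_mul (hφd u hu).sin).fun_mul
      (dW u hu).cos))).congr_deriv ?_
    rw [hsinh, hcosh, Real.cos_two_mul', Real.sin_two_mul]
    linear_combination u * (-deriv B.Z u * (-(Real.exp (B.Z u) * Real.sin (φ u) * Real.cos (B.W u)) - Real.exp (-B.Z u) * Real.cos (φ u) * Real.sin (B.W u))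
      + deriv B.W u * ((Real.exp (B.Z u) ^ 2 - Real.exp (-B.Z u) ^ 2) / 2) * (Real.exp (B.Z u) * Real.cos (φ u) * Real.cos (B.W u) - Real.exp (-B.Z u) * Real.sin (φ u) * Real.sin (B.W u))) * hcs (φ u) + u * deriv B.W u * (-(Real.exp (B.Z u) * Real.sin (φ u) * Real.sin (B.W u)) - Real.exp (-B.Z u) * Real.cos (φ u) * Real.cos (B.W u)) * EF u
      - (Real.exp (-B.Z u) * Real.cos (φ u) * Real.sin (B.W u) - Real.exp (B.Z u) * Real.sin (φ u) * Real.cos (B.W u)) * mul_inv_cancel₀ (B.ne_zero hu)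
  · refine ((hasDerivAt_id' u).fun_mul ((((dZ u hu).exp.fun_mul (hφd u hu).sin).fun_mul
      (dW u hu).sin).fun_add (((dZ u hu).fun_neg.exp.fun_mul (hφd u hu).cos).fun_mul
      (dW u hu).cos))).congr_deriv ?_
    rw [hsinh, hcosh, Real.cos_two_mul', Real.sin_two_mul]
    linear_combination u * (-deriv B.Z u * (Real.exp (B.Z u) * Real.sin (φ u) * Real.sin (B.W u) - Real.exp (-B.Z u) * Real.cos (φ u) * Real.cos (B.W u))
      + deriv B.W u * ((Real.exp (B.Z u) ^ 2 - Real.exp (-B.Z u) ^ 2) / 2) * (-(Real.exp (B.Z u) * Real.cos (φ u) * Real.sin (B.W u)) - Real.exp (-B.Z u) * Real.sin (φ u) * Real.cos (B.W u))) * hcs (φ u) + u * deriv B.W u * (-(Real.exp (B.Z u) * Real.sin (φ u) * Real.cos (B.W u)) + Real.exp (-B.Z u) * Real.cos (φ u) * Real.sin (B.W u)) * EF u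
      - (Real.exp (B.Z u) * Real.sin (φ u) * Real.sin (B.W u) + Real.exp (-B.Z u) * Real.cos (φ u) * Real.cos (B.W u)) * mul_inv_cancel₀ (B.ne_zero hu)
  · simp only [toRosen]
    rw [hsinh, hcosh, Real.cos_two_mul']
    linear_combination -u ^ 2 * (Real.exp (B.Z u) ^ 2 + Real.exp (-B.Z u) ^ 2) / 2 * hcs (B.W u)
      - u ^ 2 * (Real.exp (B.Z u) ^ 2 * Real.cos (B.W u) ^ 2 + Real.exp (-B.Z u) ^ 2 * Real.sin (B.W u) ^ 2) * hcs (φ u)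
  · simp only [toRosen]
    rw [hsinh, Real.sin_two_mul]
    linear_combination u ^ 2 * (Real.exp (B.Z u) ^ 2 - Real.exp (-B.Z u) ^ 2) * Real.sin (B.W u) * Real.cos (B.W u) * hcs (φ u)
  · simp only [toRosen]
    rw [hsinh, hcosh, Real.cos_two_mul']
    linear_combination -u ^ 2 * (Real.exp (B.Z u) ^ 2 + Real.exp (-B.Z u) ^ 2) / 2 * hcs (B.W u)
      - u ^ 2 * (Real.exp (B.Z u) ^ 2 * Real.sin (B.W u) ^ 2 + Real.exp (-B.Z u) ^ 2 * Real.cos (B.W u) ^ 2) * hcs (φ u)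
  · linear_combination u ^ 2 * (Real.sin (φ u) ^ 2 + Real.cos (φ u) ^ 2) * (Real.sin (B.W u) ^ 2 + Real.cos (B.W u) ^ 2) * EF u
      + u ^ 2 * (Real.sin (B.W u) ^ 2 + Real.cos (B.W u) ^ 2) * hcs (φ u) + u ^ 2 * hcs (B.W u)

end BPRForm

theorem deriv_sum_mul {I : Set ℝ} (hI : IsOpen I) {f x y z w x' y' z' w' : ℝ → ℝ}
    (hf : ∀ u ∈ I, f u = x u * y u + z u * w u)
    (hx : ∀ u ∈ I, HasDerivAt x (x' u) u) (hy : ∀ u ∈ I, HasDerivAt y (y' u) u)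
    (hz : ∀ u ∈ I, HasDerivAt z (z' u) u) (hw : ∀ u ∈ I, HasDerivAt w (w' u) u)
    {u : ℝ} (hu : u ∈ I) :
    HasDerivAt f (x' u * y u + x u * y' u + (z' u * w u + z u * w' u)) u :=
  (((hx u hu).mul (hy u hu)).add ((hz u hu).mul (hw u hu))).congr_of_eventuallyEq
    (Filter.eventually_of_mem (hI.mem_nhds hu) hf)

theorem deriv_deriv_sum_mul {I : Set ℝ} (hI : IsOpen I) {f x y z w x' y' z' w' : ℝ → ℝ}
    {x'' y'' z'' w'' : ℝ} (hf : ∀ u ∈ I, f u = x u * y u + z u * w u)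
    (hx : ∀ u ∈ I, HasDerivAt x (x' u) u) (hy : ∀ u ∈ I, HasDerivAt y (y' u) u)
    (hz : ∀ u ∈ I, HasDerivAt z (z' u) u) (hw : ∀ u ∈ I, HasDerivAt w (w' u) u)
    {u : ℝ} (hu : u ∈ I) (hx' : HasDerivAt x' x'' u) (hy' : HasDerivAt y' y'' u)
    (hz' : HasDerivAt z' z'' u) (hw' : HasDerivAt w' w'' u) :
    deriv (deriv f) u = x'' * y u + 2 * x' u * y' u + x u * y''
      + (z'' * w u + 2 * z' u * w' u + z u * w'') := by
  have h1 : deriv f =ᶠ[nhds u]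
      fun u => x' u * y u + x u * y' u + (z' u * w u + z u * w' u) :=
    Filter.eventually_of_mem (hI.mem_nhds hu) fun v hv =>
      (deriv_sum_mul hI hf hx hy hz hw hv).deriv
  rw [h1.deriv_eq]
  have h2 := ((hx'.fun_mul (hy u hu)).fun_add ((hx u hu).fun_mul hy')).fun_add
    ((hz'.fun_mul (hw u hu)).fun_add ((hz u hu).fun_mul hw'))
  rw [h2.deriv]
  ring

namespace Coframe

variable {B : BPRForm} (C : Coframe B) {u : ℝ}

/-- The derivatives of the coframe components, named because ¼h'h⁻¹h' is their Gram matrix. -/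
def dp1 (u : ℝ) : ℝ := (1 / u + C.X u) * C.p1 u + C.K u * C.q1 u
def dp2 (u : ℝ) : ℝ := (1 / u + C.X u) * C.p2 u + C.K u * C.q2 u
def dq1 (u : ℝ) : ℝ := C.K u * C.p1 u + (1 / u - C.X u) * C.q1 u
def dq2 (u : ℝ) : ℝ := C.K u * C.p2 u + (1 / u - C.X u) * C.q2 u

/-- The trace-free part of the wave profile in the coframe, diagonal entry. -/
def eta1 (u : ℝ) : ℝ := deriv C.X u + 2 / u * C.X u - 2 * deriv B.Y u * C.X u
/-- The trace-free part of the wave profile in the coframe, off-diagonal entry. -/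
def eta2 (u : ℝ) : ℝ := deriv C.K u + 2 / u * C.K u - 2 * deriv B.Y u * C.K u
/-- The trace part of the wave profile in the coframe. -/
def tau (u : ℝ) : ℝ := C.X u ^ 2 + C.K u ^ 2 - 2 * deriv B.Y u / u

theorem hasDerivAt_X (hu : u ∈ B.I) : HasDerivAt C.X (deriv C.X u) u :=
  (differentiableAt_of_contDiffOn B.isOpen C.smooth_X hu).hasDerivAt
theorem hasDerivAt_K (hu : u ∈ B.I) : HasDerivAt C.K (deriv C.K u) u :=
  (differentiableAt_of_contDiffOn B.isOpen C.smooth_K hu).hasDerivAt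

theorem hasDerivAt_one_div (hu : u ∈ B.I) : HasDerivAt (fun u : ℝ => 1 / u) (-1 / u ^ 2) u := by
  simpa [div_eq_mul_inv] using hasDerivAt_inv (B.ne_zero hu)

theorem hasDerivAt_first {s t : ℝ → ℝ} {s' t' : ℝ} (hu : u ∈ B.I) (hs : HasDerivAt s s' u)
    (ht : HasDerivAt t t' u) : HasDerivAt (fun u => (1 / u + C.X u) * s u + C.K u * t u)
      ((-1 / u ^ 2 + deriv C.X u) * s u + (1 / u + C.X u) * s'
        + (deriv C.K u * t u + C.K u * t')) u :=
  (((hasDerivAt_one_div hu).fun_add (C.hasDerivAt_X hu)).fun_mul hs).fun_add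
    ((C.hasDerivAt_K hu).fun_mul ht)

theorem hasDerivAt_second {s t : ℝ → ℝ} {s' t' : ℝ} (hu : u ∈ B.I) (hs : HasDerivAt s s' u)
    (ht : HasDerivAt t t' u) : HasDerivAt (fun u => C.K u * s u + (1 / u - C.X u) * t u)
      (deriv C.K u * s u + C.K u * s'
        + ((-1 / u ^ 2 - deriv C.X u) * t u + (1 / u - C.X u) * t')) u :=
  ((C.hasDerivAt_K hu).fun_mul hs).fun_add
    (((hasDerivAt_one_div hu).fun_sub (C.hasDerivAt_X hu)).fun_mul ht)

theorem kap_eq (hu : u ∈ B.I) : B.toRosen.kap u = 2 * deriv B.Y u := by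
  have hY := (differentiableAt_of_contDiffOn B.isOpen B.smooth_Y hu).hasDerivAt
  have h := ((hY.const_mul 2).exp.div_const 2).fun_neg
  have h' : deriv B.toRosen.k u = _ := h.deriv
  rw [RosenForm.kap, h']
  simp only [BPRForm.toRosen]
  have := Real.exp_ne_zero (2 * B.Y u)
  field_simp

theorem det_eq (hu : u ∈ B.I) : B.toRosen.det u = (C.p1 u * C.q2 u - C.p2 u * C.q1 u) ^ 2 := by
  rw [RosenForm.det, C.a_eq u hu, C.b_eq u hu, C.d_eq u hu]; ring

/-- The wave profile in the coframe. -/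
theorem profile_eq (hu : u ∈ B.I) :
    B.toRosen.H11 u = C.eta1 u * (C.p1 u ^ 2 - C.q1 u ^ 2) + C.eta2 u * (2 * C.p1 u * C.q1 u)
      + C.tau u * (C.p1 u ^ 2 + C.q1 u ^ 2) ∧
    B.toRosen.H12 u = C.eta1 u * (C.p1 u * C.p2 u - C.q1 u * C.q2 u)
      + C.eta2 u * (C.p1 u * C.q2 u + C.p2 u * C.q1 u)
      + C.tau u * (C.p1 u * C.p2 u + C.q1 u * C.q2 u) ∧
    B.toRosen.H22 u = C.eta1 u * (C.p2 u ^ 2 - C.q2 u ^ 2) + C.eta2 u * (2 * C.p2 u * C.q2 u)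
      + C.tau u * (C.p2 u ^ 2 + C.q2 u ^ 2) := by
  have hO := B.isOpen
  have ha : ∀ u ∈ B.I, B.toRosen.a u = C.p1 u * C.p1 u + C.q1 u * C.q1 u := fun u hu => by
    rw [C.a_eq u hu]; ring
  have hd : ∀ u ∈ B.I, B.toRosen.d u = C.p2 u * C.p2 u + C.q2 u * C.q2 u := fun u hu => by
    rw [C.d_eq u hu]; ring
  have a1 := (deriv_sum_mul hO ha C.deriv_p1 C.deriv_p1 C.deriv_q1 C.deriv_q1 hu).deriv
  have b1 := (deriv_sum_mul hO C.b_eq C.deriv_p1 C.deriv_p2 C.deriv_q1 C.deriv_q2 hu).deriv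
  have d1 := (deriv_sum_mul hO hd C.deriv_p2 C.deriv_p2 C.deriv_q2 C.deriv_q2 hu).deriv
  have p1' := C.hasDerivAt_first hu (C.deriv_p1 u hu) (C.deriv_q1 u hu)
  have p2' := C.hasDerivAt_first hu (C.deriv_p2 u hu) (C.deriv_q2 u hu)
  have q1' := C.hasDerivAt_second hu (C.deriv_p1 u hu) (C.deriv_q1 u hu)
  have q2' := C.hasDerivAt_second hu (C.deriv_p2 u hu) (C.deriv_q2 u hu)
  have a2 := deriv_deriv_sum_mul hO ha C.deriv_p1 C.deriv_p1 C.deriv_q1 C.deriv_q1 hu p1' p1' q1' q1'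
  have b2 := deriv_deriv_sum_mul hO C.b_eq C.deriv_p1 C.deriv_p2 C.deriv_q1 C.deriv_q2 hu
    p1' p2' q1' q2'
  have d2 := deriv_deriv_sum_mul hO hd C.deriv_p2 C.deriv_p2 C.deriv_q2 C.deriv_q2 hu p2' p2' q2' q2'
  have hu0 := B.ne_zero hu
  have hdet := C.det_eq hu
  have hdet0 : C.p1 u * C.q2 u - C.p2 u * C.q1 u ≠ 0 := by
    rw [C.area u hu]; exact pow_ne_zero 2 hu0
  -- From ½h' = EᵀSE one gets h'L = ½h'h⁻¹h' = 2EᵀS²E. Together with ½h'' = Eᵀ(S' + 2S²)E this gives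
  -- H = Eᵀ(S' + S² − κS)E, whose trace-free and trace parts are `eta1`, `eta2` and `tau`.
  have M11 : deriv B.toRosen.a u * B.toRosen.L11 u + deriv B.toRosen.b u * B.toRosen.L21 u
      = 2 * (C.dp1 u ^ 2 + C.dq1 u ^ 2) := by
    simp only [RosenForm.L11, RosenForm.L21, hdet, C.a_eq u hu, C.b_eq u hu, C.d_eq u hu, a1, b1,
      dp1, dq1]
    generalize 1 / u = r
    rw [← mul_div_assoc, ← mul_div_assoc, ← add_div, div_eq_iff (mul_ne_zero two_ne_zero (pow_ne_zero 2 hdet0))]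
    ring
  have M12 : deriv B.toRosen.a u * B.toRosen.L12 u + deriv B.toRosen.b u * B.toRosen.L22 u
      = 2 * (C.dp1 u * C.dp2 u + C.dq1 u * C.dq2 u) := by
    simp only [RosenForm.L12, RosenForm.L22, hdet, C.a_eq u hu, C.b_eq u hu, C.d_eq u hu, a1, b1,
      d1, dp1, dq1, dp2, dq2]
    generalize 1 / u = r
    rw [← mul_div_assoc, ← mul_div_assoc, ← add_div, div_eq_iff (mul_ne_zero two_ne_zero (pow_ne_zero 2 hdet0))]
    ring
  have M22 : deriv B.toRosen.b u * B.toRosen.L12 u + deriv B.toRosen.d u * B.toRosen.L22 u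
      = 2 * (C.dp2 u ^ 2 + C.dq2 u ^ 2) := by
    simp only [RosenForm.L12, RosenForm.L22, hdet, C.a_eq u hu, C.b_eq u hu, C.d_eq u hu, b1,
      d1, dp2, dq2]
    generalize 1 / u = r
    rw [← mul_div_assoc, ← mul_div_assoc, ← add_div, div_eq_iff (mul_ne_zero two_ne_zero (pow_ne_zero 2 hdet0))]
    ring
  have hk := kap_eq hu
  refine ⟨?_, ?_, ?_⟩
  · rw [RosenForm.H11, M11, a2, a1, hk]
    simp only [dp1, dq1, eta1, eta2, tau]
    rw [show -1 / u ^ 2 = -(1 / u) ^ 2 by ring, show 2 / u = 2 * (1 / u) by ring,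
      show 2 * deriv B.Y u / u = 2 * deriv B.Y u * (1 / u) by ring]
    -- The identity is polynomial in 1/u, so no denominators need to be cleared.
    generalize 1 / u = r
    ring
  · rw [RosenForm.H12, M12, b2, b1, hk]
    simp only [dp1, dq1, dp2, dq2, eta1, eta2, tau]
    rw [show -1 / u ^ 2 = -(1 / u) ^ 2 by ring, show 2 / u = 2 * (1 / u) by ring,
      show 2 * deriv B.Y u / u = 2 * deriv B.Y u * (1 / u) by ring]
    generalize 1 / u = r
    ring
  · rw [RosenForm.H22, M22, d2, d1, hk]
    simp only [dp2, dq2, eta1, eta2, tau]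
    rw [show -1 / u ^ 2 = -(1 / u) ^ 2 by ring, show 2 / u = 2 * (1 / u) by ring,
      show 2 * deriv B.Y u / u = 2 * deriv B.Y u * (1 / u) by ring]
    generalize 1 / u = r
    ring

end Coframe

/-! ### Aligning the coframe with the wave profile -/

/-- Two functions without common zero and with vanishing Wronskian have a constant ratio. -/
theorem exists_angle_of_wronskian_eq_zero {I : Set ℝ} (hI : IsOpen I) (hpc : IsPreconnected I)
    (hne : I.Nonempty) {f g : ℝ → ℝ} (hf : ContDiffOn ℝ ∞ f I) (hg : ContDiffOn ℝ ∞ g I)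
    (h0 : ∀ u ∈ I, ¬(f u = 0 ∧ g u = 0)) (hw : ∀ u ∈ I, f u * deriv g u - g u * deriv f u = 0) :
    ∃ θ : ℝ, ∀ u ∈ I, Real.cos θ * g u - Real.sin θ * f u = 0 := by
  obtain ⟨v, hv⟩ := hne
  have hN : ∀ u ∈ I, 0 < f u ^ 2 + g u ^ 2 := fun u hu => by
    rcases (not_and_or.1 (h0 u hu)) with h | h
    · have := sq_nonneg (g u); positivity
    · have := sq_nonneg (f u); positivity
  have hdf : ∀ u ∈ I, HasDerivAt f (deriv f u) u := fun u hu =>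
    (differentiableAt_of_contDiffOn hI hf hu).hasDerivAt
  have hdg : ∀ u ∈ I, HasDerivAt g (deriv g u) u := fun u hu =>
    (differentiableAt_of_contDiffOn hI hg hu).hasDerivAt
  -- The squared sine of the angle between (f, g) at u and at v, up to the factor f(v)² + g(v)². Its
  -- derivative is a multiple of the Wronskian, and it vanishes at v.
  have hd : ∀ u ∈ I, HasDerivAt
      (fun u => (f v * g u - g v * f u) ^ 2 / (f u ^ 2 + g u ^ 2)) 0 u := fun u hu => by
    refine (((((hdg u hu).const_mul (f v)).fun_sub ((hdf u hu).const_mul (g v))).fun_pow 2).fun_div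
      (((hdf u hu).fun_pow 2).fun_add ((hdg u hu).fun_pow 2)) (hN u hu).ne').congr_deriv ?_
    rw [div_eq_zero_iff]
    left
    push_cast
    linear_combination 2 * (f v * g u - g v * f u) * (f v * f u + g v * g u) * hw u hu
  have hz : ∀ u ∈ I, f v * g u - g v * f u = 0 := fun u hu => by
    have h := hI.is_const_of_deriv_eq_zero hpc
      (fun w hw => (hd w hw).differentiableAt.differentiableWithinAt)
      (fun w hw => (hd w hw).deriv) hu hv
    have h' : (f v * g u - g v * f u) ^ 2 / (f u ^ 2 + g u ^ 2) = 0 := by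
      rw [h]; ring_nf
    rcases div_eq_zero_iff.1 h' with h'' | h''
    · exact pow_eq_zero_iff two_ne_zero |>.1 h''
    · exact absurd h'' (hN u hu).ne'
  set z : ℂ := ⟨f v, g v⟩ with hzdef
  have hz0 : z ≠ 0 := fun h => h0 v hv ⟨congrArg Complex.re h, congrArg Complex.im h⟩
  refine ⟨z.arg, fun u hu => ?_⟩
  have h1 := Complex.norm_mul_cos_arg z
  have h2 := Complex.norm_mul_sin_arg z
  have h3 := hz u hu
  rw [← mul_right_inj' (norm_ne_zero_iff.2 hz0), mul_zero]
  simp only [hzdef] at h1 h2 ⊢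
  linear_combination g u * h1 - f u * h2 + h3

namespace BPRForm

variable (B : BPRForm)

theorem mul_pos_of_mem {B : BPRForm} {u v : ℝ} (hu : u ∈ B.I) (hv : v ∈ B.I) : 0 < u * v := by
  rcases lt_or_gt_of_ne (B.ne_zero hu) with h | h <;>
    rcases lt_or_gt_of_ne (B.ne_zero hv) with h' | h'
  · exact mul_pos_of_neg_of_neg h h'
  · exact absurd (B.ordConnected.out hu hv ⟨h.le, h'.le⟩) B.zero_notMem
  · exact absurd (B.ordConnected.out hv hu ⟨h'.le, h.le⟩) B.zero_notMem
  · exact mul_pos h h'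

end BPRForm

namespace Coframe

variable {B : BPRForm} (C : Coframe B) {u : ℝ}

theorem smooth_deriv_Y (B : BPRForm) : ContDiffOn ℝ ∞ (deriv B.Y) B.I :=
  B.smooth_Y.deriv_of_isOpen B.isOpen (by simp)

theorem smooth_eta {f : ℝ → ℝ} (hf : ContDiffOn ℝ ∞ f B.I) :
    ContDiffOn ℝ ∞ (fun u => deriv f u + 2 / u * f u - 2 * deriv B.Y u * f u) B.I :=
  ((hf.deriv_of_isOpen B.isOpen (by simp)).add
    ((contDiffOn_const.div contDiffOn_id fun _ hu => B.ne_zero hu).mul hf)).sub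
    ((contDiffOn_const.mul (smooth_deriv_Y B)).mul hf)

theorem smooth_eta1 : ContDiffOn ℝ ∞ C.eta1 B.I := smooth_eta C.smooth_X
theorem smooth_eta2 : ContDiffOn ℝ ∞ C.eta2 B.I := smooth_eta C.smooth_K

/-- The eta terms are trace-free in an orthonormal coframe, so the trace of H is a nonzero multiple
of `tau`. -/
theorem tau_eq_zero (hu : u ∈ B.I) (htr : B.toRosen.trace u = 0) : C.tau u = 0 := by
  obtain ⟨h1, h2, h3⟩ := C.profile_eq hu
  have h : 2 * (C.p1 u * C.q2 u - C.p2 u * C.q1 u) ^ 2 * C.tau u = 0 := by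
    rw [← htr, RosenForm.trace, h1, h2, h3, C.a_eq u hu, C.b_eq u hu, C.d_eq u hu]
    ring
  rw [C.area u hu] at h
  have := B.ne_zero hu
  simpa [this] using h

theorem profile_eq_of_vacuum (htr : ∀ u ∈ B.I, B.toRosen.trace u = 0) (hu : u ∈ B.I) :
    B.toRosen.H11 u = C.eta1 u * (C.p1 u * C.p1 u - C.q1 u * C.q1 u)
      + C.eta2 u * (C.p1 u * C.q1 u + C.p1 u * C.q1 u) ∧
    B.toRosen.H12 u = C.eta1 u * (C.p1 u * C.p2 u - C.q1 u * C.q2 u)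
      + C.eta2 u * (C.p1 u * C.q2 u + C.p2 u * C.q1 u) ∧
    B.toRosen.H22 u = C.eta1 u * (C.p2 u * C.p2 u - C.q2 u * C.q2 u)
      + C.eta2 u * (C.p2 u * C.q2 u + C.p2 u * C.q2 u) := by
  obtain ⟨h1, h2, h3⟩ := C.profile_eq hu
  have ht := C.tau_eq_zero hu (htr u hu)
  rw [h1, h2, h3, ht]
  exact ⟨by ring, by ring, by ring⟩

theorem hasDerivAt_profile (hu : u ∈ B.I) {f x y z w : ℝ → ℝ} {x' y' z' w' : ℝ}
    (hf : ∀ u ∈ B.I, f u = C.eta1 u * (x u * y u - z u * w u) + C.eta2 u * (x u * w u + y u * z u))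
    (hx : HasDerivAt x x' u) (hy : HasDerivAt y y' u)
    (hz : HasDerivAt z z' u) (hw : HasDerivAt w w' u) :
    deriv f u = deriv C.eta1 u * (x u * y u - z u * w u)
      + C.eta1 u * (x' * y u + x u * y' - (z' * w u + z u * w'))
      + (deriv C.eta2 u * (x u * w u + y u * z u)
      + C.eta2 u * (x' * w u + x u * w' + (y' * z u + y u * z'))) := by
  have h1 := (differentiableAt_of_contDiffOn B.isOpen C.smooth_eta1 hu).hasDerivAt
  have h2 := (differentiableAt_of_contDiffOn B.isOpen C.smooth_eta2 hu).hasDerivAt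
  exact (((h1.fun_mul ((hx.fun_mul hy).fun_sub (hz.fun_mul hw))).fun_add
    (h2.fun_mul ((hx.fun_mul hw).fun_add (hy.fun_mul hz)))).congr_of_eventuallyEq
    (Filter.eventually_of_mem (B.isOpen.mem_nhds hu) hf)).deriv

/-- In the coframe h is the identity and H is η, while H' is η' + Sη + ηS. The part of Sη + ηS
coming from T is a multiple of the identity and that from 1/u a multiple of η, so neither affects
det(h, H, H'). -/
theorem pol_eq (htr : ∀ u ∈ B.I, B.toRosen.trace u = 0) (hu : u ∈ B.I) :
    B.toRosen.pol u = 2 * (C.p1 u * C.q2 u - C.p2 u * C.q1 u) ^ 3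
      * (C.eta1 u * deriv C.eta2 u - C.eta2 u * deriv C.eta1 u) := by
  have hp := fun v hv => C.profile_eq_of_vacuum htr (u := v) hv
  have h1 := C.hasDerivAt_profile hu (fun v hv => (hp v hv).1) (C.deriv_p1 u hu) (C.deriv_p1 u hu)
    (C.deriv_q1 u hu) (C.deriv_q1 u hu)
  have h2 := C.hasDerivAt_profile hu (fun v hv => (hp v hv).2.1) (C.deriv_p1 u hu)
    (C.deriv_p2 u hu) (C.deriv_q1 u hu) (C.deriv_q2 u hu)
  have h3 := C.hasDerivAt_profile hu (fun v hv => (hp v hv).2.2) (C.deriv_p2 u hu)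
    (C.deriv_p2 u hu) (C.deriv_q2 u hu) (C.deriv_q2 u hu)
  rw [RosenForm.pol, h1, h2, h3, (hp u hu).1, (hp u hu).2.1, (hp u hu).2.2, C.a_eq u hu,
    C.b_eq u hu, C.d_eq u hu]
  generalize 1 / u = r
  ring

end Coframe

namespace BPRForm

variable {B : BPRForm}

/-- A linearly polarized wave has a parallel coframe in which the shear is aligned with the wave
profile up to a multiple of `e^{2Y}/u²`. -/
theorem exists_aligned_coframe (hvac : IsVacuumOn B.metric B.region)
    (hweyl : WeylNowhereZeroOn B.metric B.region)
    (hlin : IsLinearlyPolarizedOn B.metric B.region) :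
    ∃ (C : Coframe B) (c : ℝ), (∀ u ∈ B.I, C.K u = c * Real.exp (2 * B.Y u) / u ^ 2) ∧
      ∀ u ∈ B.I, 0 ≤ c * u := by
  have hpt : ∀ u ∈ B.I, ∃ q : Coord, q ∈ B.toRosen.region ∧ q 0 = u :=
    fun u hu => ⟨fun _ => u, hu, rfl⟩
  have htr : ∀ u ∈ B.I, B.toRosen.trace u = 0 := by
    intro u hu
    obtain ⟨q, hq, rfl⟩ := hpt u hu
    exact RosenForm.trace_eq_zero hq (hvac q hq 0 0)
  have hpol : ∀ u ∈ B.I, B.toRosen.pol u = 0 := by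
    intro u hu
    obtain ⟨q, hq, rfl⟩ := hpt u hu
    -- The existence clause in the definition of linear polarization supplies a tetrad on which the
    -- reality clause can be tested.
    obtain ⟨⟨z, V, T, hV, hqV, hVB, hT, hz⟩, him⟩ := hlin q hq
    exact (RosenForm.im_gamma_eq_zero_iff (R := B.toRosen) hT hV hVB
      (fun p hp => hvac p (hVB hp)) hqV).1 (him _ ⟨V, T, hV, hqV, hVB, hT, rfl⟩)
  have hφs : ContDiffOn ℝ ∞ (fun u => deriv B.W u * Real.cosh (2 * B.Z u)) B.I :=
    (B.smooth_W.deriv_of_isOpen B.isOpen (by simp)).mul (contDiffOn_const.mul B.smooth_Z).cosh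
  obtain ⟨φ, hφ, hφd⟩ := exists_smooth_primitive B.isOpen B.ordConnected B.nonempty hφs
  obtain ⟨C, hX, hK⟩ := B.exists_coframe hφ hφd
  obtain ⟨θ, hθ⟩ := exists_angle_of_wronskian_eq_zero B.isOpen B.ordConnected.isPreconnected
    B.nonempty C.smooth_eta1 C.smooth_eta2
    (by
      rintro u hu ⟨h1, h2⟩
      have hp := C.profile_eq_of_vacuum htr hu
      rw [h1, h2] at hp
      obtain ⟨q, hq, rfl⟩ := hpt u hu
      refine RosenForm.profile_ne_zero hq (hvac q hq) (hweyl q hq) ?_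
      simpa using hp)
    (by
      intro u hu
      have h := C.pol_eq htr hu
      rw [hpol u hu, C.area u hu] at h
      have h0 := B.ne_zero hu
      simpa [h0] using h.symm)
  obtain ⟨v, hv⟩ := B.nonempty
  -- Both eta functions apply the operator f ↦ u⁻²e^{2Y}(u²e^{−2Y}f)' to X and K; the fixed
  -- direction of (`eta1`, `eta2`) therefore makes this combination constant.
  have hd : ∀ u ∈ B.I, HasDerivAt
      (fun u => u ^ 2 * Real.exp (-(2 * B.Y u)) * (Real.cos θ * C.K u - Real.sin θ * C.X u)) 0 u := by
    intro u hu
    have hY := (differentiableAt_of_contDiffOn B.isOpen B.smooth_Y hu).hasDerivAt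
    refine ((((hasDerivAt_id' u).fun_pow 2).fun_mul (hY.const_mul 2).fun_neg.exp).fun_mul
      (((C.hasDerivAt_K hu).const_mul (Real.cos θ)).fun_sub
        ((C.hasDerivAt_X hu).const_mul (Real.sin θ)))).congr_deriv ?_
    have h := hθ u hu
    simp only [Coframe.eta1, Coframe.eta2] at h
    have h0 := B.ne_zero hu
    have hr : u * u⁻¹ = 1 := mul_inv_cancel₀ h0
    push_cast
    linear_combination u ^ 2 * Real.exp (-(2 * B.Y u)) * h - 2 * u * Real.exp (-(2 * B.Y u)) *
      (Real.cos θ * C.K u - Real.sin θ * C.X u) * hr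
  set c := v ^ 2 * Real.exp (-(2 * B.Y v)) * (Real.cos θ * C.K v - Real.sin θ * C.X v) with hc
  have hcK : ∀ u ∈ B.I, Real.cos θ * C.K u - Real.sin θ * C.X u
      = c * Real.exp (2 * B.Y u) / u ^ 2 := by
    intro u hu
    have h := B.isOpen.is_const_of_deriv_eq_zero B.ordConnected.isPreconnected
      (fun w hw => (hd w hw).differentiableAt.differentiableWithinAt)
      (fun w hw => (hd w hw).deriv) hu hv
    rw [hc, ← h, Real.exp_neg]
    have h0 := B.ne_zero hu
    have := Real.exp_ne_zero (2 * B.Y u)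
    field_simp
  -- The angle φ is determined only up to a constant. Turning the coframe by ψ/2 rotates the
  -- trace-free matrix (X, K) by ψ.
  have key : ∀ ψ : ℝ, ∃ C' : Coframe B, ∀ u,
      C'.K u = Real.cos ψ * C.K u - Real.sin ψ * C.X u := by
    intro ψ
    obtain ⟨C', -, hK'⟩ := B.exists_coframe (φ := fun u => φ u + ψ / 2)
      (hφ.add contDiffOn_const) (fun u hu => (hφd u hu).add_const _)
    refine ⟨C', fun u => ?_⟩
    rw [hK', hK, hX, show 2 * (φ u + ψ / 2) = 2 * φ u + ψ by ring, Real.cos_add, Real.sin_add]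
    ring
  have hsign : ∀ e : ℝ, 0 ≤ e * v → ∀ u ∈ B.I, 0 ≤ e * u := by
    intro e he u hu
    have h1 := mul_pos_of_mem hu hv
    by_contra! hneg
    have h2 : e * v * (u * v) = e * u * (v * v) := by ring
    have h3 : 0 ≤ e * v * (u * v) := mul_nonneg he h1.le
    have h4 := mul_pos_of_mem hv hv
    nlinarith
  -- Replacing θ by θ + π reverses the sign of K, so the constant can be given the sign of u, which
  -- is fixed on the interval.
  rcases le_total 0 (c * v) with hcv | hcv
  · obtain ⟨C', hC'⟩ := key θ
    exact ⟨C', c, fun u hu => by rw [hC', hcK u hu], hsign c hcv⟩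
  · obtain ⟨C', hC'⟩ := key (θ + Real.pi)
    refine ⟨C', -c, fun u hu => ?_, hsign (-c) (by linarith)⟩
    rw [hC', Real.cos_add_pi, Real.sin_add_pi]
    linear_combination -hcK u hu

end BPRForm

/-! ### A direction in which αβ is positive on the whole interval -/

namespace Coframe

variable {B : BPRForm} (C : Coframe B) {u v : ℝ}

/-- The component of `p` along the direction annihilated by `ξ`. -/
def al (ξ : ℝ × ℝ) (u : ℝ) : ℝ := C.p1 u * ξ.2 - C.p2 u * ξ.1
/-- The component of `q` along the direction annihilated by `ξ`. -/
def be (ξ : ℝ × ℝ) (u : ℝ) : ℝ := C.q1 u * ξ.2 - C.q2 u * ξ.1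

/-- The squared conformal factor `αβ/u²` of the new radial coordinate. -/
def ratio (ξ : ℝ × ℝ) (u : ℝ) : ℝ := C.al ξ u * C.be ξ u / u ^ 2

theorem smooth_al (ξ : ℝ × ℝ) : ContDiffOn ℝ ∞ (C.al ξ) B.I :=
  (C.smooth_p1.mul contDiffOn_const).sub (C.smooth_p2.mul contDiffOn_const)
theorem smooth_be (ξ : ℝ × ℝ) : ContDiffOn ℝ ∞ (C.be ξ) B.I :=
  (C.smooth_q1.mul contDiffOn_const).sub (C.smooth_q2.mul contDiffOn_const)

theorem smooth_ratio (ξ : ℝ × ℝ) : ContDiffOn ℝ ∞ (C.ratio ξ) B.I :=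
  ((C.smooth_al ξ).mul (C.smooth_be ξ)).div (contDiffOn_id.pow 2)
    fun _ hu => pow_ne_zero 2 (B.ne_zero hu)

theorem hasDerivAt_al (ξ : ℝ × ℝ) (hu : u ∈ B.I) :
    HasDerivAt (C.al ξ) ((1 / u + C.X u) * C.al ξ u + C.K u * C.be ξ u) u :=
  (((C.deriv_p1 u hu).mul_const ξ.2).fun_sub ((C.deriv_p2 u hu).mul_const ξ.1)).congr_deriv
    (by simp only [al, be]; ring)

theorem hasDerivAt_be (ξ : ℝ × ℝ) (hu : u ∈ B.I) :
    HasDerivAt (C.be ξ) (C.K u * C.al ξ u + (1 / u - C.X u) * C.be ξ u) u :=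
  (((C.deriv_q1 u hu).mul_const ξ.2).fun_sub ((C.deriv_q2 u hu).mul_const ξ.1)).congr_deriv
    (by simp only [al, be]; ring)

/-- The diagonal entries 1/u ± X add up to 2/u, which the factor u⁻² cancels. Only the off-diagonal
entry K is left, so the sign of K controls monotonicity for every direction at once. -/
theorem hasDerivAt_ratio (ξ : ℝ × ℝ) (hu : u ∈ B.I) :
    HasDerivAt (C.ratio ξ) (C.K u * (C.al ξ u ^ 2 + C.be ξ u ^ 2) / u ^ 2) u := by
  have h0 := B.ne_zero hu
  refine (((C.hasDerivAt_al ξ hu).fun_mul (C.hasDerivAt_be ξ hu)).fun_div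
    ((hasDerivAt_id' u).fun_pow 2) (pow_ne_zero 2 h0)).congr_deriv ?_
  push_cast
  field_simp
  ring

theorem al_be_ne {ξ : ℝ × ℝ} (hξ : ξ ≠ 0) (hu : u ∈ B.I) : 0 < C.al ξ u ^ 2 + C.be ξ u ^ 2 := by
  have hD := C.area u hu
  have h0 : u ^ 2 ≠ 0 := pow_ne_zero 2 (B.ne_zero hu)
  by_contra! h
  have ha : C.al ξ u = 0 := by nlinarith [sq_nonneg (C.al ξ u), sq_nonneg (C.be ξ u)]
  have hb : C.be ξ u = 0 := by nlinarith [sq_nonneg (C.al ξ u), sq_nonneg (C.be ξ u)]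
  simp only [al, be] at ha hb
  refine hξ (Prod.ext ((mul_eq_zero.1 ?_).resolve_left h0) ((mul_eq_zero.1 ?_).resolve_left h0))
  · rw [← hD]; linear_combination C.q1 u * ha - C.p1 u * hb
  · rw [← hD]; linear_combination C.q2 u * ha - C.p2 u * hb

/-- The unit directions in which `αβ` is nonnegative at `u`. -/
def dirs (u : ℝ) : Set (ℝ × ℝ) := Metric.sphere 0 1 ∩ {ξ | 0 ≤ C.ratio ξ u}

theorem isClosed_dirs (u : ℝ) : IsClosed (C.dirs u) := by
  refine Metric.isClosed_sphere.inter (isClosed_le continuous_const ?_)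
  simp only [ratio, al, be]
  fun_prop

theorem isCompact_dirs (u : ℝ) : IsCompact (C.dirs u) :=
  (isCompact_sphere (0 : ℝ × ℝ) 1).of_isClosed_subset (C.isClosed_dirs u) Set.inter_subset_left

/-- The direction of p itself has α = 0, hence ratio zero. -/
theorem dirs_nonempty (hu : u ∈ B.I) : (C.dirs u).Nonempty := by
  have hne : (C.p1 u, C.p2 u) ≠ (0 : ℝ × ℝ) := by
    intro h
    have hD := C.area u hu
    rw [Prod.mk_eq_zero] at h
    rw [h.1, h.2] at hD
    exact pow_ne_zero 2 (B.ne_zero hu) (by linarith)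
  set p : ℝ × ℝ := (C.p1 u, C.p2 u) with hp
  refine ⟨‖p‖⁻¹ • p, ?_, ?_⟩
  · simp [norm_smul, norm_ne_zero_iff.2 hne]
  · have : C.al (‖p‖⁻¹ • p) u = 0 := by
      simp only [al, hp, Prod.smul_mk, smul_eq_mul]
      ring
    simp [ratio, this]

/-- Compactness makes the choice uniform over an open interval, on which no extreme value of u is
available. -/
theorem exists_mem_all_dirs
    (h : ∀ u ∈ B.I, ∀ v ∈ B.I, C.dirs u ⊆ C.dirs v ∨ C.dirs v ⊆ C.dirs u) :
    ∃ ξ, ∀ u ∈ B.I, ξ ∈ C.dirs u := by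
  have : Nonempty B.I := B.nonempty.to_subtype
  obtain ⟨ξ, hξ⟩ := IsCompact.nonempty_iInter_of_directed_nonempty_isCompact_isClosed
    (fun u : B.I => C.dirs u)
    (fun u v => by
      rcases h u u.2 v v.2 with h | h
      · exact ⟨u, subset_rfl, h⟩
      · exact ⟨v, h, subset_rfl⟩)
    (fun u => C.dirs_nonempty u.2) (fun u => C.isCompact_dirs u) (fun u => C.isClosed_dirs u)
  exact ⟨ξ, fun u hu => Set.mem_iInter.1 hξ ⟨u, hu⟩⟩

theorem ne_zero_of_mem_dirs {ξ : ℝ × ℝ} (h : ξ ∈ C.dirs u) : ξ ≠ 0 := by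
  rintro rfl
  simpa using h.1

/-- All ratios increase strictly, so the sets `dirs` grow with u and have a common element. -/
theorem exists_pos_of_K_pos (hK : ∀ u ∈ B.I, 0 < C.K u) :
    ∃ ξ, ∀ u ∈ B.I, 0 < C.ratio ξ u := by
  have hmono : ∀ ξ : ℝ × ℝ, ξ ≠ 0 → StrictMonoOn (C.ratio ξ) B.I := fun ξ hξ =>
    strictMonoOn_of_deriv_pos B.ordConnected.convex (C.smooth_ratio ξ).continuousOn
      fun u hu => by
        rw [B.isOpen.interior_eq] at hu
        rw [(C.hasDerivAt_ratio ξ hu).deriv]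
        exact div_pos (mul_pos (hK u hu) (C.al_be_ne hξ hu)) (sq_pos_of_ne_zero (B.ne_zero hu))
  have hsub : ∀ u ∈ B.I, ∀ v ∈ B.I, u ≤ v → C.dirs u ⊆ C.dirs v := fun u hu v hv huv ξ hξ =>
    ⟨hξ.1, hξ.2.trans ((hmono ξ (C.ne_zero_of_mem_dirs hξ)).monotoneOn hu hv huv)⟩
  obtain ⟨ξ, hξ⟩ := C.exists_mem_all_dirs fun u hu v hv => (le_total u v).imp
    (hsub u hu v hv) (hsub v hv u hu)
  refine ⟨ξ, fun u hu => ?_⟩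
  -- The ratio is already nonnegative at some earlier point of the open interval, so strict
  -- monotonicity makes it positive at u.
  obtain ⟨v, hv, hvu⟩ := Filter.nonempty_of_mem (Filter.inter_mem
    (nhdsWithin_le_nhds (s := Set.Iio u) (B.isOpen.mem_nhds hu)) self_mem_nhdsWithin)
  exact (hξ v hv).2.trans_lt (hmono ξ (C.ne_zero_of_mem_dirs (hξ u hu)) hv hu hvu)

theorem exists_pos_of_K_neg (hK : ∀ u ∈ B.I, C.K u < 0) :
    ∃ ξ, ∀ u ∈ B.I, 0 < C.ratio ξ u := by
  have hanti : ∀ ξ : ℝ × ℝ, ξ ≠ 0 → StrictAntiOn (C.ratio ξ) B.I := fun ξ hξ =>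
    strictAntiOn_of_deriv_neg B.ordConnected.convex (C.smooth_ratio ξ).continuousOn
      fun u hu => by
        rw [B.isOpen.interior_eq] at hu
        rw [(C.hasDerivAt_ratio ξ hu).deriv]
        exact div_neg_of_neg_of_pos (mul_neg_of_neg_of_pos (hK u hu) (C.al_be_ne hξ hu))
          (sq_pos_of_ne_zero (B.ne_zero hu))
  have hsub : ∀ u ∈ B.I, ∀ v ∈ B.I, v ≤ u → C.dirs u ⊆ C.dirs v := fun u hu v hv huv ξ hξ =>
    ⟨hξ.1, hξ.2.trans ((hanti ξ (C.ne_zero_of_mem_dirs hξ)).antitoneOn hv hu huv)⟩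
  obtain ⟨ξ, hξ⟩ := C.exists_mem_all_dirs fun u hu v hv => (le_total v u).imp
    (hsub u hu v hv) (hsub v hv u hu)
  refine ⟨ξ, fun u hu => ?_⟩
  obtain ⟨v, hv, hvu⟩ := Filter.nonempty_of_mem (Filter.inter_mem
    (nhdsWithin_le_nhds (s := Set.Ioi u) (B.isOpen.mem_nhds hu)) self_mem_nhdsWithin)
  exact (hξ v hv).2.trans_lt (hanti ξ (C.ne_zero_of_mem_dirs (hξ u hu)) hu hv hvu)

theorem exists_pos_of_K_zero (hK : ∀ u ∈ B.I, C.K u = 0) :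
    ∃ ξ, ∀ u ∈ B.I, 0 < C.ratio ξ u := by
  obtain ⟨v, hv⟩ := B.nonempty
  have hD := C.area v hv
  have h0 := B.ne_zero hv
  -- Here every ratio is constant, so one point decides. By Cramer's rule this ξ gives α = β = 1 at
  -- v.
  refine ⟨((C.q1 v - C.p1 v) / v ^ 2, (C.q2 v - C.p2 v) / v ^ 2), fun u hu => ?_⟩
  set ξ : ℝ × ℝ := ((C.q1 v - C.p1 v) / v ^ 2, (C.q2 v - C.p2 v) / v ^ 2) with hξ
  have h := B.isOpen.is_const_of_deriv_eq_zero B.ordConnected.isPreconnected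
      (fun w hw => (C.hasDerivAt_ratio ξ hw).differentiableAt.differentiableWithinAt)
      (fun w hw => by rw [(C.hasDerivAt_ratio ξ hw).deriv, hK w hw]; simp) hu hv
  have ha : C.al ξ v = 1 := by
    simp only [al, hξ]
    field_simp
    linear_combination hD
  have hb : C.be ξ v = 1 := by
    simp only [be, hξ]
    field_simp
    linear_combination hD
  rw [h, ratio, ha, hb]
  have := sq_pos_of_ne_zero h0
  positivity

end Coframe

/-- A parallel coframe aligned with the wave profile, together with a direction along which both
coframe components have the same sign throughout. -/
structure AlignedCoframe (B : BPRForm) extends Coframe B where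
  c : ℝ
  ξ : ℝ × ℝ
  K_eq : ∀ u ∈ B.I, K u = c * Real.exp (2 * B.Y u) / u ^ 2
  c_mul_nonneg : ∀ u ∈ B.I, 0 ≤ c * u
  ratio_pos : ∀ u ∈ B.I, 0 < toCoframe.ratio ξ u

theorem BPRForm.exists_alignedCoframe {B : BPRForm} (hvac : IsVacuumOn B.metric B.region)
    (hweyl : WeylNowhereZeroOn B.metric B.region)
    (hlin : IsLinearlyPolarizedOn B.metric B.region) : Nonempty (AlignedCoframe B) := by
  obtain ⟨C, c, hK, hc⟩ := exists_aligned_coframe hvac hweyl hlin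
  have hfac : ∀ u ∈ B.I, 0 < Real.exp (2 * B.Y u) / u ^ 2 := fun u hu =>
    div_pos (Real.exp_pos _) (sq_pos_of_ne_zero (B.ne_zero hu))
  have hK' : ∀ u ∈ B.I, C.K u = c * (Real.exp (2 * B.Y u) / u ^ 2) := fun u hu => by
    rw [hK u hu, mul_div_assoc]
  obtain ⟨ξ, hξ⟩ : ∃ ξ, ∀ u ∈ B.I, 0 < C.ratio ξ u := by
    rcases lt_trichotomy c 0 with h | h | h
    · exact C.exists_pos_of_K_neg fun u hu => by
        rw [hK' u hu]; exact mul_neg_of_neg_of_pos h (hfac u hu)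
    · exact C.exists_pos_of_K_zero fun u hu => by rw [hK' u hu, h, zero_mul]
    · exact C.exists_pos_of_K_pos fun u hu => by rw [hK' u hu]; exact mul_pos h (hfac u hu)
  exact ⟨{ C with c := c, ξ := ξ, K_eq := hK, c_mul_nonneg := hc, ratio_pos := hξ }⟩

/-! ### The new radial coordinate and the diagonal form -/

/-- A smooth function with positive derivative on an open interval has a smooth inverse on its
image, which is open. -/
theorem exists_smooth_inverse {I : Set ℝ} (hI : IsOpen I) (hoc : I.OrdConnected) {f : ℝ → ℝ}
    (hf : ContDiffOn ℝ ∞ f I) (hd : ∀ u ∈ I, 0 < deriv f u) :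
    ∃ ρ : ℝ → ℝ, IsOpen (f '' I) ∧ ContDiffOn ℝ ∞ ρ (f '' I) ∧ ∀ u ∈ I, ρ (f u) = u := by
  have hmono : StrictMonoOn f I := strictMonoOn_of_deriv_pos hoc.convex hf.continuousOn
    fun u hu => hd u (by rwa [hI.interior_eq] at hu)
  have hat : ∀ u ∈ I, ContDiffAt ℝ ∞ f u := fun u hu => hf.contDiffAt (hI.mem_nhds hu)
  have hder : ∀ u ∈ I, HasDerivAt f (deriv f u) u := fun u hu =>
    (differentiableAt_of_contDiffOn hI hf hu).hasDerivAt
  have hopen : ∀ s ⊆ I, IsOpen s → IsOpen (f '' s) := fun s hsI hs => by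
    rw [isOpen_iff_mem_nhds]
    rintro _ ⟨u, hu, rfl⟩
    have h := (hat u (hsI hu)).hasStrictDerivAt' (hder u (hsI hu)) (by simp)
    rw [← h.map_nhds_eq (hd u (hsI hu)).ne']
    exact Filter.image_mem_map (hs.mem_nhds hu)
  let e := OpenPartialHomeomorph.ofContinuousOpenRestrict (hmono.injOn.toPartialEquiv f I)
    hf.continuousOn
    (fun s hs => by
      have := hopen (Subtype.val '' s) (by rintro _ ⟨x, -, rfl⟩; exact x.2)
        (hI.isOpenMap_subtype_val s hs)
      rwa [Set.image_image] at this) hI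
  refine ⟨e.symm, hopen I subset_rfl hI, fun t ht => ?_, fun u hu => e.left_inv hu⟩
  have hm : e.symm t ∈ I := e.map_target ht
  exact (e.contDiffAt_symm_deriv (hd _ hm).ne' ht (hder _ hm) (hat _ hm)).contDiffWithinAt

namespace AlignedCoframe

variable {B : BPRForm} (A : AlignedCoframe B) {u : ℝ}

def α (u : ℝ) : ℝ := A.al A.ξ u
def β (u : ℝ) : ℝ := A.be A.ξ u

/-- The new coordinate `ũ` as a function of `u`. -/
def radial (u : ℝ) : ℝ := u * Real.sqrt (A.ratio A.ξ u)

variable {A}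

theorem α_mul_β_pos (hu : u ∈ B.I) : 0 < A.α u * A.β u := by
  have h := A.ratio_pos u hu
  have h0 := B.ne_zero hu
  rw [Coframe.ratio] at h
  have := mul_pos h (sq_pos_of_ne_zero h0)
  rwa [div_mul_cancel₀ _ (pow_ne_zero 2 h0)] at this

theorem α_ne (hu : u ∈ B.I) : A.α u ≠ 0 := left_ne_zero_of_mul (α_mul_β_pos hu).ne'
theorem β_ne (hu : u ∈ B.I) : A.β u ≠ 0 := right_ne_zero_of_mul (α_mul_β_pos hu).ne'

theorem radial_sq (hu : u ∈ B.I) : A.radial u ^ 2 = A.α u * A.β u := by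
  rw [radial, mul_pow, Real.sq_sqrt (A.ratio_pos u hu).le, Coframe.ratio,
    mul_div_cancel₀ _ (pow_ne_zero 2 (B.ne_zero hu))]
  rfl

theorem radial_ne (hu : u ∈ B.I) : A.radial u ≠ 0 := fun h =>
  (α_mul_β_pos (A := A) hu).ne' (by rw [← radial_sq hu, h]; ring)

theorem u_mul_K_nonneg (hu : u ∈ B.I) : 0 ≤ u * A.K u := by
  rw [A.K_eq u hu, show u * (A.c * Real.exp (2 * B.Y u) / u ^ 2)
    = A.c * u * (Real.exp (2 * B.Y u) / u ^ 2) by ring]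
  exact mul_nonneg (A.c_mul_nonneg u hu) (by positivity)

/-- With ρ the ratio, ũ' = √ρ + uρ'/(2√ρ), and uρ' has the sign of uK, which is nonnegative by the
choice of the sign of c. -/
theorem deriv_radial_pos (hu : u ∈ B.I) : 0 < deriv A.radial u := by
  have h := A.ratio_pos u hu
  have hd := (hasDerivAt_id' u).fun_mul ((A.hasDerivAt_ratio A.ξ hu).sqrt h.ne')
  have : deriv A.radial u = _ := hd.deriv
  rw [this]
  have hs := Real.sqrt_pos.2 h
  have h2 : 0 ≤ u * (A.K u * (A.al A.ξ u ^ 2 + A.be A.ξ u ^ 2) / u ^ 2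
      / (2 * Real.sqrt (A.ratio A.ξ u))) := by
    rw [show u * (A.K u * (A.al A.ξ u ^ 2 + A.be A.ξ u ^ 2) / u ^ 2
      / (2 * Real.sqrt (A.ratio A.ξ u))) = u * A.K u * ((A.al A.ξ u ^ 2 + A.be A.ξ u ^ 2) / u ^ 2
      / (2 * Real.sqrt (A.ratio A.ξ u))) by ring]
    exact mul_nonneg (u_mul_K_nonneg hu) (by positivity)
  linarith

variable (A)

theorem smooth_α : ContDiffOn ℝ ∞ A.α B.I := A.smooth_al A.ξ
theorem smooth_β : ContDiffOn ℝ ∞ A.β B.I := A.smooth_be A.ξ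

theorem smooth_radial : ContDiffOn ℝ ∞ A.radial B.I :=
  contDiffOn_id.mul ((A.smooth_ratio A.ξ).sqrt fun u hu => (A.ratio_pos u hu).ne')

/-- The inverse of `radial`. -/
def rho : ℝ → ℝ := (exists_smooth_inverse B.isOpen B.ordConnected A.smooth_radial
  fun _ hu => deriv_radial_pos hu).choose

theorem isOpen_image : IsOpen (A.radial '' B.I) :=
  (exists_smooth_inverse B.isOpen B.ordConnected A.smooth_radial
    fun _ hu => deriv_radial_pos hu).choose_spec.1

theorem smooth_rho : ContDiffOn ℝ ∞ A.rho (A.radial '' B.I) :=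
  (exists_smooth_inverse B.isOpen B.ordConnected A.smooth_radial
    fun _ hu => deriv_radial_pos hu).choose_spec.2.1

theorem rho_radial (hu : u ∈ B.I) : A.rho (A.radial u) = u :=
  (exists_smooth_inverse B.isOpen B.ordConnected A.smooth_radial
    fun _ hu => deriv_radial_pos hu).choose_spec.2.2 u hu

theorem rho_mem {t : ℝ} (ht : t ∈ A.radial '' B.I) : A.rho t ∈ B.I := by
  obtain ⟨u, hu, rfl⟩ := ht
  rwa [A.rho_radial hu]

theorem radial_rho {t : ℝ} (ht : t ∈ A.radial '' B.I) : A.radial (A.rho t) = t := by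
  obtain ⟨u, hu, rfl⟩ := ht
  rw [A.rho_radial hu]

theorem smooth_comp_rho {f : ℝ → ℝ} (hf : ContDiffOn ℝ ∞ f B.I) :
    ContDiffOn ℝ ∞ (fun t => f (A.rho t)) (A.radial '' B.I) :=
  hf.comp A.smooth_rho fun _ ht => A.rho_mem ht

/-- The diagonal form of the metric in the new coordinates. -/
def form : BPRForm where
  I := A.radial '' B.I
  isOpen := A.isOpen_image
  ordConnected := (B.ordConnected.isPreconnected.image _ A.smooth_radial.continuousOn).ordConnected
  nonempty := B.nonempty.image _
  zero_notMem := by rintro ⟨u, hu, h⟩; exact radial_ne hu h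
  -- Substituting du = dũ/ũ' divides e^{2Y} by ũ'. With e^{2Z} = α/β and ũ² = αβ, the entries
  -- ũ²e^{±2Z} are α² and β².
  Y := fun t => B.Y (A.rho t) - Real.log (deriv A.radial (A.rho t)) / 2
  Z := fun t => Real.log (A.α (A.rho t) / A.β (A.rho t)) / 2
  W := fun _ => 0
  smooth_Y := A.smooth_comp_rho (B.smooth_Y.sub (((A.smooth_radial.deriv_of_isOpen B.isOpen
    (by simp)).log fun _ hu => (deriv_radial_pos hu).ne').div_const 2))
  smooth_Z := A.smooth_comp_rho (((A.smooth_α.div A.smooth_β fun _ hu => β_ne hu).log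
    fun _ hu => div_ne_zero (α_ne hu) (β_ne hu)).div_const 2)
  smooth_W := contDiffOn_const

theorem form_metric {p : Coord} (hu : u ∈ B.I) (hp : p 0 = A.radial u) :
    A.form.metric p = !![0, -(Real.exp (2 * B.Y u) / deriv A.radial u / 2), 0, 0;
      -(Real.exp (2 * B.Y u) / deriv A.radial u / 2), 0, 0, 0;
      0, 0, A.α u ^ 2, 0; 0, 0, 0, A.β u ^ 2] := by
  have hY : Real.exp (2 * A.form.Y (p 0)) = Real.exp (2 * B.Y u) / deriv A.radial u := by
    simp only [form]
    rw [hp, A.rho_radial hu, show 2 * (B.Y u - Real.log (deriv A.radial u) / 2)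
      = 2 * B.Y u - Real.log (deriv A.radial u) by ring, Real.exp_sub,
      Real.exp_log (deriv_radial_pos hu)]
  have hpos : 0 < A.α u / A.β u := by
    rw [show A.α u / A.β u = A.α u * A.β u / A.β u ^ 2 by
      have := β_ne (A := A) hu; field_simp]
    exact div_pos (α_mul_β_pos hu) (sq_pos_of_ne_zero (β_ne hu))
  have hZ : 2 * A.form.Z (p 0) = Real.log (A.α u / A.β u) := by
    simp only [form]
    rw [hp, A.rho_radial hu]; ring
  have hW : A.form.W (p 0) = 0 := rfl
  have ha := α_ne (A := A) hu
  have hb := β_ne (A := A) hu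
  have h2 : p 0 ^ 2 = A.α u * A.β u := by rw [hp, radial_sq hu]
  have e1 : p 0 ^ 2 * Real.cosh (2 * A.form.Z (p 0)) = (A.α u ^ 2 + A.β u ^ 2) / 2 := by
    rw [hZ, Real.cosh_eq, Real.exp_neg, Real.exp_log hpos, h2]
    field_simp
  have e2 : p 0 ^ 2 * Real.sinh (2 * A.form.Z (p 0)) = (A.α u ^ 2 - A.β u ^ 2) / 2 := by
    rw [hZ, Real.sinh_eq, Real.exp_neg, Real.exp_log hpos, h2]
    field_simp
  simp only [BPRForm.metric, hY, hW, mul_zero, Real.cos_zero, Real.sin_zero, mul_one, e1, e2,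
    neg_zero]
  congr! <;> ring

end AlignedCoframe

/-! ### The explicit change of coordinates -/

theorem hasFDerivAt_coord (p : Coord) (i : Fin 4) : HasFDerivAt (fun q : Coord => q i)
    (ContinuousLinearMap.proj (R := ℝ) (φ := fun _ : Fin 4 => ℝ) i) p :=
  (ContinuousLinearMap.proj (R := ℝ) (φ := fun _ : Fin 4 => ℝ) i).hasFDerivAt

theorem hasFDerivAt_comp_zero {f : ℝ → ℝ} {f' : ℝ} {p : Coord} (hf : HasDerivAt f f' (p 0)) :
    HasFDerivAt (fun q : Coord => f (q 0))
      (f' • ContinuousLinearMap.proj (R := ℝ) (φ := fun _ : Fin 4 => ℝ) 0) p :=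
  hf.comp_hasFDerivAt p (hasFDerivAt_coord p 0)

theorem pd_linear {f g : ℝ → ℝ} {f' g' : ℝ} {p : Coord} (hf : HasDerivAt f f' (p 0))
    (hg : HasDerivAt g g' (p 0)) (a : Fin 4) :
    pd a (fun q : Coord => f (q 0) * q 2 + g (q 0) * q 3) p
      = (Pi.single a 1 : Coord) 0 * (f' * p 2 + g' * p 3)
        + f (p 0) * (Pi.single a 1 : Coord) 2 + g (p 0) * (Pi.single a 1 : Coord) 3 := by
  have h := ((hasFDerivAt_comp_zero hf).fun_mul (hasFDerivAt_coord p 2)).fun_add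
    ((hasFDerivAt_comp_zero hg).fun_mul (hasFDerivAt_coord p 3))
  rw [pd, h.fderiv]
  simp
  ring

theorem pd_quadratic {f : ℝ → ℝ} {f' : ℝ} {p : Coord} (hf : HasDerivAt f f' (p 0)) (x y : ℝ)
    (a : Fin 4) :
    pd a (fun q : Coord => q 1 + f (q 0) * (x * q 2 + y * q 3) ^ 2) p
      = (Pi.single a 1 : Coord) 1
        + (Pi.single a 1 : Coord) 0 * (f' * (x * p 2 + y * p 3) ^ 2)
        + 2 * f (p 0) * (x * p 2 + y * p 3)
          * (x * (Pi.single a 1 : Coord) 2 + y * (Pi.single a 1 : Coord) 3) := by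
  have hs := ((hasFDerivAt_coord p 2).const_mul x).fun_add ((hasFDerivAt_coord p 3).const_mul y)
  have h := (hasFDerivAt_coord p 1).fun_add
    ((hasFDerivAt_comp_zero hf).fun_mul (hs.fun_mul hs))
  simp only [← sq] at h
  rw [pd, h.fderiv]
  simp
  ring

namespace AlignedCoframe

variable {B : BPRForm} (A : AlignedCoframe B) {u : ℝ}

/-- The coefficient of the quadratic shift of `r`. -/
def shift (u : ℝ) : ℝ := -(A.c * u ^ 2 / (A.α u * A.β u))

/-- The new coordinates as functions of the old ones. -/
def toNew (q : Coord) : Coord :=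
  ![A.radial (q 0), q 1 + A.shift (q 0) * (A.ξ.1 * q 2 + A.ξ.2 * q 3) ^ 2,
    A.p1 (q 0) / A.α (q 0) * q 2 + A.p2 (q 0) / A.α (q 0) * q 3,
    A.q1 (q 0) / A.β (q 0) * q 2 + A.q2 (q 0) / A.β (q 0) * q 3]

def oldX (q : Coord) : ℝ :=
  (A.q2 (A.rho (q 0)) * A.α (A.rho (q 0)) * q 2 - A.p2 (A.rho (q 0)) * A.β (A.rho (q 0)) * q 3)
    / A.rho (q 0) ^ 2
def oldY (q : Coord) : ℝ :=
  (A.p1 (A.rho (q 0)) * A.β (A.rho (q 0)) * q 3 - A.q1 (A.rho (q 0)) * A.α (A.rho (q 0)) * q 2)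
    / A.rho (q 0) ^ 2

/-- The old coordinates as functions of the new ones. -/
def toOld (q : Coord) : Coord :=
  ![A.rho (q 0), q 1 - A.shift (A.rho (q 0)) * (A.ξ.1 * A.oldX q + A.ξ.2 * A.oldY q) ^ 2,
    A.oldX q, A.oldY q]

theorem toNew_mem {q : Coord} (hq : q ∈ B.region) : A.toNew q ∈ A.form.region := ⟨q 0, hq, rfl⟩

theorem toOld_mem {q : Coord} (hq : q ∈ A.form.region) : A.toOld q ∈ B.region := A.rho_mem hq

theorem oldX_toNew {q : Coord} (hq : q ∈ B.region) : A.oldX (A.toNew q) = q 2 := by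
  have h0 := B.ne_zero hq
  have ha := α_ne (A := A) hq
  have hb := β_ne (A := A) hq
  simp only [oldX, toNew, Matrix.cons_val, A.rho_radial hq]
  field_simp
  linear_combination q 2 * A.area _ hq

theorem oldY_toNew {q : Coord} (hq : q ∈ B.region) : A.oldY (A.toNew q) = q 3 := by
  have h0 := B.ne_zero hq
  have ha := α_ne (A := A) hq
  have hb := β_ne (A := A) hq
  simp only [oldY, toNew, Matrix.cons_val, A.rho_radial hq]
  field_simp
  linear_combination q 3 * A.area _ hq

theorem toOld_toNew {q : Coord} (hq : q ∈ B.region) : A.toOld (A.toNew q) = q := by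
  have h0 : A.rho (A.toNew q 0) = q 0 := A.rho_radial hq
  have h1 : A.toNew q 1 = q 1 + A.shift (q 0) * (A.ξ.1 * q 2 + A.ξ.2 * q 3) ^ 2 := rfl
  rw [toOld, A.oldX_toNew hq, A.oldY_toNew hq, h0, h1]
  ext i
  fin_cases i <;> simp

theorem toNew_toOld {q : Coord} (hq : q ∈ A.form.region) : A.toNew (A.toOld q) = q := by
  have hm := A.toOld_mem hq
  have h0 := B.ne_zero hm
  have ha := α_ne (A := A) hm
  have hb := β_ne (A := A) hm
  have hD := A.area _ hm
  have hr : A.radial (A.rho (q 0)) = q 0 := A.radial_rho hq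
  have e0 : A.toOld q 0 = A.rho (q 0) := rfl
  rw [e0] at h0 ha hb hD
  ext i
  fin_cases i
  · exact hr
  · simp [toNew, toOld]
  · simp only [toNew, toOld, oldX, oldY, Matrix.cons_val, Fin.reduceFinMk]
    field_simp
    linear_combination q 2 * A.α (A.rho (q 0)) * hD
  · simp only [toNew, toOld, oldX, oldY, Matrix.cons_val, Fin.reduceFinMk]
    field_simp
    linear_combination q 3 * A.β (A.rho (q 0)) * hD

theorem smooth_shift : ContDiffOn ℝ ∞ A.shift B.I :=
  ((contDiffOn_const.mul (contDiffOn_id.pow 2)).div (A.smooth_α.mul A.smooth_β)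
    fun _ hu => (α_mul_β_pos hu).ne').neg

theorem smooth_toNew : ContDiffOn ℝ ∞ A.toNew B.region := by
  have hz : ∀ {f : ℝ → ℝ}, ContDiffOn ℝ ∞ f B.I →
      ContDiffOn ℝ ∞ (fun q : Coord => f (q 0)) B.region := fun hf =>
    hf.comp (contDiff_apply ℝ ℝ (0 : Fin 4)).contDiffOn fun _ hq => hq
  have hc : ∀ i : Fin 4, ContDiffOn ℝ ∞ (fun q : Coord => q i) B.region :=
    fun i => (contDiff_apply ℝ ℝ i).contDiffOn
  have hl : ∀ {f g a : ℝ → ℝ}, ContDiffOn ℝ ∞ f B.I → ContDiffOn ℝ ∞ g B.I →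
      ContDiffOn ℝ ∞ a B.I → (∀ u ∈ B.I, a u ≠ 0) → ContDiffOn ℝ ∞
        (fun q : Coord => f (q 0) / a (q 0) * q 2 + g (q 0) / a (q 0) * q 3) B.region :=
    fun hf hg ha h0 => ((hz (hf.div ha h0)).mul (hc 2)).add ((hz (hg.div ha h0)).mul (hc 3))
  rw [contDiffOn_pi]
  intro i
  fin_cases i
  · exact hz A.smooth_radial
  · exact (hc 1).add ((hz A.smooth_shift).mul (((contDiffOn_const.mul (hc 2)).add
      (contDiffOn_const.mul (hc 3))).pow 2))
  · exact hl A.smooth_p1 A.smooth_p2 A.smooth_α fun _ hu => α_ne hu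
  · exact hl A.smooth_q1 A.smooth_q2 A.smooth_β fun _ hu => β_ne hu

theorem smooth_toOld : ContDiffOn ℝ ∞ A.toOld A.form.region := by
  have hz : ∀ {f : ℝ → ℝ}, ContDiffOn ℝ ∞ f B.I →
      ContDiffOn ℝ ∞ (fun q : Coord => f (A.rho (q 0))) A.form.region := fun hf =>
    (A.smooth_comp_rho hf).comp (contDiff_apply ℝ ℝ (0 : Fin 4)).contDiffOn fun _ hq => hq
  have hc : ∀ i : Fin 4, ContDiffOn ℝ ∞ (fun q : Coord => q i) A.form.region :=
    fun i => (contDiff_apply ℝ ℝ i).contDiffOn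
  have hρ := hz (f := id) contDiffOn_id
  have hρ0 : ∀ q ∈ A.form.region, A.rho (q 0) ^ 2 ≠ 0 := fun q hq =>
    pow_ne_zero 2 (B.ne_zero (A.rho_mem hq))
  have hX : ContDiffOn ℝ ∞ A.oldX A.form.region :=
    ((((hz A.smooth_q2).mul (hz A.smooth_α)).mul (hc 2)).sub
      (((hz A.smooth_p2).mul (hz A.smooth_β)).mul (hc 3))).div (hρ.pow 2) hρ0
  have hY : ContDiffOn ℝ ∞ A.oldY A.form.region :=
    ((((hz A.smooth_p1).mul (hz A.smooth_β)).mul (hc 3)).sub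
      (((hz A.smooth_q1).mul (hz A.smooth_α)).mul (hc 2))).div (hρ.pow 2) hρ0
  rw [contDiffOn_pi]
  intro i
  fin_cases i
  · exact hρ
  · exact (hc 1).sub ((hz A.smooth_shift).mul (((contDiffOn_const.mul hX).add
      (contDiffOn_const.mul hY)).pow 2))
  · exact hX
  · exact hY

/-- The change to coordinates in which the transverse metric is diagonal. -/
def coordChange : OpenPartialHomeomorph Coord Coord where
  toFun := A.toNew
  invFun := A.toOld
  source := B.region
  target := A.form.region
  map_source' _ hq := A.toNew_mem hq
  map_target' _ hq := A.toOld_mem hq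
  left_inv' _ hq := A.toOld_toNew hq
  right_inv' _ hq := A.toNew_toOld hq
  open_source := B.toRosen.isOpen_region
  open_target := A.form.toRosen.isOpen_region
  continuousOn_toFun := A.smooth_toNew.continuousOn
  continuousOn_invFun := A.smooth_toOld.continuousOn

theorem hasDerivAt_α (hu : u ∈ B.I) :
    HasDerivAt A.α ((1 / u + A.X u) * A.α u + A.K u * A.β u) u := A.hasDerivAt_al A.ξ hu
theorem hasDerivAt_β (hu : u ∈ B.I) :
    HasDerivAt A.β (A.K u * A.α u + (1 / u - A.X u) * A.β u) u := A.hasDerivAt_be A.ξ hu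

theorem K_mul_sq (hu : u ∈ B.I) : A.K u * u ^ 2 = A.c * Real.exp (2 * B.Y u) := by
  rw [A.K_eq u hu, div_mul_cancel₀ _ (pow_ne_zero 2 (B.ne_zero hu))]

/-- The numerator of the quotient rule is K(q_iα − p_iβ) = K u² ξ_i, and K u² = c e^{2Y}. Alignment
thus makes both derivatives multiples of the constant vector ξ, so that the cross terms in the
metric can be absorbed by a quadratic shift of r. -/
theorem hasDerivAt_p_div (hu : u ∈ B.I) :
    HasDerivAt (fun u => A.p1 u / A.α u)
      (A.c * Real.exp (2 * B.Y u) * A.ξ.1 / A.α u ^ 2) u ∧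
    HasDerivAt (fun u => A.p2 u / A.α u)
      (A.c * Real.exp (2 * B.Y u) * A.ξ.2 / A.α u ^ 2) u := by
  have ha := α_ne (A := A) hu
  refine ⟨((A.deriv_p1 u hu).fun_div (A.hasDerivAt_α hu) ha).congr_deriv ?_,
    ((A.deriv_p2 u hu).fun_div (A.hasDerivAt_α hu) ha).congr_deriv ?_⟩
  · rw [← A.K_mul_sq hu, ← A.area u hu]
    congr 1
    simp only [α, β, Coframe.al, Coframe.be]
    ring
  · rw [← A.K_mul_sq hu, ← A.area u hu]
    congr 1
    simp only [α, β, Coframe.al, Coframe.be]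
    ring

theorem hasDerivAt_q_div (hu : u ∈ B.I) :
    HasDerivAt (fun u => A.q1 u / A.β u)
      (-(A.c * Real.exp (2 * B.Y u) * A.ξ.1) / A.β u ^ 2) u ∧
    HasDerivAt (fun u => A.q2 u / A.β u)
      (-(A.c * Real.exp (2 * B.Y u) * A.ξ.2) / A.β u ^ 2) u := by
  have hb := β_ne (A := A) hu
  refine ⟨((A.deriv_q1 u hu).fun_div (A.hasDerivAt_β hu) hb).congr_deriv ?_,
    ((A.deriv_q2 u hu).fun_div (A.hasDerivAt_β hu) hb).congr_deriv ?_⟩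
  · rw [← A.K_mul_sq hu, ← A.area u hu]
    congr 1
    simp only [α, β, Coframe.al, Coframe.be]
    ring
  · rw [← A.K_mul_sq hu, ← A.area u hu]
    congr 1
    simp only [α, β, Coframe.al, Coframe.be]
    ring

/-- This is the value that cancels the du² term c²e^{4Y}(ξ₁x + ξ₂y)²(1/α² + 1/β²) produced by the
moving transverse coordinates. -/
theorem hasDerivAt_shift (hu : u ∈ B.I) :
    HasDerivAt A.shift (A.c ^ 2 * Real.exp (2 * B.Y u) * (A.α u ^ 2 + A.β u ^ 2)
      / (A.α u * A.β u) ^ 2) u := by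
  have h0 := B.ne_zero hu
  refine ((((hasDerivAt_id' u).fun_pow 2).const_mul A.c).fun_div
    ((A.hasDerivAt_α hu).fun_mul (A.hasDerivAt_β hu)) (α_mul_β_pos hu).ne').fun_neg.congr_deriv ?_
  rw [← neg_div]
  congr 1
  push_cast
  have hr : u * (1 / u) = 1 := by field_simp
  linear_combination A.c * (A.α u ^ 2 + A.β u ^ 2) * A.K_mul_sq hu
    + 2 * A.c * u * A.α u * A.β u * hr

/-- In the pulled-back metric the dx^i dx^j terms rebuild h = EᵀE. The du dx^i terms amount to −2c
e^{2Y}u²ξ_i(ξ₁x + ξ₂y)/(αβ) and fix `shift` as −cu²/(αβ); the du² terms then cancel by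
`hasDerivAt_shift`. -/
theorem isCoordinateChange : IsCoordinateChange A.coordChange B.metric A.form.metric where
  smooth := A.smooth_toNew
  smooth_symm := A.smooth_toOld
  metric_eq := by
    intro p hp a b
    change p 0 ∈ B.I at hp
    have hα := α_ne (A := A) hp
    have hβ := β_ne (A := A) hp
    have hU := (deriv_radial_pos (A := A) hp).ne'
    have hg : B.metric p = !![0, -(Real.exp (2 * B.Y (p 0)) / 2), 0, 0;
        -(Real.exp (2 * B.Y (p 0)) / 2), 0, 0, 0;
        0, 0, A.p1 (p 0) ^ 2 + A.q1 (p 0) ^ 2, A.p1 (p 0) * A.p2 (p 0) + A.q1 (p 0) * A.q2 (p 0);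
        0, 0, A.p1 (p 0) * A.p2 (p 0) + A.q1 (p 0) * A.q2 (p 0),
          A.p2 (p 0) ^ 2 + A.q2 (p 0) ^ 2] := by
      rw [← A.a_eq _ hp, ← A.b_eq _ hp, ← A.d_eq _ hp]
      rfl
    have hJ0 : ∀ a, pd a (fun q => A.toNew q 0) p
        = (Pi.single a 1 : Coord) 0 * deriv A.radial (p 0) := fun a => by
      have h := pd_comp_zero (differentiableAt_of_contDiffOn B.isOpen A.smooth_radial hp) a
      refine h.trans ?_
      by_cases ha : a = 0
      · subst ha; simp
      · simp [ha, Ne.symm ha]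
    have hJ1 := pd_quadratic (A.hasDerivAt_shift hp) A.ξ.1 A.ξ.2
    have hJ2 := pd_linear (A.hasDerivAt_p_div hp).1 (A.hasDerivAt_p_div hp).2
    have hJ3 := pd_linear (A.hasDerivAt_q_div hp).1 (A.hasDerivAt_q_div hp).2
    change ∀ a, pd a (fun q => A.toNew q 1) p = _ at hJ1
    change ∀ a, pd a (fun q => A.toNew q 2) p = _ at hJ2
    change ∀ a, pd a (fun q => A.toNew q 3) p = _ at hJ3
    change B.metric p a b = ∑ c, ∑ d, pd a (fun q => A.toNew q c) p * pd b (fun q => A.toNew q d) p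
      * A.form.metric (A.toNew p) c d
    rw [A.form_metric hp rfl, hg]
    -- Cramer's rule for recovering ξ from α and β; needed only in the du dx and du dy entries.
    have hx1 : A.ξ.1 * p 0 ^ 2 = A.q1 (p 0) * A.α (p 0) - A.p1 (p 0) * A.β (p 0) := by
      rw [← A.area _ hp]; simp only [α, β, Coframe.al, Coframe.be]; ring
    have hx2 : A.ξ.2 * p 0 ^ 2 = A.q2 (p 0) * A.α (p 0) - A.p2 (p 0) * A.β (p 0) := by
      rw [← A.area _ hp]; simp only [α, β, Coframe.al, Coframe.be]; ring
    simp only [Fin.sum_univ_four, hJ0, hJ1, hJ2, hJ3, shift]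
    generalize Real.exp (2 * B.Y (p 0)) = E
    generalize A.α (p 0) = α at *
    generalize A.β (p 0) = β at *
    generalize deriv A.radial (p 0) = U at *
    fin_cases a <;> fin_cases b <;> simp
    all_goals field_simp
    all_goals first
      | ring1
      | linear_combination -(A.c * E * (A.ξ.1 * p 2 + A.ξ.2 * p 3)) * hx1
      | linear_combination -(A.c * E * (A.ξ.1 * p 2 + A.ξ.2 * p 3)) * hx2

end AlignedCoframe

/-! ### Conclusion -/

namespace BPRForm

variable {B : BPRForm}

/-- A linearly polarized vacuum wave with nowhere vanishing curvature has global coordinates with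
`W' = 0`. -/
theorem hasGlobalConstantWForm (hvac : IsVacuumOn B.metric B.region)
    (hweyl : WeylNowhereZeroOn B.metric B.region)
    (hlin : IsLinearlyPolarizedOn B.metric B.region) : HasGlobalConstantWForm B := by
  obtain ⟨A⟩ := exists_alignedCoframe hvac hweyl hlin
  exact ⟨A.form, A.coordChange, fun _ _ => deriv_const _ _, rfl, rfl, A.isCoordinateChange⟩

theorem hasLocalConstantWForm (h : HasGlobalConstantWForm B) : HasLocalConstantWForm B := by
  obtain ⟨B', e, hW, hs, ht, he⟩ := h
  exact fun p hp => ⟨B', e, hW, hs ▸ hp, hs.le, ht.le, he⟩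

end BPRForm
end PlaneWave

end

theorem lemma3 (B : PlaneWave.BPRForm)
    (hvac : PlaneWave.IsVacuumOn B.metric B.region)
    (hweyl : PlaneWave.WeylNowhereZeroOn B.metric B.region) :
    (PlaneWave.IsLinearlyPolarizedOn B.metric B.region ↔
        PlaneWave.HasGlobalConstantWForm B) ∧
      (PlaneWave.IsLinearlyPolarizedOn B.metric B.region ↔
        PlaneWave.HasLocalConstantWForm B) := by
  have h31 := PlaneWave.BPRForm.isLinearlyPolarizedOn_of_local hvac hweyl
  have h12 := PlaneWave.BPRForm.hasGlobalConstantWForm hvac hweyl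
  have h23 := PlaneWave.BPRForm.hasLocalConstantWForm (B := B)
  exact ⟨⟨h12, fun h => h31 (h23 h)⟩, ⟨fun h => h23 (h12 h), h31⟩⟩
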